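/- **Setting.** Let $m,n\ge 1$ and $\phi=m/n$. Let $X=(X_{ij})\in\mathbb R^{m\times n}$ be a random matrix with rows $X_1,\dots,X_m$, and let $\mathsf L,\mathcal F:\mathbb R^2\to\mathbb R$. Let $\mu^{(0)},\mu_\ast\in\mathbb R^n$, $\xi\in\mathbb R^m$ be fixed (equivalently: $X$ is independent of $(\mu^{(0)},\mu_\ast,\xi)$, and $\mathbb P^{(0)},\mathbb E^{(0)}$ are conditional on $(\mu^{(0)},\mu_\ast,\xi)$), and let $\eta_0,\eta_1,\ldots>0$ be step sizes. Put $Y_i=\mathcal F(\langle X_i,\mu_\ast\rangle,\xi_i)$ and $\mathfrak S(x_0,z_0,\xi_0)=\partial_1\mathsf L(x_0,\mathcal F(z_0,\xi_0))$; functions of vectors are applied componentwise. Here $\|\cdot\|$ is the Euclidean norm, $\|\cdot\|_{\mathrm{op}}$ the spectral norm, $\pi_m$ is uniform on $\{1,\dots,m\}$, $U$ is uniform on $[0,1]$, $\mathsf Z_n\sim\mathcal N(0,I_n)$, and these are independent of everything else. Starting from $\mu^{(0)}=\mathrm u_X^{(0)}=\mathrm u_\ast^{(0)}$, define for $t\ge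 1$ the gradient descent, the theoretical gradient descent and the state evolution (Gaussian theoretical gradient descent) by $$\mu^{(t)}=\mu^{(t-1)}-\tfrac{\eta_{t-1}}{m}X^\top\partial_1\mathsf L(X\mu^{(t-1)},Y),\qquad \mathrm u_X^{(t)}=\mathrm u_X^{(t-1)}-\tfrac{\eta_{t-1}}{m}\mathbb E^{(0)}X^\top\mathfrak S(X\mathrm u_X^{(t-1)},X\mu_\ast,\xi),$$ $$\mathrm u_\ast^{(t)}=(1-\eta_{t-1}\tau_\ast^{(t-1)})\,\mathrm u_\ast^{(t-1)}+\eta_{t-1}\delta_\ast^{(t-1)}\mu_\ast,$$ where $\tau_\ast^{(t-1)}=\mathbb E^{(0)}\partial_1\mathfrak S(\langle\mathsf Z_n,\mathrm u_\ast^{(t-1)}\rangle,\langle\mathsf Z_n,\mu_\ast\rangle,\xi_{\pi_m})$ and $\delta_\ast^{(t-1)}=-\mathbb E^{(0)}\partial_2\mathfrak S(\langle\mathsf Z_n,\mathrm u_\ast^{(t-1)}\rangle,\langle\mathsf Z_n,\mu_\ast\rangle,\xi_{\pi_m})$. For $\mathrm u,\mathrm v\in\mathbb R^n$ let $$M_{\mathrm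 u,\mathrm v}(X)=\mathbb E_{U,\pi_m}\,\partial_1\mathfrak S\big(\langle X_{\pi_m},U\mathrm u+(1-U)\mathrm v\rangle,\langle X_{\pi_m},\mu_\ast\rangle,\xi_{\pi_m}\big)X_{\pi_m}X_{\pi_m}^\top ,$$ and, for deterministic $\mathrm u,\mathrm v$, $\mathbb M^X_{\mathrm u,\mathrm v}=\mathbb E^{(0)}M_{\mathrm u,\mathrm v}(X)$. For sequences $\mathrm u^{(\cdot)},\mathrm v^{(\cdot)}$ let $$\mathfrak M^{(t)}_{\mathrm u^{(\cdot)},\mathrm v^{(\cdot)}}(X)=1+\max_{0\le\tau\le t}\sum_{s=0}^{\tau}\prod_{r=s}^{\tau}\big\|I_n-\eta_rM_{\mathrm u^{(r)},\mathrm v^{(r)}}(X)\big\|_{\mathrm{op}},$$ $$\mathscr M^{(t),X}_{\mathrm u^{(\cdot)},\mathrm v^{(\cdot)}}=1+\max_{0\le\tau\le t}\sum_{s=0}^{\tau}\prod_{r=s}^{\tau}\big\|I_n-\eta_r\mathbb M^X_{\mathrm u^{(r)},\mathrm v^{(r)}}\big\|_{\mathrm{op}} .$$ **Assumptions**, for some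 $K,\Lambda\ge2$ and an integer $\mathfrak p\ge1$: (A1) The entries $X_{ij}$ are independent, $\mathbb E X_{ij}=0$, $\mathrm{Var}(X_{ij})=1$, and $\|X_{ij}\|_{\psi_2}\le K$, where $\|V\|_{\psi_2}=\inf\{C>0:\mathbb E e^{V^2/C^2}\le2\}$. (A2) For all $i$ and $z$, $\mathsf L(\cdot,\mathcal F(z,\xi_i))$ is differentiable; for all $i$, $(x,z)\mapsto\mathfrak S(x,z,\xi_i)$ is $C^4$, and for every multi-index $\alpha\in\mathbb Z_{\ge0}^2$ with $|\alpha|\le4$ the function $f=\partial_\alpha\mathfrak S(\cdot,\cdot,\xi_i)$ satisfies $|f(0,0)|\le\Lambda$ and $|f(w)-f(w')|\le\Lambda(1+\|w\|+\|w'\|)^{\mathfrak p-1}\|w-w'\|$ for all $w,w'\in\mathbb R^2$. **Theorem.** There is a universal constant $c_0>1$, and for every integer $\mathfrak p\ge 1$ a constant $c_{\mathfrak p}>1$ depending only on $\mathfrak p$, such that under (A1)–(A2), for all $t\ge1$ and $x\ge1$, with $\mathbb P^{(0)}$-probability at least $1-c_0\,n\,t\,e^{-x}$, $$\|\mu^{(t)}-\mathrm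 u_\ast^{(t)}\|\le\Big(K\Lambda L_\ast^{(0)}\big(1\vee\max_{0\le s<t}\eta_s\big)x\Big)^{c_{\mathfrak p}}\Big(1+\max_{1\le s\le t-1}\big(n^{1/2}\|\mathrm u_\ast^{(s)}\|_\infty\vee\|\mathrm u_X^{(s)}\|\big)\Big)^{c_{\mathfrak p}}\Big\{\phi^{-1/2}\,\mathfrak M^{(t-1)}_{\mu^{(\cdot)},\mathrm u_X^{(\cdot)}}(X)+n^{-1/2}\mathscr M^{(t-1),X}_{\mathrm u_X^{(\cdot)},\mathrm u_\ast^{(\cdot)}}\Big\},$$ where $L_\ast^{(0)}=1+n^{1/2}\|\mu^{(0)}\|_\infty+n^{1/2}\|\mu_\ast\|_\infty$ and the maximum over the empty set (when $t=1$) is $0$. -/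

import Mathlib

open MeasureTheory ProbabilityTheory
open scoped ENNReal NNReal Matrix

noncomputable section

namespace NonconvexGD

/-- The maximum of a nonnegative function over a finite set, equal to `0` on the empty set. -/
def maxOver (I : Finset ℕ) (f : ℕ → ℝ) : ℝ := I.fold max 0 f

/-- The sup-norm `‖u‖_∞` (the norm of `Fin n → ℝ` is the sup-norm). -/
def linftyNorm {n : ℕ} (u : EuclideanSpace ℝ (Fin n)) : ℝ := ‖WithLp.ofLp u‖

/-- The spectral (`ℓ²`-operator) norm of a square matrix. -/
def opNorm {n : ℕ} (A : Matrix (Fin n) (Fin n) ℝ) : ℝ :=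
  ‖Matrix.toEuclideanCLM (n := Fin n) (𝕜 := ℝ) A‖

/-- The Orlicz-2 (sub-gaussian) norm `inf {C > 0 : E [exp ((V / C)²) - 1] ≤ 1}`,
with value `∞` if there is no such `C`. -/
def psiTwoNorm {Ω : Type*} [MeasurableSpace Ω] (P : Measure Ω) (V : Ω → ℝ) : ℝ≥0∞ :=
  ⨅ (C : ℝ≥0) (_ : 0 < C)
    (_ : ∫⁻ ω, ENNReal.ofReal (Real.exp ((V ω / C) ^ 2) - 1) ∂P ≤ 1), (C : ℝ≥0∞)

/-- `f` is `Λ`-pseudo-Lipschitz of order `p` (such an `f` is continuous, hence measurable).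
The norms are Euclidean. -/
def PseudoLipschitz {d : ℕ} (Λ : ℝ) (p : ℕ) (f : EuclideanSpace ℝ (Fin d) → ℝ) : Prop :=
  ∀ x y, |f x - f y| ≤ Λ * (1 + ‖x‖ + ‖y‖) ^ (p - 1) * ‖x - y‖

/-! ### The function `𝔖` and its partial derivatives -/

/-- Partial derivative in the first variable of a function of two variables. -/
def partialOne (f : ℝ → ℝ → ℝ) : ℝ → ℝ → ℝ := fun x z => deriv (fun s => f s z) x

/-- Partial derivative in the second variable of a function of two variables. -/
def partialTwo (f : ℝ → ℝ → ℝ) : ℝ → ℝ → ℝ := fun x z => deriv (fun s => f x s) z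

/-- The mixed partial derivative `∂_α f` for the multi-index `α = (a, b)`. -/
def partialMulti (a b : ℕ) (f : ℝ → ℝ → ℝ) : ℝ → ℝ → ℝ := partialOne^[a] (partialTwo^[b] f)

/-- `𝔖(x₀, z₀, ξ₀) = ∂₁L(x₀, F(z₀, ξ₀))`, as a function of `(x₀, z₀)` for a given `ξ₀`. -/
def score (L F : ℝ → ℝ → ℝ) (ξ₀ : ℝ) : ℝ → ℝ → ℝ := fun x z => partialOne L x (F z ξ₀)

/-! ### Assumptions -/

/-- The entries of the design `X` are independent, centred, of unit variance, and have
`ψ₂`-norm at most `K`. -/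
structure DesignAssumption {Ω : Type*} [MeasurableSpace Ω] (P : Measure Ω) {m n : ℕ}
    (X : Ω → Matrix (Fin m) (Fin n) ℝ) (K : ℝ) : Prop where
  measurable : ∀ i j, Measurable (fun ω => X ω i j)
  indep : iIndepFun (fun (ij : Fin m × Fin n) (ω : Ω) => X ω ij.1 ij.2) P
  mean_zero : ∀ i j, ∫ ω, X ω i j ∂P = 0
  unit_variance : ∀ i j, variance (fun ω => X ω i j) P = 1
  subgaussian : ∀ i j, psiTwoNorm P (fun ω => X ω i j) ≤ ENNReal.ofReal K

/-- For every `i`, `∂₁L(·, F(z, ξᵢ))` exists, the map `(x, z) ↦ 𝔖(x, z, ξᵢ)` has partial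
derivatives up to order `4`, and each `∂_α 𝔖(·, ·, ξᵢ)`, `|α| ≤ 4`, is `Λ`-pseudo-Lipschitz of
order `p` and bounded by `Λ` in absolute value at the origin. -/
structure ScoreAssumption {m : ℕ} (L F : ℝ → ℝ → ℝ) (ξ : Fin m → ℝ) (Λ : ℝ) (p : ℕ) : Prop where
  differentiable_loss : ∀ i z, Differentiable ℝ (fun s => L s (F z (ξ i)))
  contDiff : ∀ i, ContDiff ℝ 4 (fun q : ℝ × ℝ => score L F (ξ i) q.1 q.2)
  pseudoLipschitz : ∀ i (a b : ℕ), a + b ≤ 4 →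
    PseudoLipschitz Λ p
      (fun w : EuclideanSpace ℝ (Fin 2) => partialMulti a b (score L F (ξ i)) (w 0) (w 1))
  bound_at_zero : ∀ i (a b : ℕ), a + b ≤ 4 → |partialMulti a b (score L F (ξ i)) 0 0| ≤ Λ

/-! ### Gradient descent and its theoretical counterparts -/

/-- The responses `Yᵢ = F(⟨Xᵢ, μ⋆⟩, ξᵢ)`. -/
def response {m n : ℕ} (F : ℝ → ℝ → ℝ) (ξ : Fin m → ℝ) (μstar : EuclideanSpace ℝ (Fin n))
    (A : Matrix (Fin m) (Fin n) ℝ) : Fin m → ℝ :=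
  fun i => F ((A *ᵥ WithLp.ofLp μstar) i) (ξ i)

/-- Gradient descent on data `(A, Y)`:
`μ^(t) = μ^(t-1) - (η_{t-1} / m) Aᵀ ∂₁L(A μ^(t-1), Y)`. -/
def gradDescent {m n : ℕ} (L : ℝ → ℝ → ℝ) (η : ℕ → ℝ) (μ0 : EuclideanSpace ℝ (Fin n))
    (A : Matrix (Fin m) (Fin n) ℝ) (Y : Fin m → ℝ) : ℕ → EuclideanSpace ℝ (Fin n)
  | 0 => μ0
  | t + 1 =>
    let μ := gradDescent L η μ0 A Y t
    μ - (η t / m) • WithLp.toLp 2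
      (Aᵀ *ᵥ fun i => partialOne L ((A *ᵥ WithLp.ofLp μ) i) (Y i))

/-- The theoretical gradient descent
`u_X^(t) = u_X^(t-1) - (η_{t-1} / m) E[Xᵀ 𝔖(X u_X^(t-1), X μ⋆, ξ)]`. -/
def theoGradDescent {Ω : Type*} [MeasurableSpace Ω] (P : Measure Ω) {m n : ℕ}
    (X : Ω → Matrix (Fin m) (Fin n) ℝ) (L F : ℝ → ℝ → ℝ) (ξ : Fin m → ℝ) (η : ℕ → ℝ)
    (μ0 μstar : EuclideanSpace ℝ (Fin n)) : ℕ → EuclideanSpace ℝ (Fin n)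
  | 0 => μ0
  | t + 1 =>
    let u := theoGradDescent P X L F ξ η μ0 μstar t
    u - (η t / m) • WithLp.toLp 2 (fun j => ∫ ω,
      ((X ω)ᵀ *ᵥ fun i => score L F (ξ i) ((X ω *ᵥ WithLp.ofLp u) i)
        ((X ω *ᵥ WithLp.ofLp μstar) i)) j ∂P)

/-- `E f(⟨Z, u⟩, ⟨Z, v⟩, π)` for independent `Z ∼ N(0, I_n)` and `π` uniform on the `m` indices. -/
def gaussMean {m n : ℕ} (f : Fin m → ℝ → ℝ → ℝ) (u v : EuclideanSpace ℝ (Fin n)) : ℝ :=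
  (1 / (m : ℝ)) * ∑ i, ∫ z, f i (inner ℝ z u) (inner ℝ z v) ∂(stdGaussian (EuclideanSpace ℝ (Fin n)))

/-- The coefficient `τ⋆ = E ∂₁𝔖(⟨Z, u⟩, ⟨Z, μ⋆⟩, ξ_π)` at the current state `u`. -/
def tauStar {m n : ℕ} (L F : ℝ → ℝ → ℝ) (ξ : Fin m → ℝ)
    (μstar u : EuclideanSpace ℝ (Fin n)) : ℝ :=
  gaussMean (fun i => partialOne (score L F (ξ i))) u μstar

/-- The coefficient `δ⋆ = - E ∂₂𝔖(⟨Z, u⟩, ⟨Z, μ⋆⟩, ξ_π)` at the current state `u`. -/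
def deltaStar {m n : ℕ} (L F : ℝ → ℝ → ℝ) (ξ : Fin m → ℝ)
    (μstar u : EuclideanSpace ℝ (Fin n)) : ℝ :=
  - gaussMean (fun i => partialTwo (score L F (ξ i))) u μstar

/-- The state evolution
`u⋆^(t) = (1 - η_{t-1} τ⋆^(t-1)) u⋆^(t-1) + η_{t-1} δ⋆^(t-1) μ⋆`. -/
def stateEvolution {m n : ℕ} (L F : ℝ → ℝ → ℝ) (ξ : Fin m → ℝ) (η : ℕ → ℝ)
    (μ0 μstar : EuclideanSpace ℝ (Fin n)) : ℕ → EuclideanSpace ℝ (Fin n)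
  | 0 => μ0
  | t + 1 =>
    let u := stateEvolution L F ξ η μ0 μstar t
    (1 - η t * tauStar L F ξ μstar u) • u + (η t * deltaStar L F ξ μstar u) • μstar

/-! ### The matrices `M_{u,v}(X)`, `𝕄_{u,v}^X` and the growth quantities -/

/-- `M_{u,v}(A) = E_{U,π} ∂₁𝔖(⟨A_π, U u + (1 - U) v⟩, ⟨A_π, μ⋆⟩, ξ_π) A_π A_πᵀ`, with `U` uniform on
`[0, 1]` and `π` uniform on the `m` indices. -/
def empMatrix {m n : ℕ} (L F : ℝ → ℝ → ℝ) (ξ : Fin m → ℝ) (μstar : EuclideanSpace ℝ (Fin n))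
    (u v : EuclideanSpace ℝ (Fin n)) (A : Matrix (Fin m) (Fin n) ℝ) :
    Matrix (Fin n) (Fin n) ℝ :=
  Matrix.of fun j k => (1 / (m : ℝ)) * ∑ i, ∫ U in (0 : ℝ)..1,
    partialOne (score L F (ξ i)) ((A *ᵥ WithLp.ofLp (U • u + (1 - U) • v)) i)
      ((A *ᵥ WithLp.ofLp μstar) i) * (A i j * A i k)

/-- `𝕄_{u,v}^X = E M_{u,v}(X)`, the expectation of the previous matrix over `X` (entrywise), for
deterministic `u` and `v`. -/
def meanMatrix {Ω : Type*} [MeasurableSpace Ω] (P : Measure Ω) {m n : ℕ}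
    (X : Ω → Matrix (Fin m) (Fin n) ℝ) (L F : ℝ → ℝ → ℝ) (ξ : Fin m → ℝ)
    (μstar : EuclideanSpace ℝ (Fin n)) (u v : EuclideanSpace ℝ (Fin n)) :
    Matrix (Fin n) (Fin n) ℝ :=
  Matrix.of fun j k => ∫ ω, empMatrix L F ξ μstar u v (X ω) j k ∂P

/-- `1 + max_{τ ∈ [0:t]} ∑_{s ∈ [0:τ]} ∏_{r ∈ [s:τ]} ‖I_n - η_r B_r‖_op`. -/
def growth {n : ℕ} (η : ℕ → ℝ) (B : ℕ → Matrix (Fin n) (Fin n) ℝ) (t : ℕ) : ℝ :=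
  1 + maxOver (Finset.Icc 0 t) fun τ =>
    ∑ s ∈ Finset.Icc 0 τ, ∏ r ∈ Finset.Icc s τ, opNorm (1 - η r • B r)

/-- The random quantity `𝔐^(t)_{u,v}(A)` for two sequences `u`, `v`. -/
def empGrowth {m n : ℕ} (L F : ℝ → ℝ → ℝ) (ξ : Fin m → ℝ) (η : ℕ → ℝ)
    (μstar : EuclideanSpace ℝ (Fin n)) (u v : ℕ → EuclideanSpace ℝ (Fin n))
    (A : Matrix (Fin m) (Fin n) ℝ) (t : ℕ) : ℝ :=
  growth η (fun r => empMatrix L F ξ μstar (u r) (v r) A) t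

/-- The deterministic quantity `ℳ^(t),X_{u,v}` for two sequences `u`, `v`. -/
def meanGrowth {Ω : Type*} [MeasurableSpace Ω] (P : Measure Ω) {m n : ℕ}
    (X : Ω → Matrix (Fin m) (Fin n) ℝ) (L F : ℝ → ℝ → ℝ) (ξ : Fin m → ℝ) (η : ℕ → ℝ)
    (μstar : EuclideanSpace ℝ (Fin n)) (u v : ℕ → EuclideanSpace ℝ (Fin n)) (t : ℕ) : ℝ :=
  growth η (fun r => meanMatrix P X L F ξ μstar (u r) (v r)) t

/-- `L⋆^(0) = 1 + √n ‖μ^(0)‖_∞ + √n ‖μ⋆‖_∞`. -/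
def initialSize {n : ℕ} (μ0 μstar : EuclideanSpace ℝ (Fin n)) : ℝ :=
  1 + √(n : ℝ) * linftyNorm μ0 + √(n : ℝ) * linftyNorm μstar

end NonconvexGD

end

/-! The distance from gradient descent to the state evolution is split at the theoretical gradient
descent, and both halves are treated alike. By the fundamental theorem of calculus along the segment
between two points `u` and `v`, the difference of their empirical gradients is exactly `empMatrix`
applied to `u - v` (`empMatrix_mulVec`); taking expectations gives the same identity for
`meanMatrix` and population gradients (`meanMatrix_mulVec`). So each distance obeys `a (s+1) ≤ ‖I -
η B‖ a s + E`, and unrolling this recursion produces the growth factors (`le_mul_growth`). The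
source term `E` is a mismatch of two gradients at one and the same deterministic point, which is
what makes it tractable.

In the first half the mismatch is between the empirical and the population gradient at a theoretical
iterate. Since that iterate does not depend on `X`, each coordinate of the mismatch is an average of
`m` independent centred variables, of size `m^(-1/2)`; over `n` coordinates the norm is of order
`(n/m)^(1/2)`. The summands grow polynomially in sub-Gaussian variables and need not have
exponential moments, so tails come from even moments up to order `2k` with `k = ⌈x⌉`
(`momentBound_sum`, `MomentBound.measure_lt_le`) and a union bound over coordinates and steps.

In the second half the mismatch is between the population gradient and the state evolution
direction. For coefficient vectors with entries of size `n^(-1/2)`, approximate integration by parts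
(`stein_pi`) turns `E[x_j f]` into derivative expectations up to `O(1/n)`. Lindeberg replacement
(`lindeberg_pi`) then makes the design Gaussian at cost `n * n^(-3/2)`, which is multiplied by a
further `n^(-1/2)`. Each coordinate is thus off by `O(1/n)` (`gaussian_approx_pi`), the norm by
`O(n^(-1/2))`. Three derivatives of a first derivative of the score are used, hence the fourth order
smoothness.

All constants are finally dominated by powers of a single quantity `Z ≥ 2`. -/

namespace NonconvexGD

/-! ### Even moments -/

/-- The even moments of `f` up to order `2k` are dominated by the powers of `β`. -/
structure MomentBound {Ω : Type*} [MeasurableSpace Ω] (P : Measure Ω) (k : ℕ) (β : ℝ)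
    (f : Ω → ℝ) : Prop where
  measurable : Measurable f
  integrable : ∀ i ≤ k, Integrable (fun ω => f ω ^ (2 * i)) P
  le : ∀ i ≤ k, ∫ ω, f ω ^ (2 * i) ∂P ≤ β ^ i

/-- Multiplying by `s + v` sends the remainder at one exponent to the remainder at the next, plus an
explicit term in `v ^ 2`; induction then needs no calculus. -/
theorem abs_add_pow_taylor_le (s v : ℝ) (n : ℕ) :
    |(s + v) ^ (n + 2) - s ^ (n + 2) - (n + 2) * s ^ (n + 1) * v| ≤
      ((n + 2) * (n + 1) / 2) * v ^ 2 * (|s| + |v|) ^ n := by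
  induction n with
  | zero =>
    rw [show (s + v) ^ (0 + 2) - s ^ (0 + 2) - ((0 : ℕ) + 2) * s ^ (0 + 1) * v = v ^ 2 by
      push_cast; ring]
    rw [abs_of_nonneg (sq_nonneg v)]
    norm_num
  | succ n ih =>
    have e : (s + v) ^ (n + 1 + 2) - s ^ (n + 1 + 2) - ((n + 1 : ℕ) + 2) * s ^ (n + 1 + 1) * v =
        (s + v) * ((s + v) ^ (n + 2) - s ^ (n + 2) - (n + 2) * s ^ (n + 1) * v) +
          (n + 2) * (s ^ (n + 1) * v ^ 2) := by
      push_cast; ring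
    rw [e]
    have h1 : |s + v| ≤ |s| + |v| := abs_add_le s v
    have h2 : |s| ^ (n + 1) ≤ (|s| + |v|) ^ (n + 1) := by
      gcongr; linarith [abs_nonneg v]
    calc _ ≤ |(s + v) * ((s + v) ^ (n + 2) - s ^ (n + 2) - (n + 2) * s ^ (n + 1) * v)| +
          |(n + 2) * (s ^ (n + 1) * v ^ 2)| := abs_add_le _ _
      _ = |s + v| * |(s + v) ^ (n + 2) - s ^ (n + 2) - (n + 2) * s ^ (n + 1) * v| +
          (n + 2) * (|s| ^ (n + 1) * v ^ 2) := by
        rw [abs_mul, abs_mul, abs_mul, abs_pow, abs_of_nonneg (sq_nonneg v),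
          abs_of_nonneg (by positivity : (0 : ℝ) ≤ n + 2)]
      _ ≤ (|s| + |v|) * (((n + 2) * (n + 1) / 2) * v ^ 2 * (|s| + |v|) ^ n) +
          (n + 2) * ((|s| + |v|) ^ (n + 1) * v ^ 2) := by gcongr
      _ = _ := by push_cast; ring

theorem one_add_inv_four_sq_pow_le (k : ℕ) (hk : 1 ≤ k) :
    (1 + 1 / (4 * (k : ℝ) ^ 2)) ^ k ≤ 2 := by
  have hk' : (1 : ℝ) ≤ k := by exact_mod_cast hk
  have h1 : (1 + 1 / (4 * (k : ℝ) ^ 2)) ^ k ≤ Real.exp (1 / 4) := by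
    calc (1 + 1 / (4 * (k : ℝ) ^ 2)) ^ k ≤ Real.exp (1 / (4 * (k : ℝ) ^ 2)) ^ k := by
          gcongr; linarith [Real.add_one_le_exp (1 / (4 * (k : ℝ) ^ 2))]
      _ = Real.exp (k * (1 / (4 * (k : ℝ) ^ 2))) := by rw [← Real.exp_nat_mul]
      _ ≤ Real.exp (1 / 4) := by
          apply Real.exp_le_exp.2
          rw [mul_one_div, div_le_div_iff₀ (by positivity) (by positivity)]
          nlinarith
  have h2 : Real.exp (1 / 4) ≤ 2 := by
    have := Real.exp_one_lt_d9
    have h3 : Real.exp (1 / 4) ≤ Real.exp (Real.log 2) := by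
      apply Real.exp_le_exp.2
      linarith [Real.log_two_gt_d9]
    rwa [Real.exp_log (by norm_num)] at h3
  exact h1.trans h2

/-- The term linear in `v` is kept apart because it disappears in expectation when `v` is centred
and independent of `s`. The rest is absorbed into a binomial power in which `s ^ 2` has coefficient
exactly one, so that iterating over many summands does not compound constants. -/
theorem add_pow_two_mul_le (s v : ℝ) {i k : ℕ} (hi : 1 ≤ i) (hik : i ≤ k) :
    (s + v) ^ (2 * i) ≤ 2 * i * s ^ (2 * i - 1) * v + (s ^ 2 + 4 * (k : ℝ) ^ 2 * v ^ 2) ^ i := by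
  obtain ⟨j, rfl⟩ : ∃ j, i = j + 1 := ⟨i - 1, by omega⟩
  have hk' : ((j : ℝ) + 1) ≤ k := by exact_mod_cast hik
  have hk1 : (1 : ℝ) ≤ k := by exact_mod_cast hi.trans hik
  have hT := abs_le.1 (abs_add_pow_taylor_le s v (2 * j))
  set q : ℝ := s ^ 2 + 4 * (k : ℝ) ^ 2 * v ^ 2 with hq
  have hq0 : 0 ≤ q := by positivity
  -- Cauchy–Schwarz with weights `1` and `4k²`; its loss factor is so close to one that its `k`-th
  -- power stays below `2`.
  have hsv : (|s| + |v|) ^ 2 ≤ (1 + 1 / (4 * (k : ℝ) ^ 2)) * q := by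
    have h4 : (0 : ℝ) < 4 * (k : ℝ) ^ 2 := by positivity
    have e : (1 + 1 / (4 * (k : ℝ) ^ 2)) * q - (|s| + |v|) ^ 2 =
        (|s| / (2 * k) - 2 * k * |v|) ^ 2 := by
      rw [hq, ← sq_abs s, ← sq_abs v]
      field_simp
      ring
    nlinarith [sq_nonneg (|s| / (2 * k) - 2 * k * |v|)]
  have hpow : (|s| + |v|) ^ (2 * j) ≤ 2 * q ^ j := by
    rw [pow_mul]
    calc ((|s| + |v|) ^ 2) ^ j ≤ ((1 + 1 / (4 * (k : ℝ) ^ 2)) * q) ^ j := by gcongr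
      _ = (1 + 1 / (4 * (k : ℝ) ^ 2)) ^ j * q ^ j := mul_pow _ _ _
      _ ≤ (1 + 1 / (4 * (k : ℝ) ^ 2)) ^ k * q ^ j := by
          gcongr
          · linarith [show 0 ≤ 1 / (4 * (k : ℝ) ^ 2) by positivity]
          · omega
      _ ≤ 2 * q ^ j := by gcongr; exact one_add_inv_four_sq_pow_le k (hi.trans hik)
  have hs : s ^ (2 * j + 2) ≤ s ^ 2 * q ^ j := by
    rw [pow_add, mul_comm, pow_mul]
    have h5 : s ^ 2 ≤ q := by
      rw [hq]; linarith [show 0 ≤ 4 * (k : ℝ) ^ 2 * v ^ 2 by positivity]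
    exact mul_le_mul_of_nonneg_left (pow_le_pow_left₀ (sq_nonneg s) h5 j) (sq_nonneg s)
  have hmain : ((2 * j + 2 : ℝ) * (2 * j + 1) / 2) * v ^ 2 * (|s| + |v|) ^ (2 * j) ≤
      4 * (k : ℝ) ^ 2 * v ^ 2 * q ^ j := by
    calc _ ≤ ((2 * j + 2 : ℝ) * (2 * j + 1) / 2) * v ^ 2 * (2 * q ^ j) := by gcongr
      _ = ((2 * j + 2 : ℝ) * (2 * j + 1)) * (v ^ 2 * q ^ j) := by ring
      _ ≤ (4 * (k : ℝ) ^ 2) * (v ^ 2 * q ^ j) := by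
          refine mul_le_mul_of_nonneg_right ?_ (by positivity)
          nlinarith [show (0 : ℝ) ≤ j by positivity]
      _ = _ := by ring
  have hexp : q ^ (j + 1) = s ^ 2 * q ^ j + 4 * (k : ℝ) ^ 2 * v ^ 2 * q ^ j := by
    rw [pow_succ]; nth_rewrite 2 [hq]; ring
  have e1 : 2 * (j + 1) = 2 * j + 2 := by ring
  have e2 : 2 * (j + 1) - 1 = 2 * j + 1 := by omega
  rw [e2, hexp, e1]
  push_cast at hT ⊢
  linarith [hT.2]

section

variable {Ω : Type*} [MeasurableSpace Ω] {P : Measure Ω} {k : ℕ} {β γ : ℝ} {f g : Ω → ℝ}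

theorem MomentBound.mono (h : MomentBound P k β f) (hβ : 0 ≤ β) (hβγ : β ≤ γ) {k' : ℕ}
    (hk : k' ≤ k) : MomentBound P k' γ f :=
  ⟨h.measurable, fun i hi => h.integrable i (hi.trans hk),
    fun i hi => (h.le i (hi.trans hk)).trans (by gcongr)⟩

/-- Moments of `g` of order `2i` use moments of `f` of order `2ri`, so domination by an `r`-th power
consumes `r` times the order. -/
theorem MomentBound.of_abs_le_pow {r : ℕ} (h : MomentBound P (r * k) β f) (hg : Measurable g)
    {c : ℝ} (hc : 0 ≤ c) (hgf : ∀ ω, |g ω| ≤ c * |f ω| ^ r) :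
    MomentBound P k (c ^ 2 * β ^ r) g := by
  have key : ∀ i ω, g ω ^ (2 * i) ≤ c ^ (2 * i) * f ω ^ (2 * (r * i)) := by
    intro i ω
    have h1 : |g ω| ^ (2 * i) ≤ (c * |f ω| ^ r) ^ (2 * i) := by gcongr; exact hgf ω
    rw [Even.pow_abs (even_two_mul i), mul_pow, ← pow_mul] at h1
    rw [show 2 * (r * i) = r * (2 * i) by ring]
    rwa [← Even.pow_abs (show Even (r * (2 * i)) from ⟨r * i, by ring⟩)]
  have hint : ∀ i ≤ k, Integrable (fun ω => g ω ^ (2 * i)) P := by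
    intro i hi
    refine ((h.integrable (r * i) (Nat.mul_le_mul_left r hi)).const_mul (c ^ (2 * i))).mono'
      (hg.pow_const _).aestronglyMeasurable (ae_of_all _ fun ω => ?_)
    rw [Real.norm_eq_abs, abs_of_nonneg (Even.pow_nonneg (even_two_mul i) _)]
    exact key i ω
  refine ⟨hg, hint, fun i hi => ?_⟩
  calc ∫ ω, g ω ^ (2 * i) ∂P ≤ ∫ ω, c ^ (2 * i) * f ω ^ (2 * (r * i)) ∂P :=
        integral_mono (hint i hi)
          ((h.integrable (r * i) (Nat.mul_le_mul_left r hi)).const_mul _) (key i)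
    _ = c ^ (2 * i) * ∫ ω, f ω ^ (2 * (r * i)) ∂P := integral_const_mul _ _
    _ ≤ c ^ (2 * i) * β ^ (r * i) := by
        gcongr
        exact h.le _ (Nat.mul_le_mul_left r hi)
    _ = (c ^ 2 * β ^ r) ^ i := by rw [mul_pow, ← pow_mul, ← pow_mul]

theorem MomentBound.const_mul (h : MomentBound P k β f) (c : ℝ) :
    MomentBound P k (c ^ 2 * β) (fun ω => c * f ω) := by
  have := MomentBound.of_abs_le_pow (r := 1) (g := fun ω => c * f ω) (by simpa using h)
    (h.measurable.const_mul c) (abs_nonneg c) (fun ω => by simp [abs_mul])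
  simpa using this

theorem MomentBound.of_abs_le (h : MomentBound P k β f) (hg : Measurable g)
    (hgf : ∀ ω, |g ω| ≤ |f ω|) : MomentBound P k β g := by
  have := MomentBound.of_abs_le_pow (r := 1) (g := g) (c := 1) (by simpa using h)
    hg zero_le_one (fun ω => by simpa using hgf ω)
  simpa using this

theorem MomentBound.abs (h : MomentBound P k β f) : MomentBound P k β (fun ω => |f ω|) :=
  h.of_abs_le (measurable_norm.comp h.measurable) (fun ω => by simp)

theorem MomentBound.add [IsProbabilityMeasure P] (hf : MomentBound P k β f)
    (hg : MomentBound P k γ g) (hβ : 0 ≤ β) (hγ : 0 ≤ γ) :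
    MomentBound P k (4 * (β + γ)) (fun ω => f ω + g ω) := by
  have key : ∀ i, 1 ≤ i → ∀ ω, (f ω + g ω) ^ (2 * i) ≤
      2 ^ (2 * i - 1) * (f ω ^ (2 * i) + g ω ^ (2 * i)) := by
    intro i _ ω
    have h1 := add_pow_le (abs_nonneg (f ω)) (abs_nonneg (g ω)) (2 * i)
    rw [Even.pow_abs (even_two_mul i), Even.pow_abs (even_two_mul i)] at h1
    refine le_trans ?_ h1
    rw [← Even.pow_abs (even_two_mul i)]
    gcongr
    exact abs_add_le _ _
  have hm : Measurable (fun ω => f ω + g ω) := hf.measurable.add hg.measurable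
  have hint : ∀ i ≤ k, Integrable (fun ω => (f ω + g ω) ^ (2 * i)) P := by
    intro i hi
    rcases Nat.eq_zero_or_pos i with rfl | hi1
    · simp
    refine (((hf.integrable i hi).add (hg.integrable i hi)).const_mul (2 ^ (2 * i - 1))).mono'
      (hm.pow_const _).aestronglyMeasurable (ae_of_all _ fun ω => ?_)
    rw [Real.norm_eq_abs, abs_of_nonneg (Even.pow_nonneg (even_two_mul i) _)]
    exact key i hi1 ω
  have hsub : ∀ i : ℕ, 1 ≤ i → (2 : ℝ) ^ (2 * i - 1) * (β ^ i + γ ^ i) ≤ (4 * (β + γ)) ^ i := by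
    intro i hi
    have h1 : β ^ i + γ ^ i ≤ (β + γ) ^ i := pow_add_pow_le hβ hγ (by omega)
    calc (2 : ℝ) ^ (2 * i - 1) * (β ^ i + γ ^ i) ≤ 2 ^ (2 * i) * (β + γ) ^ i := by
          gcongr
          · norm_num
          · omega
      _ = (4 * (β + γ)) ^ i := by rw [pow_mul, ← mul_pow]; norm_num
  refine ⟨hm, hint, fun i hi => ?_⟩
  rcases Nat.eq_zero_or_pos i with rfl | hi1
  · simp
  calc ∫ ω, (f ω + g ω) ^ (2 * i) ∂P
      ≤ ∫ ω, 2 ^ (2 * i - 1) * (f ω ^ (2 * i) + g ω ^ (2 * i)) ∂P :=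
        integral_mono (hint i hi)
          (((hf.integrable i hi).add (hg.integrable i hi)).const_mul _) (key i hi1)
    _ = 2 ^ (2 * i - 1) * (∫ ω, f ω ^ (2 * i) ∂P + ∫ ω, g ω ^ (2 * i) ∂P) := by
        rw [integral_const_mul, integral_add (hf.integrable i hi) (hg.integrable i hi)]
    _ ≤ 2 ^ (2 * i - 1) * (β ^ i + γ ^ i) := by
        gcongr
        · exact hf.le i hi
        · exact hg.le i hi
    _ ≤ _ := hsub i hi1

theorem MomentBound.integrable_pow [IsProbabilityMeasure P] (h : MomentBound P k β f) {q : ℕ}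
    (hq : q ≤ 2 * k) : Integrable (fun ω => f ω ^ q) P := by
  have h1 := (integrable_const (1 : ℝ)).add (h.integrable k le_rfl)
  refine h1.mono' (h.measurable.pow_const _).aestronglyMeasurable (ae_of_all _ fun ω => ?_)
  rw [Real.norm_eq_abs, abs_pow]
  have h2 : f ω ^ (2 * k) = |f ω| ^ (2 * k) := (Even.pow_abs (even_two_mul k) _).symm
  simp only [Pi.add_apply, h2]
  rcases le_total |f ω| 1 with h3 | h3
  · linarith [pow_le_one₀ (n := q) (abs_nonneg (f ω)) h3, pow_nonneg (abs_nonneg (f ω)) (2 * k)]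
  · linarith [pow_le_pow_right₀ h3 hq]

theorem MomentBound.integrable_self [IsProbabilityMeasure P] (h : MomentBound P k β f)
    (hk : 1 ≤ k) : Integrable f P := by
  simpa using h.integrable_pow (q := 1) (by omega)

theorem MomentBound.nonneg (h : MomentBound P k β f) (hk : 1 ≤ k) : 0 ≤ β := by
  have := h.le 1 hk
  rw [pow_one] at this
  exact (integral_nonneg fun ω => Even.pow_nonneg (even_two_mul 1) _).trans this

theorem momentBound_const [IsProbabilityMeasure P] (k : ℕ) {c : ℝ} (hc : c ^ 2 ≤ β) :
    MomentBound P k β (fun _ : Ω => c) := by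
  refine ⟨measurable_const, fun i _ => integrable_const _, fun i _ => ?_⟩
  rw [integral_const, probReal_univ, one_smul, pow_mul]
  gcongr

theorem MomentBound.sq_integral_le [IsProbabilityMeasure P] (h : MomentBound P k β f)
    (hk : 1 ≤ k) : (∫ ω, f ω ∂P) ^ 2 ≤ β := by
  have h1 := h.le 1 hk
  have hi1 := h.integrable_self hk
  have hi2 := h.integrable 1 hk
  simp only [mul_one, pow_one] at h1 hi2
  set c := ∫ ω, f ω ∂P with hc
  have h2 : 0 ≤ ∫ ω, (f ω - c) ^ 2 ∂P := integral_nonneg fun ω => sq_nonneg _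
  have h3 : ∫ ω, (f ω - c) ^ 2 ∂P = ∫ ω, f ω ^ 2 ∂P - c ^ 2 := by
    have e : ∀ ω, (f ω - c) ^ 2 = f ω ^ 2 - 2 * c * f ω + c ^ 2 := fun ω => by ring
    simp_rw [e]
    have hs : Integrable (fun ω => f ω ^ 2 - 2 * c * f ω) P := hi2.sub (hi1.const_mul _)
    rw [integral_add hs (integrable_const _),
      integral_sub hi2 (hi1.const_mul _), integral_const_mul, integral_const, ← hc]
    simp only [probReal_univ, one_smul]; ring
  linarith

/-- In contrast to `MomentBound.add`, `β` enters with coefficient one. After `add_pow_two_mul_le`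
the linear term integrates to zero, and independence factors every binomial term, so the bounds
reassemble into a binomial power. -/
theorem MomentBound.add_indep [IsProbabilityMeasure P] (hf : MomentBound P k β f)
    (hg : MomentBound P k γ g) (hind : IndepFun f g P) (hg0 : ∫ ω, g ω ∂P = 0) :
    MomentBound P k (β + 4 * (k : ℝ) ^ 2 * γ) (fun ω => f ω + g ω) := by
  rcases Nat.eq_zero_or_pos k with rfl | hk
  · refine ⟨hf.measurable.add hg.measurable, fun i hi => ?_, fun i hi => ?_⟩ <;>
    · obtain rfl : i = 0 := by omega
      simp
  have hm : Measurable (fun ω => f ω + g ω) := hf.measurable.add hg.measurable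
  have hadd := hf.add hg (hf.nonneg hk) (hg.nonneg hk)
  refine ⟨hm, hadd.integrable, fun i hi => ?_⟩
  rcases Nat.eq_zero_or_pos i with rfl | hi1
  · simp
  have hcross : IndepFun (fun ω => f ω ^ (2 * i - 1)) g P :=
    hind.comp (φ := fun s : ℝ => s ^ (2 * i - 1)) (ψ := id) (by fun_prop) measurable_id
  have hci : Integrable (fun ω => f ω ^ (2 * i - 1) * g ω) P :=
    hcross.integrable_mul (hf.integrable_pow (by omega)) (hg.integrable_self hk)
  have hc0 : ∫ ω, f ω ^ (2 * i - 1) * g ω ∂P = 0 := by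
    have := hcross.integral_mul_eq_mul_integral
      (hf.measurable.pow_const _).aestronglyMeasurable hg.measurable.aestronglyMeasurable
    simp only [Pi.mul_apply] at this
    rw [show ∫ ω, f ω ^ (2 * i - 1) * g ω ∂P = _ from this, hg0, mul_zero]
  have hprod : ∀ a b : ℕ, IndepFun (fun ω => f ω ^ a) (fun ω => g ω ^ b) P := fun a b =>
    hind.comp (φ := fun s : ℝ => s ^ a) (ψ := fun s : ℝ => s ^ b) (by fun_prop) (by fun_prop)
  have hterm : ∀ l ∈ Finset.range (i + 1), Integrable (fun ω =>
      (4 * (k : ℝ) ^ 2) ^ (i - l) * i.choose l * (f ω ^ (2 * l) * g ω ^ (2 * (i - l)))) P := by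
    intro l hl
    have hl' := Finset.mem_range.1 hl
    exact ((hprod _ _).integrable_mul (hf.integrable l (by omega))
      (hg.integrable (i - l) (by omega))).const_mul _
  have hexp : ∀ ω, (f ω ^ 2 + 4 * (k : ℝ) ^ 2 * g ω ^ 2) ^ i = ∑ l ∈ Finset.range (i + 1),
      (4 * (k : ℝ) ^ 2) ^ (i - l) * i.choose l * (f ω ^ (2 * l) * g ω ^ (2 * (i - l))) := by
    intro ω
    rw [add_pow]
    refine Finset.sum_congr rfl fun l _ => ?_
    rw [mul_pow, pow_mul, pow_mul]; ring
  have hi2 : Integrable (fun ω => (f ω ^ 2 + 4 * (k : ℝ) ^ 2 * g ω ^ 2) ^ i) P := by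
    simp_rw [hexp]; exact integrable_finsetSum _ hterm
  calc ∫ ω, (f ω + g ω) ^ (2 * i) ∂P
      ≤ ∫ ω, (2 * i * (f ω ^ (2 * i - 1) * g ω) +
          (f ω ^ 2 + 4 * (k : ℝ) ^ 2 * g ω ^ 2) ^ i) ∂P := by
        refine integral_mono (hadd.integrable i hi) ((hci.const_mul _).add hi2) fun ω => ?_
        have := add_pow_two_mul_le (f ω) (g ω) hi1 hi
        simp only
        linarith
    _ = ∫ ω, (f ω ^ 2 + 4 * (k : ℝ) ^ 2 * g ω ^ 2) ^ i ∂P := by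
        rw [integral_add (hci.const_mul _) hi2, integral_const_mul, hc0]; simp
    _ = ∑ l ∈ Finset.range (i + 1), (4 * (k : ℝ) ^ 2) ^ (i - l) * i.choose l *
          ((∫ ω, f ω ^ (2 * l) ∂P) * ∫ ω, g ω ^ (2 * (i - l)) ∂P) := by
        simp_rw [hexp]
        rw [integral_finsetSum _ hterm]
        refine Finset.sum_congr rfl fun l _ => ?_
        rw [integral_const_mul]
        congr 1
        exact (hprod _ _).integral_mul_eq_mul_integral
          (hf.measurable.pow_const _).aestronglyMeasurable
          (hg.measurable.pow_const _).aestronglyMeasurable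
    _ ≤ ∑ l ∈ Finset.range (i + 1), (4 * (k : ℝ) ^ 2) ^ (i - l) * i.choose l *
          (β ^ l * γ ^ (i - l)) := by
        refine Finset.sum_le_sum fun l hl => ?_
        have hl' := Finset.mem_range.1 hl
        have h0 := hf.nonneg hk
        have := hf.le l (by omega)
        have := hg.le (i - l) (by omega)
        have : 0 ≤ ∫ ω, g ω ^ (2 * (i - l)) ∂P :=
          integral_nonneg fun ω => Even.pow_nonneg (even_two_mul _) _
        gcongr
    _ = (β + 4 * (k : ℝ) ^ 2 * γ) ^ i := by
        rw [add_pow]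
        refine Finset.sum_congr rfl fun l _ => ?_
        rw [mul_pow]; ring

theorem momentBound_sum [IsProbabilityMeasure P] {ι : Type*} {V : ι → Ω → ℝ} {b : ι → ℝ}
    (hV : ∀ i, MomentBound P k (b i) (V i)) (hind : iIndepFun V P)
    (h0 : ∀ i, ∫ ω, V i ω ∂P = 0) (s : Finset ι) :
    MomentBound P k (4 * (k : ℝ) ^ 2 * ∑ i ∈ s, b i) (fun ω => ∑ i ∈ s, V i ω) := by
  classical
  induction s using Finset.induction_on with
  | empty => simpa using momentBound_const k (P := P) (c := 0) (β := 0) (by norm_num)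
  | insert a s ha ih =>
    have hi : IndepFun (fun ω => ∑ i ∈ s, V i ω) (V a) P := by
      have := hind.indepFun_finsetSum_of_notMem (fun i => (hV i).measurable) ha
      convert this using 1
      ext ω; simp
    have := ih.add_indep (hV a) hi (h0 a)
    simp_rw [Finset.sum_insert ha]
    convert this using 1
    · ring
    · ext ω; ring

/-- Markov's inequality at the top order `2k`: the threshold `e √β` cancels `β ^ k` and leaves `e ^
(-2k)`. -/
theorem MomentBound.measure_lt_le [IsProbabilityMeasure P] (h : MomentBound P k β f)
    (hβ : 0 < β) : P.real {ω | Real.exp 1 * √β < |f ω|} ≤ Real.exp (-(2 * k)) := by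
  have h1 : {ω | Real.exp 1 * √β < |f ω|} ⊆
      {ω | (Real.exp 1 * √β) ^ (2 * k) ≤ f ω ^ (2 * k)} := by
    intro ω hω
    simp only [Set.mem_ofPred_eq] at hω ⊢
    rw [← Even.pow_abs (even_two_mul k) (f ω)]
    gcongr
  have h2 := mul_meas_ge_le_integral_of_nonneg (μ := P)
    (ae_of_all _ fun ω => Even.pow_nonneg (even_two_mul k) (f ω)) (h.integrable k le_rfl)
    ((Real.exp 1 * √β) ^ (2 * k))
  have h3 := h2.trans (h.le k le_rfl)
  rw [mul_pow, pow_mul (√β), Real.sq_sqrt hβ.le] at h3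
  have h4 : P.real {ω | (Real.exp 1 * √β) ^ (2 * k) ≤ f ω ^ (2 * k)} * Real.exp 1 ^ (2 * k) ≤ 1 := by
    rw [mul_pow, pow_mul (√β), Real.sq_sqrt hβ.le]
    have hb : 0 < β ^ k := by positivity
    nlinarith
  have h5 : Real.exp 1 ^ (2 * k) = Real.exp (2 * k) := by
    rw [← Real.exp_nat_mul]; push_cast; ring_nf
  rw [h5] at h4
  calc _ ≤ _ := measureReal_mono h1
    _ ≤ _ := by
      rw [Real.exp_neg, ← one_div, le_div_iff₀ (Real.exp_pos _)]
      exact h4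

/-- Since `f ≥ 1`, the `r`-th power is below the even power `2r`; odd exponents then need no
interpolation. -/
theorem MomentBound.integral_le_pow [IsProbabilityMeasure P] {r : ℕ} (h : MomentBound P r β f)
    (h1 : ∀ ω, 1 ≤ f ω) : Integrable (fun ω => f ω ^ r) P ∧ ∫ ω, f ω ^ r ∂P ≤ β ^ r := by
  have hi : Integrable (fun ω => f ω ^ r) P := h.integrable_pow (by omega)
  refine ⟨hi, (integral_mono hi (h.integrable r le_rfl) fun ω => ?_).trans (h.le r le_rfl)⟩
  exact pow_le_pow_right₀ (h1 ω) (by omega)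

end

/-! ### Functions of two variables with polynomial growth -/

/-- The directional derivative of a function of two variables. -/
noncomputable def dirDeriv (h₁ h₂ : ℝ) (f : ℝ → ℝ → ℝ) : ℝ → ℝ → ℝ :=
  fun x z => h₁ * partialOne f x z + h₂ * partialTwo f x z

/-- `f` is differentiable up to order `r` (and continuous if `r = 0`), and all its partial
derivatives of order at most `r` are dominated by `D (1 + |x| + |z|) ^ p`. -/
def SmoothGrowth (p : ℕ) : ℕ → ℝ → (ℝ → ℝ → ℝ) → Prop
  | 0, D, f => Continuous (fun q : ℝ × ℝ => f q.1 q.2) ∧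
      ∀ x z, |f x z| ≤ D * (1 + |x| + |z|) ^ p
  | r + 1, D, f => (Differentiable ℝ (fun q : ℝ × ℝ => f q.1 q.2) ∧
      ∀ x z, |f x z| ≤ D * (1 + |x| + |z|) ^ p) ∧
      SmoothGrowth p r D (partialOne f) ∧ SmoothGrowth p r D (partialTwo f)

section

variable {p r : ℕ} {D D' : ℝ} {f g : ℝ → ℝ → ℝ}

theorem SmoothGrowth.continuous (h : SmoothGrowth p r D f) :
    Continuous (fun q : ℝ × ℝ => f q.1 q.2) := by
  cases r with
  | zero => exact h.1
  | succ r => exact h.1.1.continuous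

theorem SmoothGrowth.bound (h : SmoothGrowth p r D f) (x z : ℝ) :
    |f x z| ≤ D * (1 + |x| + |z|) ^ p := by
  cases r with
  | zero => exact h.2 x z
  | succ r => exact h.1.2 x z

theorem SmoothGrowth.of_succ (h : SmoothGrowth p (r + 1) D f) : SmoothGrowth p r D f := by
  induction r generalizing f with
  | zero => exact ⟨h.continuous, h.bound⟩
  | succ r ih => exact ⟨h.1, ih h.2.1, ih h.2.2⟩

theorem SmoothGrowth.of_le {r' : ℕ} (h : SmoothGrowth p r D f) (hr : r' ≤ r) :
    SmoothGrowth p r' D f := by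
  induction r, hr using Nat.le_induction with
  | base => exact h
  | succ r _ ih => exact ih h.of_succ

theorem differentiable_left (h : Differentiable ℝ (fun q : ℝ × ℝ => f q.1 q.2)) (z : ℝ) :
    Differentiable ℝ (fun s => f s z) :=
  h.comp (f := fun s : ℝ => (s, z)) (by fun_prop)

theorem differentiable_right (h : Differentiable ℝ (fun q : ℝ × ℝ => f q.1 q.2)) (x : ℝ) :
    Differentiable ℝ (fun s => f x s) :=
  h.comp (f := fun s : ℝ => (x, s)) (by fun_prop)

theorem SmoothGrowth.abs_linear_comb_le (hf : SmoothGrowth p r D f) (hg : SmoothGrowth p r D' g)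
    (a b x z : ℝ) :
    |a * f x z + b * g x z| ≤ (|a| * D + |b| * D') * (1 + |x| + |z|) ^ p := by
  calc |a * f x z + b * g x z| ≤ |a * f x z| + |b * g x z| := abs_add_le _ _
    _ = |a| * |f x z| + |b| * |g x z| := by rw [abs_mul, abs_mul]
    _ ≤ |a| * (D * (1 + |x| + |z|) ^ p) + |b| * (D' * (1 + |x| + |z|) ^ p) := by
        gcongr
        · exact hf.bound x z
        · exact hg.bound x z
    _ = _ := by ring

theorem SmoothGrowth.linear_comb (hf : SmoothGrowth p r D f) (hg : SmoothGrowth p r D' g)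
    (a b : ℝ) : SmoothGrowth p r (|a| * D + |b| * D') (fun x z => a * f x z + b * g x z) := by
  have bd := hf.abs_linear_comb_le hg a b
  induction r generalizing f g with
  | zero => exact ⟨(hf.1.const_mul a |>.add (hg.1.const_mul b) :), bd⟩
  | succ r ih =>
    have e1 : partialOne (fun x z => a * f x z + b * g x z) =
        fun x z => a * partialOne f x z + b * partialOne g x z := by
      funext x z
      simp only [partialOne]
      rw [deriv_fun_add ((differentiable_left hf.1.1 z x).const_mul a)
        ((differentiable_left hg.1.1 z x).const_mul b), deriv_const_mul_field,
        deriv_const_mul_field]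
    have e2 : partialTwo (fun x z => a * f x z + b * g x z) =
        fun x z => a * partialTwo f x z + b * partialTwo g x z := by
      funext x z
      simp only [partialTwo]
      rw [deriv_fun_add ((differentiable_right hf.1.1 x z).const_mul a)
        ((differentiable_right hg.1.1 x z).const_mul b), deriv_const_mul_field,
        deriv_const_mul_field]
    refine ⟨⟨(hf.1.1.const_mul a).add (hg.1.1.const_mul b), bd⟩, ?_, ?_⟩
    · rw [e1]; exact ih hf.2.1 hg.2.1 (hf.2.1.abs_linear_comb_le hg.2.1 a b)
    · rw [e2]; exact ih hf.2.2 hg.2.2 (hf.2.2.abs_linear_comb_le hg.2.2 a b)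

/-- Each directional derivative gains a factor `|h₁| + |h₂|`. With `h₁, h₂` the `j`-th coefficients
of the linear forms, this is where powers of `n^(-1/2)` originate. -/
theorem SmoothGrowth.directional (h : SmoothGrowth p (r + 1) D f) (h₁ h₂ : ℝ) :
    SmoothGrowth p r ((|h₁| + |h₂|) * D) (dirDeriv h₁ h₂ f) := by
  rw [add_mul]
  exact h.2.1.linear_comb h.2.2 h₁ h₂

theorem fderiv_apply_one_zero (h : Differentiable ℝ (fun q : ℝ × ℝ => f q.1 q.2)) (x z : ℝ) :
    fderiv ℝ (fun q : ℝ × ℝ => f q.1 q.2) (x, z) (1, 0) = partialOne f x z := by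
  have h1 : HasDerivAt (fun s : ℝ => (s, z)) ((1 : ℝ), (0 : ℝ)) x :=
    (hasDerivAt_id x).prodMk (hasDerivAt_const x z)
  exact (((h (x, z)).hasFDerivAt.comp_hasDerivAt x h1).deriv).symm

theorem fderiv_apply_zero_one (h : Differentiable ℝ (fun q : ℝ × ℝ => f q.1 q.2)) (x z : ℝ) :
    fderiv ℝ (fun q : ℝ × ℝ => f q.1 q.2) (x, z) (0, 1) = partialTwo f x z := by
  have h1 : HasDerivAt (fun s : ℝ => (x, s)) ((0 : ℝ), (1 : ℝ)) z :=
    (hasDerivAt_const z x).prodMk (hasDerivAt_id z)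
  exact (((h (x, z)).hasFDerivAt.comp_hasDerivAt z h1).deriv).symm

theorem hasDerivAt_line (h : Differentiable ℝ (fun q : ℝ × ℝ => f q.1 q.2)) (a b h₁ h₂ s : ℝ) :
    HasDerivAt (fun s => f (a + s * h₁) (b + s * h₂))
      (dirDeriv h₁ h₂ f (a + s * h₁) (b + s * h₂)) s := by
  have h1 : HasDerivAt (fun s : ℝ => (a + s * h₁, b + s * h₂)) (h₁, h₂) s := by
    have e1 : HasDerivAt (fun s : ℝ => a + s * h₁) h₁ s := by
      simpa using ((hasDerivAt_id s).mul_const h₁).const_add a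
    have e2 : HasDerivAt (fun s : ℝ => b + s * h₂) h₂ s := by
      simpa using ((hasDerivAt_id s).mul_const h₂).const_add b
    exact e1.prodMk e2
  have h2 := (h (a + s * h₁, b + s * h₂)).hasFDerivAt.comp_hasDerivAt s h1
  have e : fderiv ℝ (fun q : ℝ × ℝ => f q.1 q.2) (a + s * h₁, b + s * h₂) (h₁, h₂) =
      dirDeriv h₁ h₂ f (a + s * h₁) (b + s * h₂) := by
    have : ((h₁, h₂) : ℝ × ℝ) = h₁ • (1, 0) + h₂ • (0, 1) := by simp
    rw [this, map_add, map_smul, map_smul, fderiv_apply_one_zero h, fderiv_apply_zero_one h]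
    rfl
  rw [e] at h2
  exact h2

/-! ### One-dimensional Taylor estimates -/

theorem abs_sub_le_of_deriv_bound {φ φ' : ℝ → ℝ} {B S : ℝ}
    (hφ : ∀ s, HasDerivAt φ (φ' s) s) (hB : ∀ s, |s| ≤ S → |φ' s| ≤ B) {s : ℝ} (hs : |s| ≤ S) :
    |φ s - φ 0| ≤ B * S := by
  have hS : 0 ≤ S := (abs_nonneg s).trans hs
  have hB0 : 0 ≤ B := (abs_nonneg _).trans (hB s hs)
  have h1 := (convex_Icc (-S) S).norm_image_sub_le_of_norm_hasDerivWithin_le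
    (f := φ) (f' := φ') (C := B) (fun y _ => (hφ y).hasDerivWithinAt)
    (fun y hy => hB y (abs_le.2 hy)) (x := 0) (y := s) ⟨by linarith, hS⟩ (abs_le.1 hs)
  rw [Real.norm_eq_abs, Real.norm_eq_abs, sub_zero] at h1
  exact h1.trans (by gcongr)

/-- The mean value inequality for the function minus its linear part; iterating it loses the
factorials of Taylor's formula, which do not matter here. -/
theorem abs_taylor_one_le {φ φ₁ φ₂ : ℝ → ℝ} {B S : ℝ} (h0 : ∀ s, HasDerivAt φ (φ₁ s) s)
    (h1 : ∀ s, HasDerivAt φ₁ (φ₂ s) s) (hB : ∀ s, |s| ≤ S → |φ₂ s| ≤ B) {s : ℝ} (hs : |s| ≤ S) :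
    |φ s - φ 0 - φ₁ 0 * s| ≤ B * S * S := by
  have := abs_sub_le_of_deriv_bound (φ := fun s => φ s - φ₁ 0 * s) (φ' := fun s => φ₁ s - φ₁ 0)
    (B := B * S) (S := S) (fun s => by
      have := (h0 s).sub ((hasDerivAt_id s).const_mul (φ₁ 0))
      rw [mul_one] at this
      exact this)
    (fun s hs => abs_sub_le_of_deriv_bound h1 hB hs) hs
  convert this using 2
  ring

theorem abs_taylor_two_le {φ φ₁ φ₂ φ₃ : ℝ → ℝ} {B S : ℝ} (h0 : ∀ s, HasDerivAt φ (φ₁ s) s)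
    (h1 : ∀ s, HasDerivAt φ₁ (φ₂ s) s) (h2 : ∀ s, HasDerivAt φ₂ (φ₃ s) s)
    (hB : ∀ s, |s| ≤ S → |φ₃ s| ≤ B) {s : ℝ} (hs : |s| ≤ S) :
    |φ s - φ 0 - φ₁ 0 * s - φ₂ 0 / 2 * s ^ 2| ≤ B * S * S * S := by
  have := abs_sub_le_of_deriv_bound (φ := fun s => φ s - φ₁ 0 * s - φ₂ 0 / 2 * s ^ 2)
    (φ' := fun s => φ₁ s - φ₁ 0 - φ₂ 0 * s)
    (B := B * S * S) (S := S) (fun s => by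
      have := ((h0 s).sub ((hasDerivAt_id s).const_mul (φ₁ 0))).sub
        ((hasDerivAt_pow 2 s).const_mul (φ₂ 0 / 2))
      refine this.congr_deriv ?_
      push_cast; ring)
    (fun s hs => abs_taylor_one_le h1 h2 hB hs) hs
  convert this using 2
  ring

theorem SmoothGrowth.line_bound (h : SmoothGrowth p r D f) (hD : 0 ≤ D) (a b h₁ h₂ : ℝ) {s S : ℝ}
    (hs : |s| ≤ S) :
    |f (a + s * h₁) (b + s * h₂)| ≤ D * (1 + |a| + |b| + (|h₁| + |h₂|) * S) ^ p := by
  refine (h.bound _ _).trans ?_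
  have h3 : |a + s * h₁| ≤ |a| + S * |h₁| := by
    refine (abs_add_le _ _).trans ?_
    rw [abs_mul]; gcongr
  have h4 : |b + s * h₂| ≤ |b| + S * |h₂| := by
    refine (abs_add_le _ _).trans ?_
    rw [abs_mul]; gcongr
  refine mul_le_mul_of_nonneg_left (pow_le_pow_left₀ (by positivity) ?_ p) hD
  linarith

/-- The size of the second order Taylor terms that control Gaussian integration by parts. -/
theorem SmoothGrowth.stein_remainder (h : SmoothGrowth p 2 D f) (hD : 0 ≤ D) (a b h₁ h₂ s : ℝ) :
    |s * f (a + s * h₁) (b + s * h₂) - dirDeriv h₁ h₂ f (a + s * h₁) (b + s * h₂)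
        - f a b * s - dirDeriv h₁ h₂ f a b * (s ^ 2 - 1)| ≤
      ((|h₁| + |h₂|) ^ 2 * D) * (1 + |a| + |b| + (|h₁| + |h₂|) * |s|) ^ p * (|s| ^ 3 + |s|) := by
  have d0 := hasDerivAt_line h.1.1 a b h₁ h₂
  have g1 := h.directional h₁ h₂
  have d1 := hasDerivAt_line g1.1.1 a b h₁ h₂
  have g2 := g1.directional h₁ h₂
  have hB : ∀ s' : ℝ, |s'| ≤ |s| → _ := fun s' hs' =>
    g2.line_bound (by positivity) a b h₁ h₂ hs'
  have t1 := abs_taylor_one_le d0 d1 hB le_rfl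
  have t2 := abs_sub_le_of_deriv_bound d1 hB le_rfl
  simp only [zero_mul, add_zero] at t1 t2
  set B := (|h₁| + |h₂|) * ((|h₁| + |h₂|) * D) * (1 + |a| + |b| + (|h₁| + |h₂|) * |s|) ^ p with hBd
  -- The subtracted terms, multiples of `s` and `s ^ 2 - 1`, are those killed by mean zero and unit
  -- variance; what is left is a first order remainder of `f` and a zeroth order remainder of its
  -- derivative.
  calc _ = |s * (f (a + s * h₁) (b + s * h₂) - f a b - dirDeriv h₁ h₂ f a b * s) -
        (dirDeriv h₁ h₂ f (a + s * h₁) (b + s * h₂) -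
          dirDeriv h₁ h₂ f a b)| := by congr 1; ring
    _ ≤ |s| * |f (a + s * h₁) (b + s * h₂) - f a b - dirDeriv h₁ h₂ f a b * s| +
        |dirDeriv h₁ h₂ f (a + s * h₁) (b + s * h₂) -
          dirDeriv h₁ h₂ f a b| := by
        rw [← abs_mul]; exact abs_sub _ _
    _ ≤ |s| * (B * |s| * |s|) + B * |s| := by gcongr
    _ = _ := by rw [hBd]; ring

/-- The size of the third order Taylor terms that control the replacement of one coordinate. -/
theorem SmoothGrowth.lindeberg_remainder (h : SmoothGrowth p 3 D f) (hD : 0 ≤ D)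
    (a b h₁ h₂ s : ℝ) :
    |f (a + s * h₁) (b + s * h₂) - f a b - dirDeriv h₁ h₂ f a b * s
        - dirDeriv h₁ h₂ (dirDeriv h₁ h₂ f) a b / 2 * s ^ 2| ≤
      ((|h₁| + |h₂|) ^ 3 * D) * (1 + |a| + |b| + (|h₁| + |h₂|) * |s|) ^ p * |s| ^ 3 := by
  have d0 := hasDerivAt_line h.1.1 a b h₁ h₂
  have g1 := h.directional h₁ h₂
  have d1 := hasDerivAt_line g1.1.1 a b h₁ h₂
  have g2 := g1.directional h₁ h₂
  have d2 := hasDerivAt_line g2.1.1 a b h₁ h₂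
  have g3 := g2.directional h₁ h₂
  have hB : ∀ s' : ℝ, |s'| ≤ |s| → _ := fun s' hs' =>
    g3.line_bound (by positivity) a b h₁ h₂ hs'
  have t1 := abs_taylor_two_le d0 d1 d2 hB le_rfl
  simp only [zero_mul, add_zero] at t1
  refine t1.trans (le_of_eq ?_)
  ring

/-! ### The score has polynomial growth -/

theorem contDiff_partialOne {n : ℕ} (h : ContDiff ℝ (n + 1) (fun q : ℝ × ℝ => f q.1 q.2)) :
    ContDiff ℝ n (fun q : ℝ × ℝ => partialOne f q.1 q.2) := by
  have hd : Differentiable ℝ (fun q : ℝ × ℝ => f q.1 q.2) := h.differentiable (by simp)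
  have e : (fun q : ℝ × ℝ => partialOne f q.1 q.2) =
      fun q => fderiv ℝ (fun q : ℝ × ℝ => f q.1 q.2) q (1, 0) := by
    ext ⟨x, z⟩; exact (fderiv_apply_one_zero hd x z).symm
  rw [e]
  exact (h.fderiv_right le_rfl).clm_apply contDiff_const

theorem contDiff_partialTwo {n : ℕ} (h : ContDiff ℝ (n + 1) (fun q : ℝ × ℝ => f q.1 q.2)) :
    ContDiff ℝ n (fun q : ℝ × ℝ => partialTwo f q.1 q.2) := by
  have hd : Differentiable ℝ (fun q : ℝ × ℝ => f q.1 q.2) := h.differentiable (by simp)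
  have e : (fun q : ℝ × ℝ => partialTwo f q.1 q.2) =
      fun q => fderiv ℝ (fun q : ℝ × ℝ => f q.1 q.2) q (0, 1) := by
    ext ⟨x, z⟩; exact (fderiv_apply_zero_one hd x z).symm
  rw [e]
  exact (h.fderiv_right le_rfl).clm_apply contDiff_const

theorem partialTwo_partialOne (h : ContDiff ℝ 2 (fun q : ℝ × ℝ => f q.1 q.2)) :
    partialTwo (partialOne f) = partialOne (partialTwo f) := by
  have hd : Differentiable ℝ (fun q : ℝ × ℝ => f q.1 q.2) := h.differentiable (by simp)
  have h1 := contDiff_partialOne (n := 1) (by exact_mod_cast h)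
  have h2 := contDiff_partialTwo (n := 1) (by exact_mod_cast h)
  have hF : Differentiable ℝ (fderiv ℝ (fun q : ℝ × ℝ => f q.1 q.2)) :=
    (h.fderiv_right (m := 1) (by norm_num)).differentiable (by simp)
  funext x z
  have hs : IsSymmSndFDerivAt ℝ (fun q : ℝ × ℝ => f q.1 q.2) (x, z) :=
    h.contDiffAt.isSymmSndFDerivAt (by simp)
  rw [← fderiv_apply_zero_one (h1.differentiable (by simp)),
    ← fderiv_apply_one_zero (h2.differentiable (by simp))]
  have e1 : (fun q : ℝ × ℝ => partialOne f q.1 q.2) =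
      fun q => fderiv ℝ (fun q : ℝ × ℝ => f q.1 q.2) q (1, 0) := by
    ext ⟨x, z⟩; exact (fderiv_apply_one_zero hd x z).symm
  have e2 : (fun q : ℝ × ℝ => partialTwo f q.1 q.2) =
      fun q => fderiv ℝ (fun q : ℝ × ℝ => f q.1 q.2) q (0, 1) := by
    ext ⟨x, z⟩; exact (fderiv_apply_zero_one hd x z).symm
  rw [e1, e2, fderiv_clm_apply (hF _) (by fun_prop), fderiv_clm_apply (hF _) (by fun_prop)]
  simp only [fderiv_fun_const, Pi.zero_apply, ContinuousLinearMap.comp_zero, zero_add,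
    ContinuousLinearMap.flip_apply]
  exact hs _ _

theorem contDiff_partialTwo_iterate {N : ℕ} (b : ℕ) {f : ℝ → ℝ → ℝ}
    (h : ContDiff ℝ (N + b : ℕ) (fun q : ℝ × ℝ => f q.1 q.2)) :
    ContDiff ℝ N (fun q : ℝ × ℝ => (partialTwo^[b] f) q.1 q.2) := by
  induction b generalizing f with
  | zero => simpa using h
  | succ b ih =>
    rw [Function.iterate_succ_apply]
    exact ih (contDiff_partialTwo (by exact_mod_cast h))

theorem contDiff_partialMulti {N : ℕ} (a b : ℕ) {f : ℝ → ℝ → ℝ}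
    (h : ContDiff ℝ (N + a + b : ℕ) (fun q : ℝ × ℝ => f q.1 q.2)) :
    ContDiff ℝ N (fun q : ℝ × ℝ => partialMulti a b f q.1 q.2) := by
  induction a generalizing N with
  | zero => exact contDiff_partialTwo_iterate b h
  | succ a ih =>
    have e : partialMulti (a + 1) b f = partialOne (partialMulti a b f) := by
      simp [partialMulti, Function.iterate_succ_apply']
    rw [e]
    have h2 := ih (N := N + 1) (by rw [show N + 1 + a + b = N + (a + 1) + b by ring]; exact h)
    exact contDiff_partialOne (by exact_mod_cast h2)

/-- In `partialMulti` the derivatives in the second variable are taken first, whereas `SmoothGrowth`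
allows any order. Symmetry of second derivatives carries `partialTwo` past the `a` outer derivatives
one at a time. -/
theorem partialTwo_partialMulti (a b : ℕ) {f : ℝ → ℝ → ℝ}
    (h : ContDiff ℝ (a + b + 1 : ℕ) (fun q : ℝ × ℝ => f q.1 q.2)) :
    partialTwo (partialMulti a b f) = partialMulti a (b + 1) f := by
  induction a with
  | zero => simp [partialMulti, Function.iterate_succ_apply']
  | succ a ih =>
    have h2 : ContDiff ℝ 2 (fun q : ℝ × ℝ => partialMulti a b f q.1 q.2) :=
      contDiff_partialMulti (N := 2) a b (h.of_le (by exact_mod_cast (by omega)))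
    have e : ∀ c, partialMulti (a + 1) c f = partialOne (partialMulti a c f) := fun c => by
      simp [partialMulti, Function.iterate_succ_apply']
    rw [e, e, partialTwo_partialOne h2, ih (h.of_le (by exact_mod_cast (by omega)))]

end

theorem PseudoLipschitz.growth {p : ℕ} (hp : 1 ≤ p) {Λ : ℝ} (hΛ : 0 ≤ Λ)
    {f : EuclideanSpace ℝ (Fin 2) → ℝ} (h : PseudoLipschitz Λ p f) (h0 : |f 0| ≤ Λ) (x z : ℝ) :
    |f !₂[x, z]| ≤ 2 * Λ * (1 + |x| + |z|) ^ p := by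
  have hn : ‖(!₂[x, z] : EuclideanSpace ℝ (Fin 2))‖ ≤ |x| + |z| := by
    rw [EuclideanSpace.norm_eq, Real.sqrt_le_left (by positivity)]
    simp only [Fin.sum_univ_two]
    simp
    nlinarith [sq_abs x, sq_abs z, abs_nonneg x, abs_nonneg z,
      mul_nonneg (abs_nonneg x) (abs_nonneg z)]
  have h1 := h !₂[x, z] 0
  rw [norm_zero, add_zero, sub_zero] at h1
  have hT : 1 ≤ 1 + |x| + |z| := by linarith [abs_nonneg x, abs_nonneg z]
  have h2 : |f !₂[x, z]| ≤ |f !₂[x, z] - f 0| + |f 0| := by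
    have := abs_add_le (f !₂[x, z] - f 0) (f 0)
    rwa [sub_add_cancel] at this
  have h3 : Λ * (1 + ‖(!₂[x, z] : EuclideanSpace ℝ (Fin 2))‖) ^ (p - 1) *
      ‖(!₂[x, z] : EuclideanSpace ℝ (Fin 2))‖ ≤
      Λ * ((1 + |x| + |z|) ^ (p - 1) * (1 + |x| + |z|)) := by
    rw [mul_assoc]
    refine mul_le_mul_of_nonneg_left (mul_le_mul (pow_le_pow_left₀ (by positivity) ?_ _) ?_
      (norm_nonneg _) (by positivity)) hΛ <;> linarith
  -- Truncated subtraction: for `p = 0` this would fail, hence `1 ≤ p`.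
  have h4 : (1 + |x| + |z|) ^ (p - 1) * (1 + |x| + |z|) = (1 + |x| + |z|) ^ p := by
    rw [← pow_succ]; congr 1; omega
  have h5 : Λ ≤ Λ * (1 + |x| + |z|) ^ p := le_mul_of_one_le_right hΛ (one_le_pow₀ hT)
  rw [h4] at h3
  linarith

theorem ScoreAssumption.smoothGrowth {m p : ℕ} (hp : 1 ≤ p) {L F : ℝ → ℝ → ℝ} {ξ : Fin m → ℝ}
    {Λ : ℝ} (hΛ : 0 ≤ Λ) (h : ScoreAssumption L F ξ Λ p) (i : Fin m) :
    SmoothGrowth p 4 (2 * Λ) (score L F (ξ i)) := by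
  have hb : ∀ a b : ℕ, a + b ≤ 4 → ∀ x z,
      |partialMulti a b (score L F (ξ i)) x z| ≤ 2 * Λ * (1 + |x| + |z|) ^ p := by
    intro a b hab x z
    have := (h.pseudoLipschitz i a b hab).growth hp hΛ (by simpa using h.bound_at_zero i a b hab) x z
    simpa using this
  have hc : ContDiff ℝ (4 : ℕ) (fun q : ℝ × ℝ => score L F (ξ i) q.1 q.2) := h.contDiff i
  have key : ∀ r a b : ℕ, a + b + r ≤ 4 →
      SmoothGrowth p r (2 * Λ) (partialMulti a b (score L F (ξ i))) := by
    intro r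
    induction r with
    | zero =>
      intro a b hab
      exact ⟨(contDiff_partialMulti (N := 0) a b
        (hc.of_le (by exact_mod_cast (by omega)))).continuous, hb a b (by omega)⟩
    | succ r ih =>
      intro a b hab
      refine ⟨⟨(contDiff_partialMulti (N := 1) a b
        (hc.of_le (by exact_mod_cast (by omega)))).differentiable (by simp),
        hb a b (by omega)⟩, ?_, ?_⟩
      · have := ih (a + 1) b (by omega)
        simpa [partialMulti, Function.iterate_succ_apply'] using this
      · rw [partialTwo_partialMulti a b (hc.of_le (by exact_mod_cast (by omega)))]
        exact ih a (b + 1) (by omega)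
  simpa [partialMulti] using key 4 0 0 (by omega)

theorem MomentBound.comp {Ω Ω' : Type*} [MeasurableSpace Ω] [MeasurableSpace Ω'] {P : Measure Ω}
    {Q : Measure Ω'} {k : ℕ} {β : ℝ} {f : Ω' → ℝ} {φ : Ω → Ω'} (h : MomentBound Q k β f)
    (mp : MeasurePreserving φ P Q) : MomentBound P k β (fun ω => f (φ ω)) := by
  refine ⟨h.measurable.comp mp.measurable, fun i hi => ?_, fun i hi => ?_⟩
  · exact mp.integrable_comp_of_integrable (h.integrable i hi)
  · refine le_trans (le_of_eq ?_) (h.le i hi)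
    rw [← mp.map_eq, integral_map mp.measurable.aemeasurable
      (h.measurable.pow_const _).aestronglyMeasurable]

/-! ### Product measures -/

section

variable {ι : Type*} [Fintype ι]

/-- A law on the line that is centred, has unit variance and has sub-exponential moments. -/
structure StandardMoments (κ : ℝ) (ρ : Measure ℝ) : Prop where
  prob : IsProbabilityMeasure ρ
  mean : ∫ s, s ∂ρ = 0
  var : ∫ s, s ^ 2 ∂ρ = 1
  moments : ∀ k : ℕ, MomentBound ρ k (κ * (k : ℝ) ^ 2) (fun s => s)

/-- The linear form with coefficient vector `u`. -/
noncomputable def lin (u x : ι → ℝ) : ℝ := ∑ i, x i * u i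

/-- The sum of squares of the coordinates. -/
noncomputable def sumSq (u : ι → ℝ) : ℝ := ∑ i, u i ^ 2

theorem continuous_lin (u : ι → ℝ) : Continuous (lin u) := by
  unfold lin; fun_prop

theorem sumSq_nonneg (u : ι → ℝ) : 0 ≤ sumSq u := Finset.sum_nonneg fun _ _ => sq_nonneg _

/-- The random variable whose powers dominate all the functions below. -/
noncomputable def envelope (u v : ι → ℝ) (j : ι) (x : ι → ℝ) : ℝ :=
  1 + |lin u x| + |lin v x| + |x j|

/-- The moment parameter of `envelope`. -/
noncomputable def envBound (κ : ℝ) (k : ℕ) (U : ℝ) : ℝ := 256 * κ * (k : ℝ) ^ 4 * (1 + U)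

variable {κ : ℝ}

theorem momentBound_envelope_of {Ω : Type*} [MeasurableSpace Ω] {P : Measure Ω}
    [IsProbabilityMeasure P] {k : ℕ} (hk : 1 ≤ k) (hκ : 1 ≤ κ) {a b s : Ω → ℝ} {U V : ℝ}
    (ha : MomentBound P k (4 * κ * (k : ℝ) ^ 4 * U) a)
    (hb : MomentBound P k (4 * κ * (k : ℝ) ^ 4 * V) b)
    (hs : MomentBound P k (κ * (k : ℝ) ^ 2) s) :
    MomentBound P k (envBound κ k (U + V)) (fun ω => 1 + |a ω| + |b ω| + |s ω|) := by
  have h0 := momentBound_const (P := P) k (c := 1) (β := 1) (by norm_num)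
  have na := ha.nonneg hk
  have nb := hb.nonneg hk
  have ns := hs.nonneg hk
  have h1 := h0.add ha.abs zero_le_one na
  have h2 := h1.add hb.abs (by positivity) nb
  have h3 := h2.add hs.abs (by positivity) ns
  refine h3.mono (by positivity) ?_ le_rfl
  -- The three nested sums give `64 + 64 β_a + 16 β_b + 4 β_s`; with the `4` inside `β_a` this
  -- explains the constant `256`.
  unfold envBound
  have hk' : (1 : ℝ) ≤ k := by exact_mod_cast hk
  have e1 : (1 : ℝ) ≤ κ * (k : ℝ) ^ 4 := by
    nlinarith [one_le_pow₀ (n := 4) hk']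
  have e2 : κ * (k : ℝ) ^ 2 ≤ κ * (k : ℝ) ^ 4 :=
    mul_le_mul_of_nonneg_left (pow_le_pow_right₀ hk' (by norm_num)) (by linarith)
  nlinarith

theorem momentBound_lin {ν : ι → Measure ℝ} (hν : ∀ i, StandardMoments κ (ν i)) (u : ι → ℝ)
    (k : ℕ) : MomentBound (Measure.pi ν) k (4 * κ * (k : ℝ) ^ 4 * sumSq u) (lin u) := by
  have : ∀ i, IsProbabilityMeasure (ν i) := fun i => (hν i).prob
  have hc : ∀ i, MomentBound (Measure.pi ν) k (u i ^ 2 * (κ * (k : ℝ) ^ 2))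
      (fun x => u i * x i) := fun i =>
    (((hν i).moments k).comp (measurePreserving_eval ν i)).const_mul (u i)
  have hind : iIndepFun (fun i (x : ι → ℝ) => u i * x i) (Measure.pi ν) :=
    iIndepFun_pi (μ := ν) (X := fun i s => u i * s) (fun i => by fun_prop)
  have h0 : ∀ i, ∫ x, u i * x i ∂(Measure.pi ν) = 0 := by
    intro i
    rw [integral_const_mul, integral_comp_eval (μ := ν) (i := i) (f := fun s => s)
      aestronglyMeasurable_id, (hν i).mean, mul_zero]
  have h := momentBound_sum hc hind h0 Finset.univ
  convert h using 1
  · rw [← Finset.sum_mul, sumSq]; ring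
  · ext x; simp only [lin, mul_comm]

theorem momentBound_envelope {ν : ι → Measure ℝ} (hν : ∀ i, StandardMoments κ (ν i)) (hκ : 1 ≤ κ)
    (u v : ι → ℝ) (j : ι) {k : ℕ} (hk : 1 ≤ k) :
    MomentBound (Measure.pi ν) k (envBound κ k (sumSq u + sumSq v)) (envelope u v j) := by
  have : ∀ i, IsProbabilityMeasure (ν i) := fun i => (hν i).prob
  exact momentBound_envelope_of hk hκ (momentBound_lin hν u k) (momentBound_lin hν v k)
    (((hν j).moments k).comp (measurePreserving_eval ν j))

theorem one_le_envelope (u v : ι → ℝ) (j : ι) (x : ι → ℝ) : 1 ≤ envelope u v j x := by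
  unfold envelope
  linarith [abs_nonneg (lin u x), abs_nonneg (lin v x), abs_nonneg (x j)]

theorem integrable_of_le_envelope {ν : ι → Measure ℝ} (hν : ∀ i, StandardMoments κ (ν i))
    (hκ : 1 ≤ κ) {u v : ι → ℝ} {j : ι} {F : (ι → ℝ) → ℝ} (hF : Continuous F) {C : ℝ} {q : ℕ}
    (h : ∀ x, |F x| ≤ C * envelope u v j x ^ q) : Integrable F (Measure.pi ν) := by
  have : ∀ i, IsProbabilityMeasure (ν i) := fun i => (hν i).prob
  have h1 := (momentBound_envelope hν hκ u v j (k := q + 1) (by omega)).integrable_pow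
    (q := q) (by omega)
  exact (h1.const_mul C).mono' hF.aestronglyMeasurable (ae_of_all _ h)

theorem abs_integral_le_of_le_envelope {ν : ι → Measure ℝ} (hν : ∀ i, StandardMoments κ (ν i))
    (hκ : 1 ≤ κ) {u v : ι → ℝ} {j : ι} {F : (ι → ℝ) → ℝ} {C : ℝ} (hC : 0 ≤ C) {q : ℕ}
    (hq : 1 ≤ q) (h : ∀ x, |F x| ≤ C * envelope u v j x ^ q) :
    |∫ x, F x ∂(Measure.pi ν)| ≤ C * envBound κ q (sumSq u + sumSq v) ^ q := by
  have : ∀ i, IsProbabilityMeasure (ν i) := fun i => (hν i).prob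
  have h1 := (momentBound_envelope hν hκ u v j hq).integral_le_pow (one_le_envelope u v j)
  calc |∫ x, F x ∂(Measure.pi ν)| ≤ ∫ x, C * envelope u v j x ^ q ∂(Measure.pi ν) := by
        rw [← Real.norm_eq_abs]
        exact norm_integral_le_of_norm_le (h1.1.const_mul C) (ae_of_all _ h)
    _ = C * ∫ x, envelope u v j x ^ q ∂(Measure.pi ν) := integral_const_mul _ _
    _ ≤ _ := by gcongr; exact h1.2

/-- The part of the linear form that does not involve the coordinate `j`. -/
noncomputable def linRest (u : ι → ℝ) (j : ι) (x : ι → ℝ) : ℝ := lin u x - x j * u j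

theorem continuous_linRest (u : ι → ℝ) (j : ι) : Continuous (linRest u j) := by
  unfold linRest
  exact (continuous_lin u).sub (by fun_prop)

theorem lin_eq_linRest_add (u : ι → ℝ) (j : ι) (x : ι → ℝ) :
    lin u x = linRest u j x + x j * u j := by
  unfold linRest; ring

theorem linRest_le_envelope (u v : ι → ℝ) (j : ι) (x : ι → ℝ) :
    1 + |linRest u j x| + |linRest v j x| + (|u j| + |v j|) * |x j| ≤
      (1 + 2 * (|u j| + |v j|)) * envelope u v j x := by
  have h1 : ∀ w : ι → ℝ, |linRest w j x| ≤ |lin w x| + |w j| * |x j| := by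
    intro w
    unfold linRest
    refine (abs_sub _ _).trans ?_
    rw [abs_mul, mul_comm |x j|]
  have := h1 u
  have := h1 v
  unfold envelope
  have e1 := mul_nonneg (abs_nonneg (u j)) (abs_nonneg (lin u x))
  have e2 := mul_nonneg (abs_nonneg (u j)) (abs_nonneg (lin v x))
  have e3 := mul_nonneg (abs_nonneg (v j)) (abs_nonneg (lin u x))
  have e4 := mul_nonneg (abs_nonneg (v j)) (abs_nonneg (lin v x))
  nlinarith [abs_nonneg (u j), abs_nonneg (v j), abs_nonneg (x j)]

theorem abs_coord_le_envelope (u v : ι → ℝ) (j : ι) (x : ι → ℝ) :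
    |x j| ≤ envelope u v j x := by
  unfold envelope
  linarith [abs_nonneg (lin u x), abs_nonneg (lin v x)]

variable [DecidableEq ι]

theorem linRest_update (u : ι → ℝ) (j : ι) (x : ι → ℝ) (s : ℝ) :
    linRest u j (Function.update x j s) = linRest u j x := by
  unfold linRest lin
  rw [← Finset.add_sum_erase _ _ (Finset.mem_univ j), ← Finset.add_sum_erase _ _ (Finset.mem_univ j)]
  simp only [add_sub_cancel_left]
  refine Finset.sum_congr rfl fun i hi => ?_
  rw [Function.update_of_ne (Finset.ne_of_mem_erase hi)]


/-- Resampling coordinate `j` from `ρ` changes only the `j`-th marginal. Both the independence of `x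
j` from functions not involving it and the invariance of their integrals under a change of that
marginal follow from this. -/
theorem pi_map_update (ν : ι → Measure ℝ) [∀ i, IsProbabilityMeasure (ν i)] (j : ι)
    (ρ : Measure ℝ) [IsProbabilityMeasure ρ] :
    ((Measure.pi ν).prod ρ).map (fun q : (ι → ℝ) × ℝ => Function.update q.1 j q.2) =
      Measure.pi (Function.update ν j ρ) := by
  have : ∀ i, IsProbabilityMeasure (Function.update ν j ρ i) := by
    intro i
    by_cases h : i = j
    · subst h; simpa
    · simpa [h] using inferInstanceAs (IsProbabilityMeasure (ν i))
  have hm : Measurable (fun q : (ι → ℝ) × ℝ => Function.update q.1 j q.2) := by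
    refine measurable_pi_lambda _ fun i => ?_
    by_cases h : i = j
    · subst h; simpa using measurable_snd
    · simpa [h, Function.comp_def] using (measurable_pi_apply i).comp measurable_fst
  symm
  refine Measure.pi_eq fun s hs => ?_
  rw [Measure.map_apply hm (MeasurableSet.univ_pi hs)]
  have e : (fun q : (ι → ℝ) × ℝ => Function.update q.1 j q.2) ⁻¹' Set.univ.pi s =
      (Set.univ.pi (Function.update s j Set.univ)) ×ˢ s j := by
    ext ⟨x, y⟩
    simp only [Set.mem_preimage, Set.mem_pi, Set.mem_univ, true_imp_iff, Set.mem_prod]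
    constructor
    · intro h
      refine ⟨fun i => ?_, by simpa using h j⟩
      by_cases hi : i = j
      · subst hi; simp
      · simpa [hi] using h i
    · rintro ⟨h, hj⟩ i
      by_cases hi : i = j
      · subst hi; simpa using hj
      · simpa [hi] using h i
  rw [e, Measure.prod_prod, Measure.pi_pi, ← Finset.mul_prod_erase _ _ (Finset.mem_univ j),
    ← Finset.mul_prod_erase _ _ (Finset.mem_univ j)]
  simp only [Function.update_self, measure_univ, one_mul]
  rw [mul_comm]
  congr 1
  refine Finset.prod_congr rfl fun i hi => ?_
  have : i ≠ j := Finset.ne_of_mem_erase hi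
  simp [this]

variable {ν : ι → Measure ℝ} {j : ι} {ρ : Measure ℝ}

theorem integral_pi_update [∀ i, IsProbabilityMeasure (ν i)] [IsProbabilityMeasure ρ]
    {F : (ι → ℝ) → ℝ} (hF : Measurable F) :
    ∫ x, F x ∂(Measure.pi (Function.update ν j ρ)) =
      ∫ q, F (Function.update q.1 j q.2) ∂((Measure.pi ν).prod ρ) := by
  rw [← pi_map_update, integral_map _ hF.aestronglyMeasurable]
  refine Measurable.aemeasurable (measurable_pi_lambda _ fun i => ?_)
  by_cases h : i = j
  · subst h; simpa using measurable_snd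
  · simpa [h, Function.comp_def] using (measurable_pi_apply i).comp measurable_fst

theorem integral_pi_update_of_invariant [∀ i, IsProbabilityMeasure (ν i)]
    [IsProbabilityMeasure ρ] {G : (ι → ℝ) → ℝ} (hG : Measurable G)
    (hinv : ∀ x s, G (Function.update x j s) = G x) :
    ∫ x, G x ∂(Measure.pi (Function.update ν j ρ)) = ∫ x, G x ∂(Measure.pi ν) := by
  rw [integral_pi_update hG]
  simp_rw [hinv]
  have := integral_prod_mul (μ := Measure.pi ν) (ν := ρ) G (fun _ => 1)
  simpa using this

theorem integral_pi_mul_of_invariant [∀ i, IsProbabilityMeasure (ν i)] {G : (ι → ℝ) → ℝ}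
    {ψ : ℝ → ℝ} (hG : Measurable G) (hψ : Measurable ψ)
    (hinv : ∀ x s, G (Function.update x j s) = G x) :
    ∫ x, G x * ψ (x j) ∂(Measure.pi ν) = (∫ x, G x ∂(Measure.pi ν)) * ∫ s, ψ s ∂(ν j) := by
  have h1 := integral_pi_update (ν := ν) (j := j) (ρ := ν j) (F := fun x => G x * ψ (x j))
    (hG.mul (hψ.comp (measurable_pi_apply j)))
  rw [Function.update_eq_self] at h1
  rw [h1]
  simp_rw [hinv, Function.update_self]
  exact integral_prod_mul (μ := Measure.pi ν) (ν := ν j) G ψ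


end

/-! ### Approximate integration by parts and universality -/

section

variable {ι : Type*} [Fintype ι] {κ D : ℝ} {p r : ℕ} {f : ℝ → ℝ → ℝ} {ν : ι → Measure ℝ}

theorem SmoothGrowth.continuous_comp (h : SmoothGrowth p r D f) {Ω : Type*} [TopologicalSpace Ω]
    {a b : Ω → ℝ} (ha : Continuous a) (hb : Continuous b) : Continuous (fun x => f (a x) (b x)) :=
  h.continuous.comp (ha.prodMk hb)

theorem SmoothGrowth.bound_lin (h : SmoothGrowth p r D f) (hD : 0 ≤ D) (u v : ι → ℝ) (j : ι)
    (x : ι → ℝ) : |f (lin u x) (lin v x)| ≤ D * envelope u v j x ^ p := by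
  refine (h.bound _ _).trans ?_
  refine mul_le_mul_of_nonneg_left (pow_le_pow_left₀ (by positivity) ?_ p) hD
  unfold envelope; linarith [abs_nonneg (x j)]

theorem SmoothGrowth.bound_linRest (h : SmoothGrowth p r D f) (hD : 0 ≤ D) (u v : ι → ℝ) (j : ι)
    (x : ι → ℝ) : |f (linRest u j x) (linRest v j x)| ≤
      D * (1 + 2 * (|u j| + |v j|)) ^ p * envelope u v j x ^ p := by
  refine (h.bound _ _).trans ?_
  rw [mul_assoc, ← mul_pow]
  refine mul_le_mul_of_nonneg_left (pow_le_pow_left₀ (by positivity) ?_ p) hD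
  have := linRest_le_envelope u v j x
  have : 0 ≤ (|u j| + |v j|) * |x j| := by positivity
  linarith

theorem SmoothGrowth.integrable_lin (h : SmoothGrowth p r D f) (hD : 0 ≤ D)
    (hν : ∀ i, StandardMoments κ (ν i)) (hκ : 1 ≤ κ) (u v : ι → ℝ) (j : ι) :
    Integrable (fun x => f (lin u x) (lin v x)) (Measure.pi ν) :=
  integrable_of_le_envelope hν hκ (h.continuous_comp (continuous_lin u) (continuous_lin v))
    (h.bound_lin hD u v j)

theorem SmoothGrowth.integrable_coord_mul_lin (h : SmoothGrowth p r D f) (hD : 0 ≤ D)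
    (hν : ∀ i, StandardMoments κ (ν i)) (hκ : 1 ≤ κ) (u v : ι → ℝ) (j : ι) :
    Integrable (fun x => x j * f (lin u x) (lin v x)) (Measure.pi ν) := by
  refine integrable_of_le_envelope (u := u) (v := v) (j := j) (C := D) (q := p + 1) hν hκ
    ((continuous_apply j).mul (h.continuous_comp (continuous_lin u) (continuous_lin v)))
    fun x => ?_
  rw [abs_mul, pow_succ]
  have h1 := h.bound_lin hD u v j x
  have h2 := abs_coord_le_envelope u v j x
  calc |x j| * |f (lin u x) (lin v x)| ≤ envelope u v j x * (D * envelope u v j x ^ p) := by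
        gcongr
        exact (abs_nonneg _).trans h2
    _ = _ := by ring

/-- The common size of the remainders in the replacement of a coordinate. -/
noncomputable def coordError (κ D : ℝ) (p : ℕ) (U h : ℝ) : ℝ :=
  2 * D * (1 + 2 * h) ^ p * envBound κ (p + 3) U ^ (p + 3)

theorem SmoothGrowth.integrable_linRest_mul_pow (h : SmoothGrowth p r D f) (hD : 0 ≤ D)
    (hν : ∀ i, StandardMoments κ (ν i)) (hκ : 1 ≤ κ) (u v : ι → ℝ) (j : ι) (q : ℕ) :
    Integrable (fun x => f (linRest u j x) (linRest v j x) * x j ^ q) (Measure.pi ν) := by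
  refine integrable_of_le_envelope (u := u) (v := v) (j := j)
    (C := D * (1 + 2 * (|u j| + |v j|)) ^ p) (q := p + q) hν hκ
    ((h.continuous_comp (continuous_linRest u j) (continuous_linRest v j)).mul
      ((continuous_apply j).pow q)) fun x => ?_
  rw [abs_mul, pow_add, abs_pow, ← mul_assoc]
  have h2 := abs_coord_le_envelope u v j x
  have h3 := h.bound_linRest hD u v j x
  gcongr
  exact (abs_nonneg _).trans h3

variable [DecidableEq ι]

theorem SmoothGrowth.integral_linRest_mul (h : SmoothGrowth p r D f)
    (hν : ∀ i, StandardMoments κ (ν i)) (u v : ι → ℝ) (j : ι) {ψ : ℝ → ℝ} (hψ : Measurable ψ) :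
    ∫ x, f (linRest u j x) (linRest v j x) * ψ (x j) ∂(Measure.pi ν) =
      (∫ x, f (linRest u j x) (linRest v j x) ∂(Measure.pi ν)) * ∫ s, ψ s ∂(ν j) := by
  have : ∀ i, IsProbabilityMeasure (ν i) := fun i => (hν i).prob
  refine integral_pi_mul_of_invariant (G := fun x => f (linRest u j x) (linRest v j x))
    (h.continuous_comp (continuous_linRest u j) (continuous_linRest v j)).measurable hψ ?_
  intro x s
  simp only [linRest_update]

/-- Both integrands are expanded around the point with coordinate `j` removed, which is independent
of `x j`. Matching the Gaussian mean and variance suffices to cancel the leading terms; the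
remainder is quadratic in the `j`-th coefficients. -/
theorem stein_pi (h : SmoothGrowth p 2 D f) (hD : 0 ≤ D) (hν : ∀ i, StandardMoments κ (ν i))
    (hκ : 1 ≤ κ) (u v : ι → ℝ) (j : ι) :
    |∫ x, x j * f (lin u x) (lin v x) ∂(Measure.pi ν) -
        ∫ x, dirDeriv (u j) (v j) f (lin u x) (lin v x) ∂(Measure.pi ν)| ≤
      (|u j| + |v j|) ^ 2 * coordError κ D p (sumSq u + sumSq v) (|u j| + |v j|) := by
  have : ∀ i, IsProbabilityMeasure (ν i) := fun i => (hν i).prob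
  have g1 := h.directional (u j) (v j)
  have hD1 : 0 ≤ (|u j| + |v j|) * D := by positivity
  set G0 := fun x : ι → ℝ => f (linRest u j x) (linRest v j x) with hG0
  set G1 := fun x : ι → ℝ => dirDeriv (u j) (v j) f (linRest u j x) (linRest v j x) with hG1
  have i1 := h.integrable_coord_mul_lin hD hν hκ u v j
  have i2 := g1.integrable_lin hD1 hν hκ u v j
  have i3 : Integrable (fun x => G0 x * x j) (Measure.pi ν) := by
    simpa using h.integrable_linRest_mul_pow hD hν hκ u v j 1
  have i4 : Integrable (fun x => G1 x * (x j ^ 2 - 1)) (Measure.pi ν) := by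
    have a := g1.integrable_linRest_mul_pow hD1 hν hκ u v j 2
    have b := g1.integrable_linRest_mul_pow hD1 hν hκ u v j 0
    refine (a.sub b).congr (ae_of_all _ fun x => ?_)
    simp only [Pi.sub_apply, hG1]; ring
  have z3 : ∫ x, G0 x * x j ∂(Measure.pi ν) = 0 := by
    rw [h.integral_linRest_mul hν u v j (ψ := fun s => s) measurable_id, (hν j).mean, mul_zero]
  have z4 : ∫ x, G1 x * (x j ^ 2 - 1) ∂(Measure.pi ν) = 0 := by
    rw [g1.integral_linRest_mul hν u v j (ψ := fun s => s ^ 2 - 1) (by fun_prop),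
      integral_sub (((hν j).moments 1).integrable_pow (by norm_num)) (integrable_const _),
      (hν j).var]
    simp
  have e : ∫ x, x j * f (lin u x) (lin v x) ∂(Measure.pi ν) -
        ∫ x, dirDeriv (u j) (v j) f (lin u x) (lin v x) ∂(Measure.pi ν) =
      ∫ x, (x j * f (lin u x) (lin v x) - dirDeriv (u j) (v j) f (lin u x) (lin v x) -
        G0 x * x j - G1 x * (x j ^ 2 - 1)) ∂(Measure.pi ν) := by
    have i12 : Integrable (fun x => x j * f (lin u x) (lin v x) -
      dirDeriv (u j) (v j) f (lin u x) (lin v x)) (Measure.pi ν) := i1.sub i2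
    have i123 : Integrable (fun x => x j * f (lin u x) (lin v x) -
      dirDeriv (u j) (v j) f (lin u x) (lin v x) - G0 x * x j) (Measure.pi ν) := i12.sub i3
    rw [integral_sub i123 i4, integral_sub i12 i3, integral_sub i1 i2, z3, z4, sub_zero, sub_zero]
  rw [e]
  refine (abs_integral_le_of_le_envelope (u := u) (v := v) (j := j) (q := p + 3)
    (C := (|u j| + |v j|) ^ 2 * (2 * D * (1 + 2 * (|u j| + |v j|)) ^ p)) hν hκ (by positivity)
    (by omega) fun x => ?_).trans (le_of_eq (by unfold coordError; ring))
  have hr := h.stein_remainder hD (linRest u j x) (linRest v j x) (u j) (v j) (x j)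
  rw [← lin_eq_linRest_add, ← lin_eq_linRest_add] at hr
  refine hr.trans ?_
  have hT := one_le_envelope u v j x
  have hx := abs_coord_le_envelope u v j x
  have h3 : |x j| ^ 3 + |x j| ≤ 2 * envelope u v j x ^ 3 := by
    have := pow_le_pow_left₀ (abs_nonneg (x j)) hx 3
    have := le_self_pow₀ hT (n := 3) (by norm_num)
    linarith
  have h4 : (1 + |linRest u j x| + |linRest v j x| + (|u j| + |v j|) * |x j|) ^ p ≤
      ((1 + 2 * (|u j| + |v j|)) * envelope u v j x) ^ p :=
    pow_le_pow_left₀ (by positivity) (linRest_le_envelope u v j x) p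
  calc _ ≤ (|u j| + |v j|) ^ 2 * D * ((1 + 2 * (|u j| + |v j|)) * envelope u v j x) ^ p *
        (2 * envelope u v j x ^ 3) := by gcongr
    _ = _ := by rw [mul_pow, pow_add]; ring

/-- The first order term is centred and the second has unit variance, so the main terms do not see
the law of `x j` beyond two moments. Two admissible laws of coordinate `j` therefore share them. -/
theorem lindeberg_expand (h : SmoothGrowth p 3 D f) (hD : 0 ≤ D)
    (hν : ∀ i, StandardMoments κ (ν i)) (hκ : 1 ≤ κ) (u v : ι → ℝ) (j : ι) :
    |∫ x, f (lin u x) (lin v x) ∂(Measure.pi ν) -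
        ∫ x, f (linRest u j x) (linRest v j x) ∂(Measure.pi ν) -
        (∫ x, dirDeriv (u j) (v j) (dirDeriv (u j) (v j) f) (linRest u j x) (linRest v j x)
          ∂(Measure.pi ν)) / 2| ≤
      (|u j| + |v j|) ^ 3 * coordError κ D p (sumSq u + sumSq v) (|u j| + |v j|) := by
  have : ∀ i, IsProbabilityMeasure (ν i) := fun i => (hν i).prob
  have g1 := h.directional (u j) (v j)
  have g2 := g1.directional (u j) (v j)
  have hD1 : 0 ≤ (|u j| + |v j|) * D := by positivity
  have hD2 : 0 ≤ (|u j| + |v j|) * ((|u j| + |v j|) * D) := by positivity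
  set G0 := fun x : ι → ℝ => f (linRest u j x) (linRest v j x) with hG0
  set G1 := fun x : ι → ℝ => dirDeriv (u j) (v j) f (linRest u j x) (linRest v j x) with hG1
  set G2 := fun x : ι → ℝ =>
    dirDeriv (u j) (v j) (dirDeriv (u j) (v j) f) (linRest u j x) (linRest v j x) with hG2
  have i0 := h.integrable_lin hD hν hκ u v j
  have i1 : Integrable G0 (Measure.pi ν) := by
    simpa using h.integrable_linRest_mul_pow hD hν hκ u v j 0
  have i2 : Integrable (fun x => G1 x * x j) (Measure.pi ν) := by
    simpa using g1.integrable_linRest_mul_pow hD1 hν hκ u v j 1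
  have i3 : Integrable (fun x => G2 x / 2 * x j ^ 2) (Measure.pi ν) := by
    refine ((g2.integrable_linRest_mul_pow hD2 hν hκ u v j 2).div_const 2).congr
      (ae_of_all _ fun x => ?_)
    simp only [hG2]; ring
  have z2 : ∫ x, G1 x * x j ∂(Measure.pi ν) = 0 := by
    rw [g1.integral_linRest_mul hν u v j (ψ := fun s => s) measurable_id, (hν j).mean, mul_zero]
  have z3 : ∫ x, G2 x / 2 * x j ^ 2 ∂(Measure.pi ν) = (∫ x, G2 x ∂(Measure.pi ν)) / 2 := by
    have := g2.integral_linRest_mul hν u v j (ψ := fun s => s ^ 2) (by fun_prop)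
    rw [(hν j).var, mul_one] at this
    rw [← this, ← integral_div]
    refine integral_congr_ae (ae_of_all _ fun x => ?_)
    simp only [hG2]; ring
  have e : ∫ x, f (lin u x) (lin v x) ∂(Measure.pi ν) - ∫ x, G0 x ∂(Measure.pi ν) -
        (∫ x, G2 x ∂(Measure.pi ν)) / 2 =
      ∫ x, (f (lin u x) (lin v x) - G0 x - G1 x * x j - G2 x / 2 * x j ^ 2) ∂(Measure.pi ν) := by
    have i01 : Integrable (fun x => f (lin u x) (lin v x) - G0 x) (Measure.pi ν) := i0.sub i1
    have i012 : Integrable (fun x => f (lin u x) (lin v x) - G0 x - G1 x * x j) (Measure.pi ν) :=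
      i01.sub i2
    rw [integral_sub i012 i3, integral_sub i01 i2, integral_sub i0 i1, z2, z3, sub_zero]
  rw [e]
  refine (abs_integral_le_of_le_envelope (u := u) (v := v) (j := j) (q := p + 3)
    (C := (|u j| + |v j|) ^ 3 * (2 * D * (1 + 2 * (|u j| + |v j|)) ^ p)) hν hκ (by positivity)
    (by omega) fun x => ?_).trans (le_of_eq (by unfold coordError; ring))
  have hr := h.lindeberg_remainder hD (linRest u j x) (linRest v j x) (u j) (v j) (x j)
  rw [← lin_eq_linRest_add, ← lin_eq_linRest_add] at hr
  refine hr.trans ?_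
  have hT := one_le_envelope u v j x
  have h3 : |x j| ^ 3 ≤ 2 * envelope u v j x ^ 3 := by
    have := pow_le_pow_left₀ (abs_nonneg (x j)) (abs_coord_le_envelope u v j x) 3
    linarith [pow_nonneg (zero_le_one.trans hT) 3]
  have h4 : (1 + |linRest u j x| + |linRest v j x| + (|u j| + |v j|) * |x j|) ^ p ≤
      ((1 + 2 * (|u j| + |v j|)) * envelope u v j x) ^ p :=
    pow_le_pow_left₀ (by positivity) (linRest_le_envelope u v j x) p
  calc _ ≤ (|u j| + |v j|) ^ 3 * D * ((1 + 2 * (|u j| + |v j|)) * envelope u v j x) ^ p *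
        (2 * envelope u v j x ^ 3) := by gcongr
    _ = _ := by rw [mul_pow, pow_add]; ring

theorem standardMoments_update {ι : Type*} [DecidableEq ι] {κ : ℝ} {ν : ι → Measure ℝ}
    {ρ : Measure ℝ} (hν : ∀ i, StandardMoments κ (ν i))
    (hρ : StandardMoments κ ρ) (j : ι) (i : ι) : StandardMoments κ (Function.update ν j ρ i) := by
  by_cases h : i = j
  · subst h; simpa using hρ
  · simpa [h] using hν i

theorem lindeberg_step {ρ : Measure ℝ} (h : SmoothGrowth p 3 D f) (hD : 0 ≤ D)
    (hν : ∀ i, StandardMoments κ (ν i)) (hρ : StandardMoments κ ρ) (hκ : 1 ≤ κ) (u v : ι → ℝ)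
    (j : ι) :
    |∫ x, f (lin u x) (lin v x) ∂(Measure.pi ν) -
        ∫ x, f (lin u x) (lin v x) ∂(Measure.pi (Function.update ν j ρ))| ≤
      2 * ((|u j| + |v j|) ^ 3 * coordError κ D p (sumSq u + sumSq v) (|u j| + |v j|)) := by
  have : ∀ i, IsProbabilityMeasure (ν i) := fun i => (hν i).prob
  have := hρ.prob
  have e1 := lindeberg_expand h hD hν hκ u v j
  have e2 := lindeberg_expand h hD (standardMoments_update hν hρ j) hκ u v j
  have hinv : ∀ {g : ℝ → ℝ → ℝ} {D : ℝ} {r : ℕ}, SmoothGrowth p r D g →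
      ∫ x, g (linRest u j x) (linRest v j x) ∂(Measure.pi (Function.update ν j ρ)) =
        ∫ x, g (linRest u j x) (linRest v j x) ∂(Measure.pi ν) := by
    intro g D r hg
    refine integral_pi_update_of_invariant (G := fun x => g (linRest u j x) (linRest v j x))
      (hg.continuous_comp (continuous_linRest u j) (continuous_linRest v j)).measurable ?_
    intro x s
    simp only [linRest_update]
  rw [hinv h, hinv ((h.directional (u j) (v j)).directional (u j) (v j))] at e2
  rw [abs_le] at *
  constructor <;> linarith [e1.1, e1.2, e2.1, e2.2]

theorem lindeberg_pi {ρ : Measure ℝ} (h : SmoothGrowth p 3 D f) (hD : 0 ≤ D)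
    (hν : ∀ i, StandardMoments κ (ν i)) (hρ : StandardMoments κ ρ) (hκ : 1 ≤ κ) (u v : ι → ℝ) :
    |∫ x, f (lin u x) (lin v x) ∂(Measure.pi ν) -
        ∫ x, f (lin u x) (lin v x) ∂(Measure.pi fun _ : ι => ρ)| ≤
      ∑ j, 2 * ((|u j| + |v j|) ^ 3 * coordError κ D p (sumSq u + sumSq v) (|u j| + |v j|)) := by
  -- Telescoping over the set `s` of coordinates already replaced; every intermediate product still
  -- satisfies `StandardMoments`, so the one-coordinate step applies.
  have key : ∀ s : Finset ι, |∫ x, f (lin u x) (lin v x) ∂(Measure.pi ν) -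
        ∫ x, f (lin u x) (lin v x) ∂(Measure.pi (s.piecewise (fun _ => ρ) ν))| ≤
      ∑ j ∈ s, 2 *
        ((|u j| + |v j|) ^ 3 * coordError κ D p (sumSq u + sumSq v) (|u j| + |v j|)) := by
    intro s
    induction s using Finset.induction_on with
    | empty => simp
    | insert a s ha ih =>
      have hs : ∀ i, StandardMoments κ (s.piecewise (fun _ => ρ) ν i) := by
        intro i
        by_cases hi : i ∈ s
        · simpa [hi] using hρ
        · simpa [hi] using hν i
      have st := lindeberg_step h hD hs hρ hκ u v a
      rw [Finset.piecewise_insert, Finset.sum_insert ha]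
      rw [abs_le] at *
      constructor <;> linarith [ih.1, ih.2, st.1, st.2]
  have := key Finset.univ
  rwa [Finset.piecewise_univ] at this

end

/-! ### Gaussian approximation of one coordinate of a population gradient -/

section

variable {n : ℕ} {κ D : ℝ} {p : ℕ} {f : ℝ → ℝ → ℝ} {ν : Fin n → Measure ℝ}

theorem envBound_mono {U U' : ℝ} (hκ : 0 ≤ κ) (k : ℕ) (hU : U ≤ U') :
    envBound κ k U ≤ envBound κ k U' := by
  unfold envBound; gcongr

theorem envBound_nonneg {U : ℝ} (hκ : 0 ≤ κ) (k : ℕ) (hU : 0 ≤ U) : 0 ≤ envBound κ k U := by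
  unfold envBound; positivity

theorem coordError_mono {U U' h h' : ℝ} (hκ : 0 ≤ κ) (hD : 0 ≤ D) (hU0 : 0 ≤ U) (hU : U ≤ U')
    (hh0 : 0 ≤ h) (hh : h ≤ h') : coordError κ D p U h ≤ coordError κ D p U' h' := by
  have h1 := envBound_mono hκ (p + 3) hU
  have h2 := envBound_nonneg hκ (p + 3) hU0
  have h3 : 0 ≤ h' := hh0.trans hh
  unfold coordError
  gcongr

theorem coordError_nonneg {U h : ℝ} (hκ : 0 ≤ κ) (hD : 0 ≤ D) (hU0 : 0 ≤ U)
    (hh0 : 0 ≤ h) : 0 ≤ coordError κ D p U h := by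
  have h2 := envBound_nonneg hκ (p + 3) hU0
  unfold coordError
  positivity

/-- The error of replacing one coordinate of the population gradient by its Gaussian value,
multiplied by the dimension. -/
noncomputable def gradError (κ D : ℝ) (p : ℕ) (B : ℝ) : ℝ :=
  36 * B ^ 4 * coordError κ D p (2 * B ^ 2) (2 * B)

theorem gaussian_approx_pi (h : SmoothGrowth p 4 D f) (hD : 0 ≤ D)
    (hν : ∀ i, StandardMoments κ (ν i)) {ρ : Measure ℝ} (hρ : StandardMoments κ ρ) (hκ : 1 ≤ κ)
    (u v : Fin n → ℝ) (hn : 1 ≤ n) {B : ℝ} (hB : 1 ≤ B) (hu : ∀ i, |u i| ≤ B / √n)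
    (hv : ∀ i, |v i| ≤ B / √n) (j : Fin n) :
    |∫ x, x j * f (lin u x) (lin v x) ∂(Measure.pi ν) -
        (u j * ∫ x, partialOne f (lin u x) (lin v x) ∂(Measure.pi fun _ : Fin n => ρ) +
          v j * ∫ x, partialTwo f (lin u x) (lin v x) ∂(Measure.pi fun _ : Fin n => ρ))| ≤
      gradError κ D p B / n := by
  have hn' : (1 : ℝ) ≤ n := by exact_mod_cast hn
  have hsn : 1 ≤ √(n : ℝ) := Real.one_le_sqrt.2 hn'
  set b := B / √(n : ℝ) with hb
  have hb0 : 0 ≤ b := by positivity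
  have hbB : b ≤ B := div_le_self (by linarith) hsn
  have hnb : (n : ℝ) * b ^ 2 = B ^ 2 := by
    rw [hb, div_pow, Real.sq_sqrt (by linarith)]; field_simp
  have hsq : ∀ w : Fin n → ℝ, (∀ i, |w i| ≤ b) → sumSq w ≤ B ^ 2 := by
    intro w hw
    calc sumSq w ≤ ∑ _i : Fin n, b ^ 2 := by
          refine Finset.sum_le_sum fun i _ => ?_
          rw [← sq_abs]
          exact pow_le_pow_left₀ (abs_nonneg _) (hw i) 2
      _ = B ^ 2 := by simp [hnb]
  set U := sumSq u + sumSq v with hU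
  have hU0 : 0 ≤ U := add_nonneg (sumSq_nonneg u) (sumSq_nonneg v)
  have hU2 : U ≤ 2 * B ^ 2 := by linarith [hsq u hu, hsq v hv]
  have hh : ∀ i, |u i| + |v i| ≤ 2 * b := fun i => by linarith [hu i, hv i]
  set E := coordError κ D p (2 * B ^ 2) (2 * B) with hE
  have hE0 : 0 ≤ E := coordError_nonneg (by linarith) hD (by positivity) (by positivity)
  have hce : ∀ i, coordError κ D p U (|u i| + |v i|) ≤ E := fun i =>
    coordError_mono (by linarith) hD hU0 hU2 (by positivity) (by linarith [hh i])
  have hce0 : ∀ i, 0 ≤ coordError κ D p U (|u i| + |v i|) := fun i =>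
    coordError_nonneg (by linarith) hD hU0 (by positivity)
  have hst := stein_pi (h.of_le (by norm_num)) hD hν hκ u v j
  have hst' : (|u j| + |v j|) ^ 2 * coordError κ D p U (|u j| + |v j|) ≤ (2 * b) ^ 2 * E := by
    have := hh j; have := hce j; have := hce0 j
    gcongr
  have hlin : ∀ {g : ℝ → ℝ → ℝ}, SmoothGrowth p 3 D g →
      |∫ x, g (lin u x) (lin v x) ∂(Measure.pi ν) -
        ∫ x, g (lin u x) (lin v x) ∂(Measure.pi fun _ : Fin n => ρ)| ≤
      n * (2 * ((2 * b) ^ 3 * E)) := by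
    intro g hg
    refine (lindeberg_pi hg hD hν hρ hκ u v).trans ?_
    calc _ ≤ ∑ _j : Fin n, 2 * ((2 * b) ^ 3 * E) := by
          refine Finset.sum_le_sum fun i _ => ?_
          have := hh i; have := hce i; have := hce0 i
          gcongr
      _ = _ := by simp
  -- The replacement is applied to the first partial derivatives of `f`; their third derivatives are
  -- fourth derivatives of `f`.
  have l1 := hlin h.2.1
  have l2 := hlin h.2.2
  have hdir : ∫ x, dirDeriv (u j) (v j) f (lin u x) (lin v x) ∂(Measure.pi ν) =
      u j * ∫ x, partialOne f (lin u x) (lin v x) ∂(Measure.pi ν) +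
        v j * ∫ x, partialTwo f (lin u x) (lin v x) ∂(Measure.pi ν) := by
    unfold dirDeriv
    rw [integral_add ((h.2.1.integrable_lin hD hν hκ u v j).const_mul _)
      ((h.2.2.integrable_lin hD hν hκ u v j).const_mul _), integral_const_mul,
      integral_const_mul]
  rw [hdir] at hst
  set I := ∫ x, x j * f (lin u x) (lin v x) ∂(Measure.pi ν)
  set a1 := ∫ x, partialOne f (lin u x) (lin v x) ∂(Measure.pi ν)
  set a2 := ∫ x, partialTwo f (lin u x) (lin v x) ∂(Measure.pi ν)
  set c1 := ∫ x, partialOne f (lin u x) (lin v x) ∂(Measure.pi fun _ : Fin n => ρ)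
  set c2 := ∫ x, partialTwo f (lin u x) (lin v x) ∂(Measure.pi fun _ : Fin n => ρ)
  have hX0 : 0 ≤ n * (2 * ((2 * b) ^ 3 * E)) := by positivity
  calc |I - (u j * c1 + v j * c2)|
      = |(I - (u j * a1 + v j * a2)) + (u j * (a1 - c1) + v j * (a2 - c2))| := by congr 1; ring
    _ ≤ |I - (u j * a1 + v j * a2)| + (|u j * (a1 - c1)| + |v j * (a2 - c2)|) :=
        (abs_add_le _ _).trans (by gcongr; exact abs_add_le _ _)
    _ = |I - (u j * a1 + v j * a2)| + (|u j| * |a1 - c1| + |v j| * |a2 - c2|) := by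
        rw [abs_mul, abs_mul]
    _ ≤ (2 * b) ^ 2 * E + (b * (n * (2 * ((2 * b) ^ 3 * E))) +
          b * (n * (2 * ((2 * b) ^ 3 * E)))) := by
        have := hu j; have := hv j
        gcongr
        exact hst.trans hst'
    -- The `n` replacements are paid for by `n b² = B²`, so both errors are of order `b² = B² / n`.
    _ = (4 * b ^ 2 + 32 * (n * b ^ 2) * b ^ 2) * E := by ring
    _ = (4 + 32 * B ^ 2) * b ^ 2 * E := by rw [hnb]; ring
    _ ≤ (36 * B ^ 2) * b ^ 2 * E := by
        gcongr; nlinarith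
    _ = gradError κ D p B / n := by
        unfold gradError
        rw [eq_div_iff (by positivity), ← hE]
        calc 36 * B ^ 2 * b ^ 2 * E * n = 36 * B ^ 2 * (n * b ^ 2) * E := by ring
          _ = _ := by rw [hnb]; ring

end

/-! ### The laws of the entries -/

/-- From `y ^ i / i! ≤ exp y` with `y = (V / C) ^ 2`. The factorial is bounded crudely by `k ^
(2i)`, giving sub-exponential growth, which is all that `StandardMoments` asks. -/
theorem momentBound_of_exp_sq {Ω : Type*} [MeasurableSpace Ω] {P : Measure Ω}
    [IsProbabilityMeasure P] {V : Ω → ℝ} (hV : Measurable V) {C : ℝ} (hC : 0 < C)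
    (h : ∫⁻ ω, ENNReal.ofReal (Real.exp ((V ω / C) ^ 2) - 1) ∂P ≤ 1) (k : ℕ) :
    MomentBound P k (2 * C ^ 2 * (k : ℝ) ^ 2) V := by
  have hm : Measurable (fun ω => Real.exp ((V ω / C) ^ 2) - 1) := by fun_prop
  have hnn : ∀ ω, 0 ≤ Real.exp ((V ω / C) ^ 2) - 1 := fun ω => by
    have := Real.one_le_exp (sq_nonneg (V ω / C)); linarith
  have hint : Integrable (fun ω => Real.exp ((V ω / C) ^ 2) - 1) P := by
    refine ⟨hm.aestronglyMeasurable, ?_⟩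
    rw [hasFiniteIntegral_iff_ofReal (ae_of_all _ hnn)]
    exact h.trans_lt (by simp)
  have hle : ∫ ω, (Real.exp ((V ω / C) ^ 2) - 1) ∂P ≤ 1 := by
    rw [integral_eq_lintegral_of_nonneg_ae (ae_of_all _ hnn) hm.aestronglyMeasurable]
    exact ENNReal.toReal_le_of_le_ofReal zero_le_one (by simpa using h)
  have hint' : Integrable (fun ω => Real.exp ((V ω / C) ^ 2)) P := by
    refine (hint.add (integrable_const 1)).congr (ae_of_all _ fun ω => ?_)
    simp
  have hle' : ∫ ω, Real.exp ((V ω / C) ^ 2) ∂P ≤ 2 := by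
    rw [integral_sub hint' (integrable_const _)] at hle
    simp at hle
    linarith
  have key : ∀ i : ℕ, ∀ ω, V ω ^ (2 * i) ≤ C ^ (2 * i) * i.factorial * Real.exp ((V ω / C) ^ 2) := by
    intro i ω
    have h1 := Real.pow_div_factorial_le_exp ((V ω / C) ^ 2) (sq_nonneg _) i
    rw [div_le_iff₀ (by positivity), ← pow_mul, div_pow, div_le_iff₀ (by positivity)] at h1
    linarith
  have hi : ∀ i, Integrable (fun ω => V ω ^ (2 * i)) P := by
    intro i
    refine (hint'.const_mul (C ^ (2 * i) * i.factorial)).mono' (hV.pow_const _).aestronglyMeasurable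
      (ae_of_all _ fun ω => ?_)
    rw [Real.norm_eq_abs, abs_of_nonneg (Even.pow_nonneg (even_two_mul i) _)]
    exact key i ω
  refine ⟨hV, fun i _ => hi i, fun i hik => ?_⟩
  rcases Nat.eq_zero_or_pos i with rfl | hi1
  · simp
  have hk : (1 : ℝ) ≤ k := by exact_mod_cast (hi1.trans_le hik)
  calc ∫ ω, V ω ^ (2 * i) ∂P
      ≤ ∫ ω, C ^ (2 * i) * i.factorial * Real.exp ((V ω / C) ^ 2) ∂P :=
        integral_mono (hi i) (hint'.const_mul _) (key i)
    _ = C ^ (2 * i) * i.factorial * ∫ ω, Real.exp ((V ω / C) ^ 2) ∂P := integral_const_mul _ _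
    _ ≤ C ^ (2 * i) * ((k : ℝ) ^ 2) ^ i * 2 ^ i := by
        have hfac : (i.factorial : ℝ) ≤ ((k : ℝ) ^ 2) ^ i :=
          calc (i.factorial : ℝ) ≤ (i : ℝ) ^ i := by exact_mod_cast Nat.factorial_le_pow i
            _ ≤ (k : ℝ) ^ i := by gcongr
            _ ≤ ((k : ℝ) ^ 2) ^ i := by gcongr; nlinarith
        have h2 : ∫ ω, Real.exp ((V ω / C) ^ 2) ∂P ≤ 2 ^ i :=
          hle'.trans (le_self_pow₀ (by norm_num) (by omega))
        have h3 : 0 ≤ ∫ ω, Real.exp ((V ω / C) ^ 2) ∂P :=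
          integral_nonneg fun ω => (Real.exp_pos _).le
        gcongr
    _ = (2 * C ^ 2 * (k : ℝ) ^ 2) ^ i := by rw [mul_pow, mul_pow, ← pow_mul]; ring

theorem exists_lt_of_psiTwoNorm_lt {Ω : Type*} [MeasurableSpace Ω] {P : Measure Ω} {V : Ω → ℝ}
    {K : ℝ≥0∞} (h : psiTwoNorm P V < K) : ∃ C : ℝ≥0, 0 < C ∧ (C : ℝ≥0∞) < K ∧
      ∫⁻ ω, ENNReal.ofReal (Real.exp ((V ω / C) ^ 2) - 1) ∂P ≤ 1 := by
  unfold psiTwoNorm at h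
  simp only [iInf_lt_iff] at h
  obtain ⟨C, hC, hI, hK⟩ := h
  exact ⟨C, hC, hK, hI⟩

/-- Moments of a variable with bounded `ψ₂`-norm. -/
theorem momentBound_of_psiTwoNorm_le {Ω : Type*} [MeasurableSpace Ω] {P : Measure Ω}
    [IsProbabilityMeasure P] {V : Ω → ℝ} (hV : Measurable V) {K : ℝ} (hK : 0 < K)
    (h : psiTwoNorm P V ≤ ENNReal.ofReal K) (k : ℕ) :
    MomentBound P k (8 * K ^ 2 * (k : ℝ) ^ 2) V := by
  -- Passing from `K` to `2K` avoids showing that the infimum is attained; the price is `2 (2K)² =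
  -- 8K²`.
  obtain ⟨C, hC, hCK, hI⟩ := exists_lt_of_psiTwoNorm_lt (h.trans_lt
    ((ENNReal.ofReal_lt_ofReal_iff (by linarith)).2 (by linarith : K < 2 * K)))
  have hC' : (C : ℝ) < 2 * K := by
    rw [ENNReal.ofReal, ENNReal.coe_lt_coe, ← NNReal.coe_lt_coe] at hCK
    rwa [Real.coe_toNNReal _ (by linarith)] at hCK
  refine (momentBound_of_exp_sq hV (C := C) (by exact_mod_cast hC) hI k).mono (by positivity) ?_ le_rfl
  have : (C : ℝ) ^ 2 ≤ (2 * K) ^ 2 := by gcongr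
  nlinarith [sq_nonneg (k : ℝ)]

theorem standardMoments_map {Ω : Type*} [MeasurableSpace Ω] {P : Measure Ω}
    [IsProbabilityMeasure P] {V : Ω → ℝ} {κ : ℝ} (hV : Measurable V) (h0 : ∫ ω, V ω ∂P = 0)
    (h1 : variance V P = 1) (h : ∀ k : ℕ, MomentBound P k (κ * (k : ℝ) ^ 2) V) :
    StandardMoments κ (P.map V) where
  prob := Measure.isProbabilityMeasure_map hV.aemeasurable
  mean := by rw [integral_map hV.aemeasurable (by fun_prop), h0]
  var := by
    rw [integral_map hV.aemeasurable (by fun_prop), ← h1, variance_of_integral_eq_zero hV.aemeasurable h0]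
  moments k := by
    refine ⟨measurable_id, fun i hi => ?_, fun i hi => ?_⟩
    · rw [integrable_map_measure (by fun_prop) hV.aemeasurable]
      exact (h k).integrable i hi
    · rw [integral_map hV.aemeasurable (by fun_prop)]
      exact (h k).le i hi

theorem standardMoments_gaussianReal {κ : ℝ} (hκ : 32 ≤ κ) :
    StandardMoments κ (gaussianReal 0 1) where
  prob := inferInstance
  mean := integral_id_gaussianReal
  var := by
    have := variance_fun_id_gaussianReal (μ := 0) (v := 1)
    rw [variance_of_integral_eq_zero (by fun_prop) integral_id_gaussianReal] at this
    simpa using this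
  moments k := by
    have ip := integrable_exp_mul_gaussianReal (μ := 0) (v := 1) 1
    have im := integrable_exp_mul_gaussianReal (μ := 0) (v := 1) (-1)
    have ev : ∀ t : ℝ, ∫ s, Real.exp (t * s) ∂(gaussianReal 0 1) = Real.exp (t ^ 2 / 2) := by
      intro t
      have := congrFun (mgf_fun_id_gaussianReal (μ := 0) (v := 1)) t
      simpa [mgf] using this
    -- Linear exponentials are enough here. The factorial of `2i` and the factor `4 ≤ 8 ^ i` combine
    -- to `(2k)^(2i) 8^i = (32 k²)^i`, the source of the constant `32`.
    have key : ∀ i : ℕ, ∀ s : ℝ, s ^ (2 * i) ≤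
        (2 * i).factorial * (Real.exp (1 * s) + Real.exp (-1 * s)) := by
      intro i s
      have h1 := Real.pow_div_factorial_le_exp |s| (abs_nonneg _) (2 * i)
      rw [div_le_iff₀ (by positivity), Even.pow_abs (even_two_mul i)] at h1
      have h2 : Real.exp |s| ≤ Real.exp (1 * s) + Real.exp (-1 * s) := by
        rcases abs_cases s with ⟨h, _⟩ | ⟨h, _⟩ <;> rw [h] <;> simp <;> positivity
      nlinarith [show (0 : ℝ) < (2 * i).factorial by positivity]
    have hi : ∀ i : ℕ, Integrable (fun s : ℝ => s ^ (2 * i)) (gaussianReal 0 1) := by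
      intro i
      refine ((ip.add im).const_mul ((2 * i).factorial : ℝ)).mono' (by fun_prop)
        (ae_of_all _ fun s => ?_)
      rw [Real.norm_eq_abs, abs_of_nonneg (Even.pow_nonneg (even_two_mul i) _)]
      exact key i s
    refine ⟨measurable_id, fun i _ => hi i, fun i hik => ?_⟩
    rcases Nat.eq_zero_or_pos i with rfl | hi1
    · simp
    have hexp : Real.exp (1 / 2) ≤ 2 := by
      have : Real.exp (1 / 2) ≤ Real.exp (Real.log 2) :=
        Real.exp_le_exp.2 (by linarith [Real.log_two_gt_d9])
      rwa [Real.exp_log (by norm_num)] at this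
    calc ∫ s, s ^ (2 * i) ∂(gaussianReal 0 1)
        ≤ ∫ s, (2 * i).factorial * (Real.exp (1 * s) + Real.exp (-1 * s)) ∂(gaussianReal 0 1) :=
          integral_mono (hi i) ((ip.add im).const_mul _) (key i)
      _ = (2 * i).factorial * (2 * Real.exp (1 / 2)) := by
          rw [integral_const_mul, integral_add ip im, ev, ev, neg_one_sq, one_pow]; ring
      _ ≤ (2 * i : ℕ) ^ (2 * i) * 4 := by
          gcongr
          · exact_mod_cast Nat.factorial_le_pow (2 * i)
          · linarith
      _ ≤ (2 * k : ℕ) ^ (2 * i) * 8 ^ i := by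
          gcongr
          calc (4 : ℝ) ≤ 8 ^ 1 := by norm_num
            _ ≤ 8 ^ i := pow_le_pow_right₀ (by norm_num) hi1
      _ = (32 * (k : ℝ) ^ 2) ^ i := by
          rw [pow_mul, ← mul_pow]; push_cast; ring
      _ ≤ (κ * (k : ℝ) ^ 2) ^ i := by gcongr

/-! ### Deterministic recursions -/

theorem le_maxOver {I : Finset ℕ} {f : ℕ → ℝ} {i : ℕ} (hi : i ∈ I) : f i ≤ maxOver I f :=
  (Finset.le_fold_max _).2 (Or.inr ⟨i, hi, le_rfl⟩)

theorem maxOver_nonneg (I : Finset ℕ) (f : ℕ → ℝ) : 0 ≤ maxOver I f :=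
  (Finset.le_fold_max _).2 (Or.inl le_rfl)

theorem opNorm_nonneg {n : ℕ} (A : Matrix (Fin n) (Fin n) ℝ) : 0 ≤ opNorm A := norm_nonneg _

theorem norm_mulVec_le {n : ℕ} (A : Matrix (Fin n) (Fin n) ℝ) (w : EuclideanSpace ℝ (Fin n)) :
    ‖WithLp.toLp 2 (A *ᵥ WithLp.ofLp w)‖ ≤ opNorm A * ‖w‖ :=
  ContinuousLinearMap.le_opNorm (Matrix.toEuclideanCLM (n := Fin n) (𝕜 := ℝ) A) w

theorem one_le_growth {n : ℕ} (η : ℕ → ℝ) (B : ℕ → Matrix (Fin n) (Fin n) ℝ) (t : ℕ) :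
    1 ≤ growth η B t := by
  unfold growth
  linarith [maxOver_nonneg (Finset.Icc 0 t) fun τ =>
    ∑ s ∈ Finset.Icc 0 τ, ∏ r ∈ Finset.Icc s τ, opNorm (1 - η r • B r)]

/-- Unrolled, an error made at an earlier step is multiplied by all later operator norms, while the
last one is multiplied by nothing: that is the summand `1` in `growth`. -/
theorem le_mul_growth {n : ℕ} (η : ℕ → ℝ) (B : ℕ → Matrix (Fin n) (Fin n) ℝ) {a : ℕ → ℝ} {E : ℝ}
    (hE : 0 ≤ E) (h0 : a 0 = 0) {t : ℕ} (ht : 1 ≤ t)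
    (h : ∀ s < t, a (s + 1) ≤ opNorm (1 - η s • B s) * a s + E) :
    a t ≤ E * growth η B (t - 1) := by
  obtain ⟨t, rfl⟩ : ∃ t', t = t' + 1 := ⟨t - 1, by omega⟩
  set b : ℕ → ℝ := fun τ =>
    ∑ s ∈ Finset.Icc 0 τ, ∏ r ∈ Finset.Icc s τ, opNorm (1 - η r • B r) with hb
  have hb0 : ∀ τ, 0 ≤ b τ := fun τ =>
    Finset.sum_nonneg fun s _ => Finset.prod_nonneg fun r _ => opNorm_nonneg _
  -- The new index adds one factor to every old product and contributes one product consisting of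
  -- that factor alone.
  have hbs : ∀ τ, b (τ + 1) = opNorm (1 - η (τ + 1) • B (τ + 1)) * (b τ + 1) := by
    intro τ
    simp only [hb]
    rw [Finset.sum_Icc_succ_top (by omega), Finset.Icc_self, Finset.prod_singleton, mul_add,
      mul_one, Finset.mul_sum]
    congr 1
    refine Finset.sum_congr rfl fun s hs => ?_
    rw [Finset.prod_Icc_succ_top (by have := (Finset.mem_Icc.1 hs).2; omega), mul_comm]
  have key : ∀ τ ≤ t, a (τ + 1) ≤ E * (1 + b τ) := by
    intro τ hτ
    induction τ with
    | zero =>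
      have := h 0 (by omega)
      rw [h0, mul_zero, zero_add] at this
      nlinarith [hb0 0]
    | succ τ ih =>
      have h1 := h (τ + 1) (by omega)
      have h2 := mul_le_mul_of_nonneg_left (ih (by omega))
        (opNorm_nonneg (1 - η (τ + 1) • B (τ + 1)))
      rw [hbs]
      linarith
  refine (key t le_rfl).trans ?_
  rw [Nat.add_sub_cancel]
  unfold growth
  gcongr
  exact le_maxOver (f := b) (Finset.mem_Icc.2 ⟨Nat.zero_le _, le_rfl⟩)

/-! ### Gradients -/

section

variable {m n p : ℕ} {D : ℝ} {L F : ℝ → ℝ → ℝ} {ξ : Fin m → ℝ}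

/-- The gradient of the empirical loss, for the design `A`. -/
noncomputable def sampleGrad (L F : ℝ → ℝ → ℝ) (ξ : Fin m → ℝ) (μstar : EuclideanSpace ℝ (Fin n))
    (A : Matrix (Fin m) (Fin n) ℝ) (u : EuclideanSpace ℝ (Fin n)) : EuclideanSpace ℝ (Fin n) :=
  WithLp.toLp 2 fun j => (1 / (m : ℝ)) *
    ∑ i, A i j * score L F (ξ i) (lin (WithLp.ofLp u) (A i)) (lin (WithLp.ofLp μstar) (A i))

theorem mulVec_eq_lin (A : Matrix (Fin m) (Fin n) ℝ) (w : Fin n → ℝ) (i : Fin m) :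
    (A *ᵥ w) i = lin w (A i) := rfl

theorem gradDescent_succ (η : ℕ → ℝ) (μ0 μstar : EuclideanSpace ℝ (Fin n))
    (A : Matrix (Fin m) (Fin n) ℝ) (t : ℕ) :
    gradDescent L η μ0 A (response F ξ μstar A) (t + 1) =
      gradDescent L η μ0 A (response F ξ μstar A) t -
        η t • sampleGrad L F ξ μstar A (gradDescent L η μ0 A (response F ξ μstar A) t) := by
  rw [gradDescent]
  congr 1
  ext j
  simp only [sampleGrad, PiLp.smul_apply, smul_eq_mul, Matrix.mulVec, dotProduct,
    Matrix.transpose_apply]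
  rw [div_eq_mul_one_div, mul_assoc]
  rfl

/-- The increments of `f(·, z)` along a segment, by the fundamental theorem of calculus. -/
theorem integral_partialOne_segment {f : ℝ → ℝ → ℝ} {r : ℕ} (h : SmoothGrowth p (r + 1) D f)
    (a b z : ℝ) :
    (∫ U in (0 : ℝ)..1, partialOne f (U * a + (1 - U) * b) z) * (a - b) = f a z - f b z := by
  have hd : ∀ U : ℝ, HasDerivAt (fun U => f (U * a + (1 - U) * b) z)
      (partialOne f (U * a + (1 - U) * b) z * (a - b)) U := by
    intro U
    have h1 : HasDerivAt (fun U : ℝ => U * a + (1 - U) * b) (a - b) U := by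
      have := ((hasDerivAt_id U).mul_const a).add
        (((hasDerivAt_id U).const_sub 1).mul_const b)
      refine this.congr_deriv ?_
      ring
    have h2 : HasDerivAt (fun s => f s z) (partialOne f (U * a + (1 - U) * b) z)
        (U * a + (1 - U) * b) := (differentiable_left h.1.1 z _).hasDerivAt
    exact h2.comp U h1
  have hc : Continuous (fun U : ℝ => partialOne f (U * a + (1 - U) * b) z * (a - b)) :=
    (h.2.1.continuous_comp (by fun_prop) continuous_const).mul continuous_const
  rw [← intervalIntegral.integral_mul_const,
    intervalIntegral.integral_eq_sub_of_hasDerivAt (fun U _ => hd U) (hc.intervalIntegrable _ _)]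
  simp

theorem lin_segment (u v x : Fin n → ℝ) (U : ℝ) :
    lin (U • u + (1 - U) • v) x = U * lin u x + (1 - U) * lin v x := by
  simp only [lin, Finset.mul_sum, ← Finset.sum_add_distrib]
  refine Finset.sum_congr rfl fun i _ => ?_
  simp; ring

/-- The contribution of one row to an entry of `empMatrix`. -/
noncomputable def rowEntry (f : ℝ → ℝ → ℝ) (u v w : Fin n → ℝ) (j k : Fin n) (x : Fin n → ℝ) : ℝ :=
  ∫ U in (0 : ℝ)..1, partialOne f (U * lin u x + (1 - U) * lin v x) (lin w x) * (x j * x k)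

theorem empMatrix_apply (μstar u v : EuclideanSpace ℝ (Fin n)) (A : Matrix (Fin m) (Fin n) ℝ)
    (j k : Fin n) : empMatrix L F ξ μstar u v A j k = (1 / (m : ℝ)) * ∑ i,
      rowEntry (score L F (ξ i)) (WithLp.ofLp u) (WithLp.ofLp v) (WithLp.ofLp μstar) j k (A i) := by
  simp only [empMatrix, Matrix.of_apply, rowEntry, mulVec_eq_lin, WithLp.ofLp_add,
    WithLp.ofLp_smul, lin_segment]

theorem sum_rowEntry_mul {f : ℝ → ℝ → ℝ} {r : ℕ} (h : SmoothGrowth p (r + 1) D f)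
    (u v w : Fin n → ℝ) (j : Fin n) (x : Fin n → ℝ) :
    ∑ k, rowEntry f u v w j k x * (u k - v k) =
      x j * f (lin u x) (lin w x) - x j * f (lin v x) (lin w x) := by
  rw [← mul_sub, ← integral_partialOne_segment h]
  have : lin u x - lin v x = ∑ k, x k * (u k - v k) := by
    simp only [lin, ← Finset.sum_sub_distrib, mul_sub]
  rw [this, Finset.mul_sum, Finset.mul_sum]
  refine Finset.sum_congr rfl fun k _ => ?_
  rw [rowEntry, intervalIntegral.integral_mul_const]
  ring

/-- An exact linearisation without convexity or a remainder: averaging the derivative over the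
segment and contracting with `u - v` integrates back to the increment of the score. -/
theorem empMatrix_mulVec (hS : ∀ i, SmoothGrowth p 4 D (score L F (ξ i)))
    (μstar u v : EuclideanSpace ℝ (Fin n)) (A : Matrix (Fin m) (Fin n) ℝ) :
    WithLp.toLp 2 (empMatrix L F ξ μstar u v A *ᵥ WithLp.ofLp (u - v)) =
      sampleGrad L F ξ μstar A u - sampleGrad L F ξ μstar A v := by
  ext j
  simp only [sampleGrad, PiLp.sub_apply, Matrix.mulVec, dotProduct, empMatrix_apply]
  rw [← mul_sub, ← Finset.sum_sub_distrib]
  simp_rw [← sum_rowEntry_mul (hS _) (WithLp.ofLp u) (WithLp.ofLp v) (WithLp.ofLp μstar) j, mul_assoc,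
    Finset.sum_mul]
  rw [← Finset.mul_sum, Finset.sum_comm]

/-- The two points may follow different vector fields; adding and subtracting `gv` places the whole
discrepancy at the reference point `v`. -/
theorem norm_gradStep_sub_le (M : Matrix (Fin n) (Fin n) ℝ) (η : ℝ) (hη : 0 ≤ η)
    {u v gu gv e : EuclideanSpace ℝ (Fin n)}
    (h : WithLp.toLp 2 (M *ᵥ WithLp.ofLp (u - v)) = gu - gv) :
    ‖(u - η • gu) - (v - η • e)‖ ≤ opNorm (1 - η • M) * ‖u - v‖ + η * ‖gv - e‖ := by
  have e1 : (u - η • gu) - (v - η • e) =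
      WithLp.toLp 2 ((1 - η • M) *ᵥ WithLp.ofLp (u - v)) - η • (gv - e) := by
    rw [Matrix.sub_mulVec, Matrix.one_mulVec, Matrix.smul_mulVec, WithLp.toLp_sub,
      WithLp.toLp_smul, h, WithLp.toLp_ofLp]
    module
  rw [e1]
  refine (norm_sub_le _ _).trans ?_
  rw [norm_smul, Real.norm_eq_abs, abs_of_nonneg hη]
  gcongr
  exact norm_mulVec_le _ _

end

/-! ### Independence of the rows -/

/-- The joint law of all entries is determined by independence and marginals. The nested product
measure `Q` has the same flat law, and regrouping it into rows yields a product over rows. -/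
theorem iIndepFun_rows {Ω : Type*} [MeasurableSpace Ω] {P : Measure Ω} {ι κ : Type*} [Fintype ι]
    [Fintype κ] {X : ι → κ → Ω → ℝ} (hX : ∀ i j, Measurable (X i j))
    (h : iIndepFun (fun (ij : ι × κ) ω => X ij.1 ij.2 ω) P) :
    iIndepFun (fun i ω j => X i j ω) P := by
  have := h.isProbabilityMeasure
  have hp : ∀ i j, IsProbabilityMeasure (P.map (X i j)) := fun i j =>
    Measure.isProbabilityMeasure_map (hX i j).aemeasurable
  have hrow : ∀ i, P.map (fun ω j => X i j ω) = Measure.pi fun j => P.map (X i j) := by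
    intro i
    have hi : iIndepFun (fun j ω => X i j ω) P :=
      h.precomp (g := fun j : κ => (i, j)) fun a b hab => (Prod.mk.inj hab).2
    exact hi.map_fun_eq_pi_map fun j => (hX i j).aemeasurable
  have hpr : ∀ i, IsProbabilityMeasure (Measure.pi fun j => P.map (X i j)) := fun i => inferInstance
  set Q : Measure (ι → κ → ℝ) := Measure.pi fun i => Measure.pi fun j => P.map (X i j) with hQ
  have hev : ∀ i, Q.map (fun x => x i) = Measure.pi fun j => P.map (X i j) := fun i =>
    (measurePreserving_eval (fun i => Measure.pi fun j => P.map (X i j)) i).map_eq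
  have hev2 : ∀ i j, Q.map (fun x => x i j) = P.map (X i j) := by
    intro i j
    have h1 := (measurePreserving_eval (fun j => P.map (X i j)) j).map_eq
    rw [← hev i, Measure.map_map (measurable_pi_apply j) (measurable_pi_apply i)] at h1
    exact h1
  have hmij : ∀ i j, Measurable fun x : ι → κ → ℝ => x i j := fun i j =>
    (measurable_pi_apply j).comp (measurable_pi_apply i)
  have hQind : iIndepFun (fun (ij : ι × κ) (x : ι → κ → ℝ) => x ij.1 ij.2) Q := by
    refine iIndepFun_uncurry' (X := fun i j (x : ι → κ → ℝ) => x i j) hmij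
      ?_ fun i => ?_
    · exact iIndepFun_pi (μ := fun i => Measure.pi fun j => P.map (X i j))
        (X := fun i (y : κ → ℝ) => y) fun i => aemeasurable_id
    · rw [iIndepFun_iff_map_fun_eq_pi_map fun j => (hmij i j).aemeasurable]
      simp_rw [hev2]
      exact hev i
  have hlawQ := hQind.map_fun_eq_pi_map fun _ => (hmij _ _).aemeasurable
  have hlawP := h.map_fun_eq_pi_map fun _ => (hX _ _).aemeasurable
  simp_rw [hev2] at hlawQ
  have hc : Measurable fun (y : ι × κ → ℝ) (i : ι) (j : κ) => y (i, j) := by fun_prop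
  rw [iIndepFun_iff_map_fun_eq_pi_map fun i =>
    (measurable_pi_lambda _ fun j => hX i j).aemeasurable]
  simp_rw [hrow]
  have e1 : P.map (fun ω i j => X i j ω) =
      (P.map fun ω (ij : ι × κ) => X ij.1 ij.2 ω).map fun y i j => y (i, j) := by
    rw [Measure.map_map hc (measurable_pi_lambda _ fun ij => hX ij.1 ij.2)]
    rfl
  have e2 : Q = (Q.map fun x (ij : ι × κ) => x ij.1 ij.2).map fun y i j => y (i, j) := by
    rw [Measure.map_map hc (measurable_pi_lambda _ fun ij => hmij ij.1 ij.2)]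
    exact Measure.map_id.symm
  rw [e1, hlawP, ← hlawQ, ← e2]

section

variable {Ω : Type*} [MeasurableSpace Ω] {P : Measure Ω} {m n p : ℕ}
  {X : Ω → Matrix (Fin m) (Fin n) ℝ} {K D : ℝ} {L F : ℝ → ℝ → ℝ} {ξ : Fin m → ℝ}

theorem DesignAssumption.measurePreserving_row (h : DesignAssumption P X K) (i : Fin m) :
    MeasurePreserving (fun ω => X ω i) P (Measure.pi fun j => P.map fun ω => X ω i j) := by
  refine ⟨measurable_pi_lambda _ fun j => h.measurable i j, ?_⟩
  have hi : iIndepFun (fun j ω => X ω i j) P :=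
    h.indep.precomp (g := fun j : Fin n => (i, j)) fun a b hab => (Prod.mk.inj hab).2
  exact hi.map_fun_eq_pi_map fun j => (h.measurable i j).aemeasurable

theorem DesignAssumption.indep_rows (h : DesignAssumption P X K) :
    iIndepFun (fun i ω => X ω i) P :=
  iIndepFun_rows (X := fun i j ω => X ω i j) h.measurable h.indep

variable [IsProbabilityMeasure P]
theorem DesignAssumption.standardMoments (h : DesignAssumption P X K) (hK : 0 < K) (i : Fin m)
    (j : Fin n) : StandardMoments (8 * K ^ 2) (P.map fun ω => X ω i j) :=
  standardMoments_map (h.measurable i j) (h.mean_zero i j) (h.unit_variance i j) fun k =>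
    momentBound_of_psiTwoNorm_le (h.measurable i j) hK (h.subgaussian i j) k

/-! ### Population gradients -/

/-- Used for integrability only, so the size of `β` and its dependence on the dimension are
irrelevant. -/
theorem exists_momentBound_sum_abs {ι : Type*} [Fintype ι] {κ : ℝ} {ν : ι → Measure ℝ}
    (hν : ∀ i, StandardMoments κ (ν i)) {k : ℕ} (hk : 1 ≤ k) (s : Finset ι) :
    ∃ β, MomentBound (Measure.pi ν) k β (fun x => 1 + ∑ i ∈ s, |x i|) := by
  classical
  have : ∀ i, IsProbabilityMeasure (ν i) := fun i => (hν i).prob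
  induction s using Finset.induction_on with
  | empty => exact ⟨1, by simpa using momentBound_const (P := Measure.pi ν) k (c := 1) (by norm_num)⟩
  | insert a s ha ih =>
    obtain ⟨β, hβ⟩ := ih
    have h1 := (((hν a).moments k).comp (measurePreserving_eval ν a)).abs
    have h2 := hβ.add h1 (hβ.nonneg hk) (h1.nonneg hk)
    have e : (fun x : ι → ℝ => 1 + ∑ i ∈ insert a s, |x i|) =
        fun x => 1 + ∑ i ∈ s, |x i| + |Function.eval a x| := by
      ext x
      rw [Finset.sum_insert ha, Function.eval]
      ring
    exact ⟨_, e ▸ h2⟩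

theorem integrable_pi_of_growth {ι : Type*} [Fintype ι] {κ : ℝ} {ν : ι → Measure ℝ}
    (hν : ∀ i, StandardMoments κ (ν i)) {G : (ι → ℝ) → ℝ} (hG : Continuous G) {C : ℝ} {q : ℕ}
    (h : ∀ x, |G x| ≤ C * (1 + ∑ i, |x i|) ^ q) : Integrable G (Measure.pi ν) := by
  have : ∀ i, IsProbabilityMeasure (ν i) := fun i => (hν i).prob
  obtain ⟨β, hβ⟩ := exists_momentBound_sum_abs hν (k := q + 1) (by omega) Finset.univ
  exact ((hβ.integrable_pow (q := q) (by omega)).const_mul C).mono' hG.aestronglyMeasurable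
    (ae_of_all _ h)

theorem continuous_rowEntry {f : ℝ → ℝ → ℝ} {r : ℕ} (h : SmoothGrowth p (r + 1) D f)
    (u v w : Fin n → ℝ) (j k : Fin n) : Continuous (rowEntry f u v w j k) := by
  unfold rowEntry
  refine intervalIntegral.continuous_parametric_intervalIntegral_of_continuous' (f := fun x U =>
    partialOne f (U * lin u x + (1 - U) * lin v x) (lin w x) * (x j * x k)) ?_ 0 1
  have cu := continuous_lin u
  have cv := continuous_lin v
  have cw := continuous_lin w
  exact (h.2.1.continuous_comp (Ω := (Fin n → ℝ) × ℝ) (by fun_prop) (by fun_prop)).mul (by fun_prop)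

theorem abs_lin_le (u x : Fin n → ℝ) : |lin u x| ≤ (∑ i, |u i|) * (1 + ∑ i, |x i|) := by
  unfold lin
  refine (Finset.abs_sum_le_sum_abs _ _).trans ?_
  rw [Finset.sum_mul]
  refine Finset.sum_le_sum fun i _ => ?_
  rw [abs_mul, mul_comm]
  have := Finset.single_le_sum (f := fun i => |x i|) (fun i _ => abs_nonneg _) (Finset.mem_univ i)
  exact mul_le_mul_of_nonneg_left (by linarith) (abs_nonneg _)

theorem integrable_rowEntry {f : ℝ → ℝ → ℝ} {r : ℕ} (h : SmoothGrowth p (r + 1) D f) (hD : 0 ≤ D)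
    {κ : ℝ} {ν : Fin n → Measure ℝ} (hν : ∀ i, StandardMoments κ (ν i)) (u v w : Fin n → ℝ)
    (j k : Fin n) : Integrable (rowEntry f u v w j k) (Measure.pi ν) := by
  set W := 1 + ∑ i, |u i| + ∑ i, |v i| + ∑ i, |w i| with hW
  refine integrable_pi_of_growth (C := D * W ^ p) (q := p + 2) hν (continuous_rowEntry h u v w j k)
    fun x => ?_
  set R := 1 + ∑ i, |x i| with hR
  have hx : ∀ i, |x i| ≤ R := fun i => by
    have := Finset.single_le_sum (f := fun i => |x i|) (fun i _ => abs_nonneg _) (Finset.mem_univ i)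
    linarith
  have hR0 : 1 ≤ R := by
    have : 0 ≤ ∑ i, |x i| := Finset.sum_nonneg fun i _ => abs_nonneg _
    linarith
  have hW0 : 0 ≤ W := by positivity
  have hb : ∀ U ∈ Set.uIoc (0 : ℝ) 1,
      ‖partialOne f (U * lin u x + (1 - U) * lin v x) (lin w x) * (x j * x k)‖ ≤
        D * W ^ p * R ^ (p + 2) := by
    intro U hU
    rw [Set.uIoc_of_le zero_le_one] at hU
    rw [Real.norm_eq_abs, abs_mul, abs_mul]
    have h1 : |U * lin u x + (1 - U) * lin v x| ≤ |lin u x| + |lin v x| := by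
      refine (abs_add_le _ _).trans ?_
      rw [abs_mul, abs_mul, abs_of_pos hU.1, abs_of_nonneg (by linarith [hU.2] : 0 ≤ 1 - U)]
      nlinarith [abs_nonneg (lin u x), abs_nonneg (lin v x), hU.1, hU.2]
    have h2 : 1 + |U * lin u x + (1 - U) * lin v x| + |lin w x| ≤ W * R := by
      have := abs_lin_le u x
      have := abs_lin_le v x
      have := abs_lin_le w x
      rw [← hR] at *
      rw [hW]
      linarith
    calc _ ≤ D * (W * R) ^ p * (R * R) := by
          have := h.2.1.bound (U * lin u x + (1 - U) * lin v x) (lin w x)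
          have h3 : D * (1 + |U * lin u x + (1 - U) * lin v x| + |lin w x|) ^ p ≤
              D * (W * R) ^ p := by gcongr
          have := hx j
          have := hx k
          have h4 : |x j| * |x k| ≤ R * R := by gcongr
          exact mul_le_mul (by linarith) h4 (by positivity) (by positivity)
      _ = _ := by rw [mul_pow, pow_add]; ring
  have := intervalIntegral.norm_integral_le_of_norm_le_const hb
  simpa [rowEntry] using this

/-- The expectation of `sampleGrad` over the design. -/
noncomputable def popGrad (P : Measure Ω) (X : Ω → Matrix (Fin m) (Fin n) ℝ) (L F : ℝ → ℝ → ℝ)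
    (ξ : Fin m → ℝ) (μstar u : EuclideanSpace ℝ (Fin n)) : EuclideanSpace ℝ (Fin n) :=
  WithLp.toLp 2 fun j => ∫ ω, sampleGrad L F ξ μstar (X ω) u j ∂P

/-- One summand of `sampleGrad`, as a function of the row. -/
noncomputable def rowGrad (f : ℝ → ℝ → ℝ) (u v : Fin n → ℝ) (j : Fin n) (x : Fin n → ℝ) : ℝ :=
  x j * f (lin u x) (lin v x)

theorem sampleGrad_apply (μstar u : EuclideanSpace ℝ (Fin n)) (A : Matrix (Fin m) (Fin n) ℝ)
    (j : Fin n) : sampleGrad L F ξ μstar A u j = (1 / (m : ℝ)) *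
      ∑ i, rowGrad (score L F (ξ i)) (WithLp.ofLp u) (WithLp.ofLp μstar) j (A i) := rfl

variable (hX : DesignAssumption P X K) (hK : 1 ≤ K)
  (hS : ∀ i, SmoothGrowth p 4 D (score L F (ξ i))) (hD : 0 ≤ D)

include hX hK hS hD

theorem integrable_rowGrad (u v : Fin n → ℝ) (j : Fin n) (i : Fin m) :
    Integrable (fun ω => rowGrad (score L F (ξ i)) u v j (X ω i)) P :=
  (hX.measurePreserving_row i).integrable_comp_of_integrable
    ((hS i).integrable_coord_mul_lin hD (fun j => hX.standardMoments (by linarith) i j)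
      (by nlinarith) u v j)

theorem integrable_sampleGrad (μstar u : EuclideanSpace ℝ (Fin n)) (j : Fin n) :
    Integrable (fun ω => sampleGrad L F ξ μstar (X ω) u j) P := by
  simp_rw [sampleGrad_apply]
  exact (integrable_finsetSum _ fun i _ => integrable_rowGrad hX hK hS hD _ _ j i).const_mul _

theorem popGrad_apply (μstar u : EuclideanSpace ℝ (Fin n)) (j : Fin n) :
    popGrad P X L F ξ μstar u j = (1 / (m : ℝ)) * ∑ i, ∫ ω,
      rowGrad (score L F (ξ i)) (WithLp.ofLp u) (WithLp.ofLp μstar) j (X ω i) ∂P := by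
  simp only [popGrad, sampleGrad_apply]
  rw [integral_const_mul, integral_finsetSum _ fun i _ => integrable_rowGrad hX hK hS hD _ _ j i]

theorem theoGradDescent_succ (η : ℕ → ℝ) (μ0 μstar : EuclideanSpace ℝ (Fin n)) (t : ℕ) :
    theoGradDescent P X L F ξ η μ0 μstar (t + 1) =
      theoGradDescent P X L F ξ η μ0 μstar t -
        η t • popGrad P X L F ξ μstar (theoGradDescent P X L F ξ η μ0 μstar t) := by
  rw [theoGradDescent]
  congr 1
  ext j
  simp only [PiLp.smul_apply, smul_eq_mul]
  rw [popGrad_apply hX hK hS hD,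
    ← integral_finsetSum _ fun i _ => integrable_rowGrad hX hK hS hD _ _ j i,
    div_eq_mul_one_div, mul_assoc]
  rfl

theorem integrable_empMatrix (μstar u v : EuclideanSpace ℝ (Fin n)) (j k : Fin n) :
    Integrable (fun ω => empMatrix L F ξ μstar u v (X ω) j k) P := by
  simp_rw [empMatrix_apply]
  refine (integrable_finsetSum _ fun i _ => ?_).const_mul _
  exact (hX.measurePreserving_row i).integrable_comp_of_integrable (integrable_rowEntry (hS i) hD
    (fun j => hX.standardMoments (by linarith) i j) _ _ _ j k)

/-- Because `u` and `v` are deterministic, expectation commutes with the multiplication by `u - v`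
in `empMatrix_mulVec`. -/
theorem meanMatrix_mulVec (μstar u v : EuclideanSpace ℝ (Fin n)) :
    WithLp.toLp 2 (meanMatrix P X L F ξ μstar u v *ᵥ WithLp.ofLp (u - v)) =
      popGrad P X L F ξ μstar u - popGrad P X L F ξ μstar v := by
  ext j
  have h1 : ∀ ω, ∑ k, empMatrix L F ξ μstar u v (X ω) j k * (u - v) k =
      sampleGrad L F ξ μstar (X ω) u j - sampleGrad L F ξ μstar (X ω) v j := by
    intro ω
    have := congrArg (fun z : EuclideanSpace ℝ (Fin n) => z j)
      (empMatrix_mulVec hS μstar u v (X ω))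
    simpa [Matrix.mulVec, dotProduct] using this
  simp only [popGrad, PiLp.sub_apply, Matrix.mulVec, dotProduct, meanMatrix, Matrix.of_apply]
  rw [← integral_sub (integrable_sampleGrad hX hK hS hD μstar u j)
    (integrable_sampleGrad hX hK hS hD μstar v j)]
  simp_rw [← h1]
  rw [integral_finsetSum _ fun k _ =>
    (integrable_empMatrix hX hK hS hD μstar u v j k).mul_const _]
  simp_rw [integral_mul_const]
  rfl

end

/-! ### Euclidean norms and coordinates -/

theorem norm_le_sqrt_mul {n : ℕ} {w : EuclideanSpace ℝ (Fin n)} {c : ℝ} (hc : 0 ≤ c)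
    (h : ∀ i, |w i| ≤ c) : ‖w‖ ≤ √(n : ℝ) * c := by
  rw [EuclideanSpace.norm_eq, ← Real.sqrt_sq hc, ← Real.sqrt_mul (by positivity)]
  apply Real.sqrt_le_sqrt
  calc ∑ i, ‖w i‖ ^ 2 ≤ ∑ _i : Fin n, c ^ 2 :=
        Finset.sum_le_sum fun i _ => pow_le_pow_left₀ (norm_nonneg _) (h i) 2
    _ = n * c ^ 2 := by simp

theorem abs_apply_le_linftyNorm {n : ℕ} (w : EuclideanSpace ℝ (Fin n)) (i : Fin n) :
    |w i| ≤ linftyNorm w := norm_le_pi_norm (WithLp.ofLp w) i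

theorem linftyNorm_nonneg {n : ℕ} (w : EuclideanSpace ℝ (Fin n)) : 0 ≤ linftyNorm w :=
  norm_nonneg _

theorem norm_le_sqrt_mul_linftyNorm {n : ℕ} (w : EuclideanSpace ℝ (Fin n)) :
    ‖w‖ ≤ √(n : ℝ) * linftyNorm w :=
  norm_le_sqrt_mul (linftyNorm_nonneg w) (abs_apply_le_linftyNorm w)

theorem sumSq_ofLp {n : ℕ} (w : EuclideanSpace ℝ (Fin n)) : sumSq (WithLp.ofLp w) = ‖w‖ ^ 2 := by
  rw [EuclideanSpace.norm_sq_eq]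
  simp [sumSq]

/-! ### The Gaussian gradient -/

section

variable {m n p : ℕ} {D : ℝ} {L F : ℝ → ℝ → ℝ} {ξ : Fin m → ℝ}

/-- The gradient that drives the state evolution. -/
noncomputable def gaussGrad (L F : ℝ → ℝ → ℝ) (ξ : Fin m → ℝ) (μstar u : EuclideanSpace ℝ (Fin n)) :
    EuclideanSpace ℝ (Fin n) :=
  tauStar L F ξ μstar u • u - deltaStar L F ξ μstar u • μstar

theorem stateEvolution_succ (η : ℕ → ℝ) (μ0 μstar : EuclideanSpace ℝ (Fin n)) (t : ℕ) :
    stateEvolution L F ξ η μ0 μstar (t + 1) = stateEvolution L F ξ η μ0 μstar t -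
      η t • gaussGrad L F ξ μstar (stateEvolution L F ξ η μ0 μstar t) := by
  rw [stateEvolution, gaussGrad]
  module

theorem gaussMean_eq {f : Fin m → ℝ → ℝ → ℝ}
    (hf : ∀ i, Continuous fun q : ℝ × ℝ => f i q.1 q.2) (u v : EuclideanSpace ℝ (Fin n)) :
    gaussMean f u v = (1 / (m : ℝ)) * ∑ i, ∫ x, f i (lin (WithLp.ofLp u) x)
      (lin (WithLp.ofLp v) x) ∂(Measure.pi fun _ : Fin n => gaussianReal 0 1) := by
  unfold gaussMean
  congr 1
  refine Finset.sum_congr rfl fun i _ => ?_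
  have hc : Continuous fun z : EuclideanSpace ℝ (Fin n) => f i (inner ℝ z u) (inner ℝ z v) :=
    (hf i).comp (f := fun z : EuclideanSpace ℝ (Fin n) => (inner ℝ z u, inner ℝ z v)) (by fun_prop)
  rw [← map_pi_eq_stdGaussian, integral_map (by fun_prop) hc.aestronglyMeasurable]
  have e : ∀ (w : EuclideanSpace ℝ (Fin n)) (x : Fin n → ℝ),
      inner ℝ (WithLp.toLp 2 x) w = lin (WithLp.ofLp w) x := by
    intro w x
    rw [PiLp.inner_apply]
    simp [lin, mul_comm]
  simp_rw [e]

variable {Ω : Type*} [MeasurableSpace Ω] {P : Measure Ω} [IsProbabilityMeasure P]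
  {X : Ω → Matrix (Fin m) (Fin n) ℝ} {K : ℝ}

theorem norm_popGrad_sub_gaussGrad_le (hm : 1 ≤ m) (hn : 1 ≤ n) (hX : DesignAssumption P X K)
    (hK : 2 ≤ K) (hS : ∀ i, SmoothGrowth p 4 D (score L F (ξ i))) (hD : 0 ≤ D)
    (μstar u : EuclideanSpace ℝ (Fin n)) {B : ℝ} (hB : 1 ≤ B)
    (hu : √(n : ℝ) * linftyNorm u ≤ B) (hv : √(n : ℝ) * linftyNorm μstar ≤ B) :
    ‖popGrad P X L F ξ μstar u - gaussGrad L F ξ μstar u‖ ≤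
      gradError (8 * K ^ 2) D p B * (n : ℝ) ^ (-(1 / 2) : ℝ) := by
  have hn' : (1 : ℝ) ≤ n := by exact_mod_cast hn
  have hm' : (1 : ℝ) ≤ m := by exact_mod_cast hm
  -- This is where `K ≥ 2` matters: one moment parameter serves the entries and the Gaussian.
  have hκ : 32 ≤ 8 * K ^ 2 := by nlinarith
  have hsn : 0 < √(n : ℝ) := Real.sqrt_pos.2 (by linarith)
  have hcoord : ∀ w : EuclideanSpace ℝ (Fin n), √(n : ℝ) * linftyNorm w ≤ B →
      ∀ i, |w i| ≤ B / √(n : ℝ) := by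
    intro w hw i
    rw [le_div_iff₀ hsn, mul_comm]
    exact (mul_le_mul_of_nonneg_left (abs_apply_le_linftyNorm w i) hsn.le).trans hw
  have hg0 : 0 ≤ gradError (8 * K ^ 2) D p B := by
    have := coordError_nonneg (κ := 8 * K ^ 2) (p := p) (U := 2 * B ^ 2) (h := 2 * B)
      (by linarith) hD (by positivity) (by linarith)
    unfold gradError; positivity
  have hrow : ∀ i j, |∫ ω, rowGrad (score L F (ξ i)) (WithLp.ofLp u) (WithLp.ofLp μstar) j (X ω i) ∂P -
      (u j * ∫ x, partialOne (score L F (ξ i)) (lin (WithLp.ofLp u) x) (lin (WithLp.ofLp μstar) x)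
          ∂(Measure.pi fun _ : Fin n => gaussianReal 0 1) +
        μstar j * ∫ x, partialTwo (score L F (ξ i)) (lin (WithLp.ofLp u) x)
          (lin (WithLp.ofLp μstar) x) ∂(Measure.pi fun _ : Fin n => gaussianReal 0 1))| ≤
      gradError (8 * K ^ 2) D p B / n := by
    intro i j
    have mp := hX.measurePreserving_row i
    have e : ∫ ω, rowGrad (score L F (ξ i)) (WithLp.ofLp u) (WithLp.ofLp μstar) j (X ω i) ∂P =
        ∫ x, rowGrad (score L F (ξ i)) (WithLp.ofLp u) (WithLp.ofLp μstar) j x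
          ∂(Measure.pi fun j => P.map fun ω => X ω i j) := by
      rw [← mp.map_eq, integral_map mp.measurable.aemeasurable]
      exact ((continuous_apply j).mul ((hS i).continuous_comp (continuous_lin _)
        (continuous_lin _))).aestronglyMeasurable
    rw [e]
    exact gaussian_approx_pi (hS i) hD (fun j => hX.standardMoments (by linarith) i j)
      (standardMoments_gaussianReal hκ) (by linarith) _ _ hn hB (hcoord u hu) (hcoord μstar hv) j
  have hfin : ∀ j, |(popGrad P X L F ξ μstar u - gaussGrad L F ξ μstar u) j| ≤
      gradError (8 * K ^ 2) D p B / n := by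
    intro j
    have e : (popGrad P X L F ξ μstar u - gaussGrad L F ξ μstar u) j = (1 / (m : ℝ)) * ∑ i,
        (∫ ω, rowGrad (score L F (ξ i)) (WithLp.ofLp u) (WithLp.ofLp μstar) j (X ω i) ∂P -
      (u j * ∫ x, partialOne (score L F (ξ i)) (lin (WithLp.ofLp u) x) (lin (WithLp.ofLp μstar) x)
          ∂(Measure.pi fun _ : Fin n => gaussianReal 0 1) +
        μstar j * ∫ x, partialTwo (score L F (ξ i)) (lin (WithLp.ofLp u) x)
          (lin (WithLp.ofLp μstar) x) ∂(Measure.pi fun _ : Fin n => gaussianReal 0 1))) := by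
      rw [Finset.sum_sub_distrib, Finset.sum_add_distrib, ← Finset.mul_sum, ← Finset.mul_sum,
        PiLp.sub_apply, popGrad_apply hX (by linarith) hS hD, gaussGrad, PiLp.sub_apply,
        PiLp.smul_apply, PiLp.smul_apply, tauStar, deltaStar,
        gaussMean_eq (fun i => (hS i).2.1.continuous), gaussMean_eq (fun i => (hS i).2.2.continuous)]
      simp only [smul_eq_mul]
      ring
    rw [e, abs_mul, abs_of_nonneg (by positivity : (0 : ℝ) ≤ 1 / m), one_div,
      inv_mul_le_iff₀ (by linarith)]
    refine (Finset.abs_sum_le_sum_abs _ _).trans ?_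
    refine (Finset.sum_le_sum fun i _ => hrow i j).trans (le_of_eq ?_)
    simp
  -- Each coordinate is `O(1/n)`, so the Euclidean norm is `√n / n = n^(-1/2)`.
  refine (norm_le_sqrt_mul (by positivity) hfin).trans (le_of_eq ?_)
  rw [Real.rpow_neg (by linarith), ← Real.sqrt_eq_rpow]
  field_simp
  rw [Real.sq_sqrt (by linarith), mul_comm]

/-! ### Concentration of the empirical gradient -/

/-- The moment parameter of one summand of the empirical gradient. -/
noncomputable def rowBound (K D : ℝ) (p k : ℕ) (U : ℝ) : ℝ :=
  D ^ 2 * envBound (8 * K ^ 2) ((p + 1) * k) U ^ (p + 1)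

/-- A summand is at most `D` times the `(p+1)`-st power of the envelope: `p` from the score and one
from the entry. This forces moment order `(p+1) k`. -/
theorem momentBound_rowGrad (hX : DesignAssumption P X K) (hK : 1 ≤ K)
    (hS : ∀ i, SmoothGrowth p 4 D (score L F (ξ i))) (hD : 0 ≤ D) (u v : Fin n → ℝ) (j : Fin n)
    (i : Fin m) {k : ℕ} (hk : 1 ≤ k) :
    MomentBound P k (rowBound K D p k (sumSq u + sumSq v))
      (fun ω => rowGrad (score L F (ξ i)) u v j (X ω i)) := by
  have hν : ∀ j, StandardMoments (8 * K ^ 2) (P.map fun ω => X ω i j) := fun j =>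
    hX.standardMoments (by linarith) i j
  have h1 := momentBound_envelope hν (by nlinarith) u v j (k := (p + 1) * k)
    (Nat.mul_pos (by omega) hk)
  refine MomentBound.comp (f := rowGrad (score L F (ξ i)) u v j) ?_ (hX.measurePreserving_row i)
  refine h1.of_abs_le_pow ((continuous_apply j).mul ((hS i).continuous_comp (continuous_lin _)
        (continuous_lin _))).measurable hD fun x => ?_
  have h2 := (hS i).bound_lin hD u v j x
  have h3 := abs_coord_le_envelope u v j x
  have h4 := one_le_envelope u v j x
  rw [abs_of_nonneg (zero_le_one.trans h4)]
  calc |x j * score L F (ξ i) (lin u x) (lin v x)|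
      = |x j| * |score L F (ξ i) (lin u x) (lin v x)| := abs_mul _ _
    _ ≤ envelope u v j x * (D * envelope u v j x ^ p) := by gcongr
    _ = _ := by ring

theorem measure_sampleGrad_deviation_le (hm : 1 ≤ m) (hX : DesignAssumption P X K) (hK : 1 ≤ K)
    (hS : ∀ i, SmoothGrowth p 4 D (score L F (ξ i))) (hD : 0 < D)
    (μstar u : EuclideanSpace ℝ (Fin n)) (j : Fin n) {k : ℕ} (hk : 1 ≤ k) {U : ℝ}
    (hU : ‖u‖ ^ 2 + ‖μstar‖ ^ 2 ≤ U) :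
    Measurable (fun ω => sampleGrad L F ξ μstar (X ω) u j) ∧
    P.real {ω | Real.exp 1 * √(32 * (k : ℝ) ^ 2 * rowBound K D p k U / m) <
        |sampleGrad L F ξ μstar (X ω) u j - popGrad P X L F ξ μstar u j|} ≤
      Real.exp (-(2 * k)) := by
  have hm' : (1 : ℝ) ≤ m := by exact_mod_cast hm
  have hk' : (1 : ℝ) ≤ k := by exact_mod_cast hk
  rw [← sumSq_ofLp, ← sumSq_ofLp] at hU
  set u' := WithLp.ofLp u
  set v' := WithLp.ofLp μstar
  have hU0 : 0 ≤ sumSq u' + sumSq v' := add_nonneg (sumSq_nonneg _) (sumSq_nonneg _)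
  have hmono : rowBound K D p k (sumSq u' + sumSq v') ≤ rowBound K D p k U := by
    unfold rowBound
    have := envBound_nonneg (κ := 8 * K ^ 2) (by positivity) ((p + 1) * k) hU0
    have := envBound_mono (κ := 8 * K ^ 2) (by positivity) ((p + 1) * k) hU
    gcongr
  set b := rowBound K D p k U with hb
  have hb0 : 0 < b := by
    rw [hb]; unfold rowBound envBound
    have : 0 ≤ U := hU0.trans hU
    have : (0 : ℝ) < ((p + 1) * k : ℕ) := by exact_mod_cast Nat.mul_pos (by omega) hk
    positivity
  set V : Fin m → Ω → ℝ := fun i ω => rowGrad (score L F (ξ i)) u' v' j (X ω i) with hV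
  have mV : ∀ i, MomentBound P k b (V i) := fun i => by
    have h1 := momentBound_rowGrad hX hK hS hD.le u' v' j i hk
    exact h1.mono (h1.nonneg hk) hmono le_rfl
  have mW : ∀ i, MomentBound P k ((1 / (m : ℝ)) ^ 2 * (4 * (b + b)))
      (fun ω => 1 / (m : ℝ) * (V i ω + -∫ ω, V i ω ∂P)) := fun i => by
    refine ((mV i).add (momentBound_const k ?_) hb0.le hb0.le).const_mul _
    rw [neg_sq]
    exact (mV i).sq_integral_le hk
  have hind : iIndepFun (fun i ω => 1 / (m : ℝ) * (V i ω + -∫ ω, V i ω ∂P)) P := by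
    refine hX.indep_rows.comp (g := fun i (x : Fin n → ℝ) =>
      1 / (m : ℝ) * (rowGrad (score L F (ξ i)) u' v' j x + -∫ ω, V i ω ∂P)) fun i => ?_
    have : Measurable (rowGrad (score L F (ξ i)) u' v' j) :=
      ((continuous_apply j).mul ((hS i).continuous_comp (continuous_lin _)
        (continuous_lin _))).measurable
    fun_prop
  have hzero : ∀ i, ∫ ω, 1 / (m : ℝ) * (V i ω + -∫ ω, V i ω ∂P) ∂P = 0 := by
    intro i
    rw [integral_const_mul, integral_add ((mV i).integrable_self hk) (integrable_const _)]
    simp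
  have hsum := momentBound_sum mW hind hzero Finset.univ
  have e1 : ∀ ω, ∑ i, 1 / (m : ℝ) * (V i ω + -∫ ω, V i ω ∂P) =
      sampleGrad L F ξ μstar (X ω) u j - popGrad P X L F ξ μstar u j := by
    intro ω
    rw [popGrad_apply hX hK hS hD.le, sampleGrad_apply, ← Finset.mul_sum, ← mul_sub,
      ← Finset.sum_sub_distrib]
    rfl
  -- Centring costs `8`, the independent sum `4k²`, and averaging leaves `1/m`.
  have e2 : 4 * (k : ℝ) ^ 2 * ∑ _i : Fin m, (1 / (m : ℝ)) ^ 2 * (4 * (b + b)) =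
      32 * (k : ℝ) ^ 2 * b / m := by
    simp; field_simp; ring
  simp_rw [e1] at hsum
  rw [e2] at hsum
  refine ⟨?_, hsum.measure_lt_le (by positivity)⟩
  simpa using hsum.measurable.add_const (popGrad P X L F ξ μstar u j)

end

/-! ### Absorbing the constants -/

/-- The exponent of the main bound. -/
def mainExponent (p : ℕ) : ℕ := 14 + 4 * p + (4 * p + 29) * (p + 3)

theorem natCast_le_pow {Z : ℝ} (hZ : 2 ≤ Z) (a : ℕ) : (a : ℝ) ≤ Z ^ a := by
  calc (a : ℝ) ≤ (2 : ℝ) ^ a := by exact_mod_cast Nat.lt_two_pow_self.le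
    _ ≤ Z ^ a := by gcongr

theorem le_pow_of_le_two_pow {Z c : ℝ} (hZ : 2 ≤ Z) {a : ℕ} (hc : c ≤ 2 ^ a) : c ≤ Z ^ a :=
  hc.trans (by gcongr)

/-- Every parameter is replaced by `Z`, and numerical constants become powers of `Z` since `Z ≥ 2`;
here `6144 ≤ 2 ^ 13`. -/
theorem envBound_le_pow {Z K B : ℝ} (hZ : 2 ≤ Z) (hK0 : 0 ≤ K) (hK : K ≤ Z) (hB1 : 1 ≤ B)
    (hB : B ≤ Z) (k a : ℕ) (hk : (k : ℝ) ≤ Z ^ a) :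
    envBound (8 * K ^ 2) k (2 * B ^ 2) ≤ Z ^ (17 + 4 * a) := by
  unfold envBound
  have hZ0 : 0 ≤ Z := by linarith
  calc 256 * (8 * K ^ 2) * (k : ℝ) ^ 4 * (1 + 2 * B ^ 2)
      ≤ 256 * (8 * Z ^ 2) * (Z ^ a) ^ 4 * (3 * Z ^ 2) := by
        have : 1 + 2 * B ^ 2 ≤ 3 * Z ^ 2 := by nlinarith
        gcongr
    _ = 6144 * (Z ^ (4 + 4 * a)) := by ring
    _ ≤ Z ^ 13 * Z ^ (4 + 4 * a) := by
        gcongr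
        exact le_pow_of_le_two_pow hZ (by norm_num)
    _ = _ := by rw [← pow_add]; congr 1; ring

theorem concentration_constant_le {Z H K Λ B x : ℝ} (hZ : 2 ≤ Z) (hH : H ≤ Z)
    (hK0 : 0 ≤ K) (hK : K ≤ Z) (hΛ0 : 0 ≤ Λ) (hΛ : Λ ≤ Z) (hB1 : 1 ≤ B) (hB : B ≤ Z)
    (hx : x ≤ Z) (p k m n : ℕ) (hk : (k : ℝ) ≤ 2 * x) :
    H * (√(n : ℝ) * (Real.exp 1 *
        √(32 * (k : ℝ) ^ 2 * rowBound K (2 * Λ) p k (2 * B ^ 2) / m))) ≤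
      Z ^ mainExponent p * ((m : ℝ) / n) ^ (-(1 / 2) : ℝ) := by
  have hZ0 : 0 ≤ Z := by linarith
  set e := envBound (8 * K ^ 2) ((p + 1) * k) (2 * B ^ 2) with he
  have he0 : 0 ≤ e := envBound_nonneg (by positivity) _ (by positivity)
  have hkZ : (k : ℝ) ≤ Z ^ 2 := by nlinarith
  have heZ : e ≤ Z ^ (17 + 4 * (p + 3)) := by
    refine envBound_le_pow hZ hK0 hK hB1 hB _ _ ?_
    push_cast
    calc ((p : ℝ) + 1) * k ≤ Z ^ (p + 1) * Z ^ 2 := by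
          gcongr
          exact_mod_cast natCast_le_pow hZ (p + 1)
      _ = Z ^ (p + 3) := by rw [← pow_add]
  set G := 2 * Λ * (Z ^ (17 + 4 * (p + 3))) ^ (p + 1) with hG
  have hG0 : 0 ≤ G := by positivity
  -- Squaring the envelope factor is wasteful but makes the bound a perfect square, so the root that
  -- follows keeps integer exponents.
  have hrb : rowBound K (2 * Λ) p k (2 * B ^ 2) ≤ G ^ 2 := by
    unfold rowBound
    rw [hG, mul_pow (2 * Λ)]
    have h1 : (1 : ℝ) ≤ (Z ^ (17 + 4 * (p + 3))) ^ (p + 1) :=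
      one_le_pow₀ (one_le_pow₀ (by linarith))
    have h2 : e ^ (p + 1) ≤ (Z ^ (17 + 4 * (p + 3))) ^ (p + 1) := by gcongr
    have h3 : e ^ (p + 1) ≤ ((Z ^ (17 + 4 * (p + 3))) ^ (p + 1)) ^ 2 :=
      h2.trans (le_self_pow₀ h1 (by norm_num))
    exact mul_le_mul_of_nonneg_left h3 (sq_nonneg _)
  have hsq : √(32 * (k : ℝ) ^ 2 * rowBound K (2 * Λ) p k (2 * B ^ 2) / m) ≤
      6 * k * G / √(m : ℝ) := by
    rw [Real.sqrt_div' _ (by positivity)]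
    refine div_le_div_of_nonneg_right ?_ (Real.sqrt_nonneg _)
    refine Real.sqrt_le_iff.2 ⟨by positivity, ?_⟩
    calc _ ≤ 32 * (k : ℝ) ^ 2 * G ^ 2 := by gcongr
      _ ≤ 36 * (k : ℝ) ^ 2 * G ^ 2 := by gcongr; norm_num
      _ = _ := by ring
  have hphi : ((m : ℝ) / n) ^ (-(1 / 2) : ℝ) = √(n : ℝ) / √(m : ℝ) := by
    rw [Real.rpow_neg (by positivity), ← Real.sqrt_eq_rpow, Real.sqrt_div (by positivity), inv_div]
  rw [hphi]
  have hexp : Real.exp 1 ≤ 3 := by linarith [Real.exp_one_lt_d9]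
  calc _ ≤ Z * (√(n : ℝ) * (3 * (6 * Z ^ 2 * G / √(m : ℝ)))) := by
        gcongr
        refine hsq.trans ?_
        gcongr
    _ = 36 * (Z ^ 3 * Λ * (Z ^ (17 + 4 * (p + 3))) ^ (p + 1)) * (√(n : ℝ) / √(m : ℝ)) := by
        rw [hG]; ring
    _ ≤ Z ^ 6 * (Z ^ 3 * Z * (Z ^ (17 + 4 * (p + 3))) ^ (p + 1)) * (√(n : ℝ) / √(m : ℝ)) := by
        gcongr
        exact le_pow_of_le_two_pow hZ (by norm_num)
    _ = Z ^ (10 + (4 * p + 29) * (p + 1)) * (√(n : ℝ) / √(m : ℝ)) := by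
        congr 1
        rw [← pow_mul, ← pow_succ, ← pow_add, ← pow_add]
        congr 1; ring
    _ ≤ _ := by
        gcongr
        · linarith
        -- `mainExponent` is the exponent that `gradError_constant_le` produces exactly; the
        -- concentration bound needs only `10 + (4p + 29)(p + 1)`.
        · unfold mainExponent; nlinarith

theorem gradError_constant_le {Z H K Λ B : ℝ} (hZ : 2 ≤ Z) (hH : H ≤ Z)
    (hK0 : 0 ≤ K) (hK : K ≤ Z) (hΛ0 : 0 ≤ Λ) (hΛ : Λ ≤ Z) (hB1 : 1 ≤ B) (hB : B ≤ Z) (p : ℕ) :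
    H * gradError (8 * K ^ 2) (2 * Λ) p B ≤ Z ^ mainExponent p := by
  have hZ0 : 0 ≤ Z := by linarith
  have he := envBound_le_pow hZ hK0 hK hB1 hB (p + 3) (p + 3) (natCast_le_pow hZ (p + 3))
  have he0 : 0 ≤ envBound (8 * K ^ 2) (p + 3) (2 * B ^ 2) :=
    envBound_nonneg (by positivity) _ (by positivity)
  unfold gradError coordError
  calc _ ≤ Z * (36 * Z ^ 4 * (2 * (2 * Z) * (Z ^ 4) ^ p * (Z ^ (17 + 4 * (p + 3))) ^ (p + 3))) := by
        have h1 : 1 + 2 * (2 * B) ≤ Z ^ 4 := by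
          have : 5 * B ≤ Z ^ 3 * Z := by
            have : 2 ^ 3 ≤ Z ^ 3 := by gcongr
            nlinarith
          nlinarith
        gcongr
    _ = 144 * (Z ^ 6 * (Z ^ 4) ^ p * (Z ^ (17 + 4 * (p + 3))) ^ (p + 3)) := by ring
    _ ≤ Z ^ 8 * (Z ^ 6 * (Z ^ 4) ^ p * (Z ^ (17 + 4 * (p + 3))) ^ (p + 3)) := by
        gcongr
        exact le_pow_of_le_two_pow hZ (by norm_num)
    _ = Z ^ mainExponent p := by
        rw [← pow_mul, ← pow_mul, ← pow_add, ← pow_add, ← pow_add]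
        congr 1
        unfold mainExponent; ring

/-! ### The main bound -/

section

variable {Ω : Type*} [MeasurableSpace Ω] {P : Measure Ω} [IsProbabilityMeasure P] {m n p : ℕ}
  {X : Ω → Matrix (Fin m) (Fin n) ℝ} {K D : ℝ} {L F : ℝ → ℝ → ℝ} {ξ : Fin m → ℝ}

/-- A pathwise statement: randomness enters through the deviation `c` at the deterministic
theoretical iterates, never at the data-dependent ones. -/
theorem norm_gradDescent_sub_theoGradDescent_le (hX : DesignAssumption P X K) (hK : 1 ≤ K)
    (hS : ∀ i, SmoothGrowth p 4 D (score L F (ξ i))) (hD : 0 ≤ D) {η : ℕ → ℝ} (hη : ∀ s, 0 < η s)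
    (μ0 μstar : EuclideanSpace ℝ (Fin n)) {t : ℕ} (ht : 1 ≤ t) {H c : ℝ} (hc : 0 ≤ c)
    (hH : ∀ s < t, η s ≤ H) (ω : Ω)
    (h : ∀ s < t, ∀ j, |sampleGrad L F ξ μstar (X ω) (theoGradDescent P X L F ξ η μ0 μstar s) j -
      popGrad P X L F ξ μstar (theoGradDescent P X L F ξ η μ0 μstar s) j| ≤ c) :
    ‖gradDescent L η μ0 (X ω) (response F ξ μstar (X ω)) t -
        theoGradDescent P X L F ξ η μ0 μstar t‖ ≤ H * (√(n : ℝ) * c) *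
      empGrowth L F ξ η μstar (gradDescent L η μ0 (X ω) (response F ξ μstar (X ω)))
        (theoGradDescent P X L F ξ η μ0 μstar) (X ω) (t - 1) := by
  have hH0 : 0 ≤ H := (hη 0).le.trans (hH 0 (by omega))
  refine le_mul_growth η _ (a := fun s => ‖gradDescent L η μ0 (X ω) (response F ξ μstar (X ω)) s -
        theoGradDescent P X L F ξ η μ0 μstar s‖) (by positivity) ?_ ht ?_
  · simp [gradDescent, theoGradDescent]
  · intro s hs
    rw [gradDescent_succ (ξ := ξ) (F := F), theoGradDescent_succ hX hK hS hD]
    refine (norm_gradStep_sub_le _ (η s) (hη s).le (empMatrix_mulVec hS μstar _ _ (X ω))).trans ?_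
    gcongr
    · exact hH s hs
    · exact norm_le_sqrt_mul hc fun j => h s hs j

theorem norm_theoGradDescent_sub_stateEvolution_le (hm : 1 ≤ m) (hn : 1 ≤ n)
    (hX : DesignAssumption P X K) (hK : 2 ≤ K)
    (hS : ∀ i, SmoothGrowth p 4 D (score L F (ξ i))) (hD : 0 ≤ D) {η : ℕ → ℝ} (hη : ∀ s, 0 < η s)
    (μ0 μstar : EuclideanSpace ℝ (Fin n)) {t : ℕ} (ht : 1 ≤ t) {H B : ℝ} (hB : 1 ≤ B)
    (hH : ∀ s < t, η s ≤ H) (hv : √(n : ℝ) * linftyNorm μstar ≤ B)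
    (hu : ∀ s < t, √(n : ℝ) * linftyNorm (stateEvolution L F ξ η μ0 μstar s) ≤ B) :
    ‖theoGradDescent P X L F ξ η μ0 μstar t - stateEvolution L F ξ η μ0 μstar t‖ ≤
      H * (gradError (8 * K ^ 2) D p B * (n : ℝ) ^ (-(1 / 2) : ℝ)) *
      meanGrowth P X L F ξ η μstar (theoGradDescent P X L F ξ η μ0 μstar)
        (stateEvolution L F ξ η μ0 μstar) (t - 1) := by
  have hH0 : 0 ≤ H := (hη 0).le.trans (hH 0 (by omega))
  have hg0 : 0 ≤ gradError (8 * K ^ 2) D p B := by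
    have := coordError_nonneg (κ := 8 * K ^ 2) (p := p) (U := 2 * B ^ 2) (h := 2 * B)
      (by positivity) hD (by positivity) (by linarith)
    unfold gradError; positivity
  refine le_mul_growth η _ (a := fun s => ‖theoGradDescent P X L F ξ η μ0 μstar s -
        stateEvolution L F ξ η μ0 μstar s‖) (by positivity) ?_ ht ?_
  · simp [stateEvolution, theoGradDescent]
  · intro s hs
    rw [stateEvolution_succ, theoGradDescent_succ hX (by linarith) hS hD]
    refine (norm_gradStep_sub_le _ (η s) (hη s).le
      (meanMatrix_mulVec hX (by linarith) hS hD μstar _ _)).trans ?_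
    gcongr
    · exact hH s hs
    · exact norm_popGrad_sub_gaussGrad_le hm hn hX hK hS hD μstar _ hB (hu s hs) hv

/-- The empirical gradients along a deterministic sequence concentrate simultaneously. -/
theorem measure_all_sampleGrad_le (hm : 1 ≤ m) (hX : DesignAssumption P X K) (hK : 1 ≤ K)
    (hS : ∀ i, SmoothGrowth p 4 D (score L F (ξ i))) (hD : 0 < D)
    (μstar : EuclideanSpace ℝ (Fin n)) (u : ℕ → EuclideanSpace ℝ (Fin n)) (t : ℕ) {k : ℕ}
    (hk : 1 ≤ k) {U : ℝ} (hU : ∀ s < t, ‖u s‖ ^ 2 + ‖μstar‖ ^ 2 ≤ U) :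
    1 - n * t * Real.exp (-(2 * k)) ≤ P.real {ω | ∀ s < t, ∀ j,
      |sampleGrad L F ξ μstar (X ω) (u s) j - popGrad P X L F ξ μstar (u s) j| ≤
        Real.exp 1 * √(32 * (k : ℝ) ^ 2 * rowBound K D p k U / m)} := by
  set c := Real.exp 1 * √(32 * (k : ℝ) ^ 2 * rowBound K D p k U / m) with hc
  set bad : ℕ → Fin n → Set Ω := fun s j =>
    {ω | c < |sampleGrad L F ξ μstar (X ω) (u s) j - popGrad P X L F ξ μstar (u s) j|} with hbad
  have hb : ∀ s < t, ∀ j, MeasurableSet (bad s j) ∧ P.real (bad s j) ≤ Real.exp (-(2 * k)) := by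
    intro s hs j
    obtain ⟨h1, h2⟩ := measure_sampleGrad_deviation_le hm hX hK hS hD μstar (u s) j hk (hU s hs)
    refine ⟨measurableSet_lt measurable_const ?_, h2⟩
    exact measurable_norm.comp (h1.sub_const _)
  set B : Set Ω := ⋃ s ∈ Finset.range t, ⋃ j ∈ (Finset.univ : Finset (Fin n)), bad s j with hB
  have hBm : MeasurableSet B :=
    Finset.measurableSet_biUnion _ fun s hs =>
      Finset.measurableSet_biUnion _ fun j _ => (hb s (Finset.mem_range.1 hs) j).1
  have hBle : P.real B ≤ n * t * Real.exp (-(2 * k)) := by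
    calc P.real B ≤ ∑ s ∈ Finset.range t,
          P.real (⋃ j ∈ (Finset.univ : Finset (Fin n)), bad s j) :=
          measureReal_biUnion_finset_le _ _
      _ ≤ ∑ s ∈ Finset.range t, ∑ _j : Fin n, Real.exp (-(2 * k)) := by
          refine Finset.sum_le_sum fun s hs => ?_
          exact (measureReal_biUnion_finset_le _ _).trans
            (Finset.sum_le_sum fun j _ => (hb s (Finset.mem_range.1 hs) j).2)
      _ = n * t * Real.exp (-(2 * k)) := by simp; ring
  have hsub : Bᶜ ⊆ {ω | ∀ s < t, ∀ j,
      |sampleGrad L F ξ μstar (X ω) (u s) j - popGrad P X L F ξ μstar (u s) j| ≤ c} := by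
    intro ω hω s hs j
    by_contra hlt
    refine hω ?_
    simp only [hB, Set.mem_iUnion]
    exact ⟨s, Finset.mem_range.2 hs, j, Finset.mem_univ j, not_le.1 hlt⟩
  have h1 := measureReal_mono (μ := P) hsub
  rw [probReal_compl_eq_one_sub hBm] at h1
  linarith

end

end NonconvexGD

/-- The vectors `μ0`, `μstar`, `ξ` are fixed: the probability is over the design `X` only. -/
theorem theorem2p4 :
    ∃ c₀ : ℝ, 1 < c₀ ∧ ∀ p : ℕ, 1 ≤ p → ∃ c : ℝ, 1 < c ∧
      ∀ {Ω : Type*} [MeasurableSpace Ω] (P : Measure Ω) [IsProbabilityMeasure P]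
        (m n : ℕ) (_ : 1 ≤ m) (_ : 1 ≤ n)
        (X : Ω → Matrix (Fin m) (Fin n) ℝ)
        (L F : ℝ → ℝ → ℝ) (ξ : Fin m → ℝ) (η : ℕ → ℝ)
        (μ0 μstar : EuclideanSpace ℝ (Fin n))
        (K Λ : ℝ) (_ : 2 ≤ K) (_ : 2 ≤ Λ)
        (_ : ∀ s, 0 < η s)
        (_ : NonconvexGD.DesignAssumption P X K)
        (_ : NonconvexGD.ScoreAssumption L F ξ Λ p)
        (t : ℕ) (_ : 1 ≤ t) (x : ℝ) (_ : 1 ≤ x),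
        let μ : Ω → ℕ → EuclideanSpace ℝ (Fin n) := fun ω =>
          NonconvexGD.gradDescent L η μ0 (X ω) (NonconvexGD.response F ξ μstar (X ω))
        let uX : ℕ → EuclideanSpace ℝ (Fin n) :=
          NonconvexGD.theoGradDescent P X L F ξ η μ0 μstar
        let ustar : ℕ → EuclideanSpace ℝ (Fin n) :=
          NonconvexGD.stateEvolution L F ξ η μ0 μstar
        let φ : ℝ := (m : ℝ) / n
        1 - c₀ * n * t * Real.exp (-x) ≤
          P.real {ω | ‖μ ω t - ustar t‖ ≤
            (K * Λ * NonconvexGD.initialSize μ0 μstar *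
                max 1 (NonconvexGD.maxOver (Finset.range t) fun s => |η s|) * x) ^ c *
              (1 + NonconvexGD.maxOver (Finset.Icc 1 (t - 1)) fun s =>
                max (√(n : ℝ) * NonconvexGD.linftyNorm (ustar s)) ‖uX s‖) ^ c *
              (φ ^ (-(1 / 2) : ℝ) *
                  NonconvexGD.empGrowth L F ξ η μstar (μ ω) uX (X ω) (t - 1) +
                (n : ℝ) ^ (-(1 / 2) : ℝ) *
                  NonconvexGD.meanGrowth P X L F ξ η μstar uX ustar (t - 1))} := by
  -- The union bound gives constant one; `2` is chosen only to exceed it strictly.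
  refine ⟨2, by norm_num, fun p hp => ⟨(NonconvexGD.mainExponent p : ℝ), ?_, ?_⟩⟩
  · have : 2 ≤ NonconvexGD.mainExponent p := by unfold NonconvexGD.mainExponent; omega
    have : (2 : ℝ) ≤ NonconvexGD.mainExponent p := by exact_mod_cast this
    linarith
  intro Ω _ P _ m n hm hn X L F ξ η μ0 μstar K Λ hK hΛ hη hX hScore t ht x hx μ uX ustar φ
  have hS := fun i => hScore.smoothGrowth hp (by linarith) i
  set L0 := NonconvexGD.initialSize μ0 μstar with hL0
  set H := max 1 (NonconvexGD.maxOver (Finset.range t) fun s => |η s|) with hH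
  set R := 1 + NonconvexGD.maxOver (Finset.Icc 1 (t - 1)) fun s =>
    max (√(n : ℝ) * NonconvexGD.linftyNorm (ustar s)) ‖uX s‖ with hR
  have hL01 : 1 ≤ L0 := by
    rw [hL0]; unfold NonconvexGD.initialSize
    have := NonconvexGD.linftyNorm_nonneg μ0
    have := NonconvexGD.linftyNorm_nonneg μstar
    have h1 : 0 ≤ √(n : ℝ) * NonconvexGD.linftyNorm μ0 := by positivity
    have h2 : 0 ≤ √(n : ℝ) * NonconvexGD.linftyNorm μstar := by positivity
    linarith
  have hμ0 : √(n : ℝ) * NonconvexGD.linftyNorm μ0 ≤ L0 := by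
    rw [hL0]; unfold NonconvexGD.initialSize
    have := mul_nonneg (Real.sqrt_nonneg (n : ℝ)) (NonconvexGD.linftyNorm_nonneg μstar)
    linarith
  have hμs : √(n : ℝ) * NonconvexGD.linftyNorm μstar ≤ L0 := by
    rw [hL0]; unfold NonconvexGD.initialSize
    have := mul_nonneg (Real.sqrt_nonneg (n : ℝ)) (NonconvexGD.linftyNorm_nonneg μ0)
    linarith
  have hR1 : 1 ≤ R := by
    have := NonconvexGD.maxOver_nonneg (Finset.Icc 1 (t - 1)) fun s =>
      max (√(n : ℝ) * NonconvexGD.linftyNorm (ustar s)) ‖uX s‖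
    linarith
  have hH1 : 1 ≤ H := le_max_left _ _
  have hηH : ∀ s < t, η s ≤ H := fun s hs => (le_abs_self _).trans
    ((NonconvexGD.le_maxOver (f := fun s => |η s|) (Finset.mem_range.2 hs)).trans
      (le_max_right _ _))
  set B := L0 * R with hB
  have hLB : L0 ≤ B := le_mul_of_one_le_right (by linarith) hR1
  have hRB : R ≤ B := le_mul_of_one_le_left (by linarith) hL01
  have hstep : ∀ s < t, √(n : ℝ) * NonconvexGD.linftyNorm (ustar s) ≤ B ∧ ‖uX s‖ ≤ B := by
    intro s hs
    -- The maximum in `R` starts at `s = 1`; the common initial point is covered by `L0` instead.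
    rcases Nat.eq_zero_or_pos s with rfl | hs0
    · exact ⟨hμ0.trans hLB, (NonconvexGD.norm_le_sqrt_mul_linftyNorm μ0).trans (hμ0.trans hLB)⟩
    · have := NonconvexGD.le_maxOver (I := Finset.Icc 1 (t - 1)) (i := s) (f := fun s =>
        max (√(n : ℝ) * NonconvexGD.linftyNorm (ustar s)) ‖uX s‖)
        (Finset.mem_Icc.2 ⟨hs0, by omega⟩)
      exact ⟨(le_max_left _ _).trans (by linarith), (le_max_right _ _).trans (by linarith)⟩
  set Q := K * Λ * L0 * H * x with hQ
  have hQK : 1 ≤ K * Λ := by nlinarith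
  have hZ : ∀ y : ℝ, ∀ a b c d e f : ℝ, 1 ≤ a → 1 ≤ b → 1 ≤ c → 1 ≤ d → 1 ≤ e → 1 ≤ f →
      y ≤ a → y ≤ a * (b * c * d * e * f) := by
    intro y a b c d e f ha hb hc hd he hf hy
    refine hy.trans (le_mul_of_one_le_right (by linarith) ?_)
    exact one_le_mul_of_one_le_of_one_le (one_le_mul_of_one_le_of_one_le
      (one_le_mul_of_one_le_of_one_le (one_le_mul_of_one_le_of_one_le hb hc) hd) he) hf
  -- The target prefactor is `Q ^ c * R ^ c = Z ^ c`, and `Z` dominates `K`, `Λ`, `H`, `x` and `B`.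
  set Z := Q * R with hZdef
  have hK1 : 1 ≤ K := by linarith
  have hΛ1 : 1 ≤ Λ := by linarith
  have ZK : K ≤ Z := (hZ K K Λ L0 H x R hK1 hΛ1 hL01 hH1 hx hR1 le_rfl).trans
    (le_of_eq (by rw [hZdef, hQ]; ring))
  have ZΛ : Λ ≤ Z := (hZ Λ Λ K L0 H x R hΛ1 hK1 hL01 hH1 hx hR1 le_rfl).trans
    (le_of_eq (by rw [hZdef, hQ]; ring))
  have ZH : H ≤ Z := (hZ H H K Λ L0 x R hH1 hK1 hΛ1 hL01 hx hR1 le_rfl).trans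
    (le_of_eq (by rw [hZdef, hQ]; ring))
  have Zx : x ≤ Z := (hZ x x K Λ L0 H R hx hK1 hΛ1 hL01 hH1 hR1 le_rfl).trans
    (le_of_eq (by rw [hZdef, hQ]; ring))
  have ZB : B ≤ Z := (hZ B B K Λ H x 1 (hL01.trans hLB) hK1 hΛ1 hH1 hx le_rfl le_rfl).trans
    (le_of_eq (by rw [hZdef, hQ, hB]; ring))
  have hZ2 : 2 ≤ Z := hK.trans ZK
  -- Rounding up keeps `exp (-2k) ≤ exp (-x)`, and `x ≥ 1` gives `k ≤ 2x`, so the powers of `k` are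
  -- absorbed into powers of `Z`.
  set k := ⌈x⌉₊ with hk
  have hxk : x ≤ k := Nat.le_ceil x
  have hk1 : 1 ≤ k := by
    have : (1 : ℝ) ≤ k := hx.trans hxk
    exact_mod_cast this
  have hk2 : (k : ℝ) ≤ 2 * x := by
    have := Nat.ceil_lt_add_one (zero_le_one.trans hx)
    linarith
  have hprob := NonconvexGD.measure_all_sampleGrad_le hm hX hK1 hS (by linarith) μstar uX t hk1
    (U := 2 * B ^ 2) (fun s hs => by
      have h1 := pow_le_pow_left₀ (norm_nonneg _) (hstep s hs).2 2
      have h2 := pow_le_pow_left₀ (norm_nonneg _)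
        ((NonconvexGD.norm_le_sqrt_mul_linftyNorm μstar).trans (hμs.trans hLB)) 2
      linarith)
  have hexp : (n : ℝ) * t * Real.exp (-(2 * k)) ≤ 2 * n * t * Real.exp (-x) := by
    have h1 : Real.exp (-(2 * k)) ≤ Real.exp (-x) := Real.exp_le_exp.2 (by linarith)
    have h2 : (0 : ℝ) ≤ n * t := by positivity
    have h3 := mul_le_mul_of_nonneg_left h1 h2
    have h4 : 0 ≤ n * t * Real.exp (-x) := by positivity
    linarith
  refine (by linarith : _ ≤ _).trans (hprob.trans (measureReal_mono ?_))
  intro ω hω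
  have c1 := NonconvexGD.norm_gradDescent_sub_theoGradDescent_le hX hK1 hS (by linarith) hη μ0 μstar
    ht (by positivity) hηH ω hω
  have c2 := NonconvexGD.norm_theoGradDescent_sub_stateEvolution_le hm hn hX hK hS (by linarith) hη
    μ0 μstar ht (hL01.trans hLB) hηH (hμs.trans hLB) fun s hs => (hstep s hs).1
  have b1 := NonconvexGD.concentration_constant_le hZ2 ZH (by linarith) ZK
    (by linarith) ZΛ (hL01.trans hLB) ZB Zx p k m n hk2
  have b2 := NonconvexGD.gradError_constant_le hZ2 ZH (by linarith) ZK
    (by linarith) ZΛ (hL01.trans hLB) ZB p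
  have g1 : 0 ≤ NonconvexGD.empGrowth L F ξ η μstar (μ ω) uX (X ω) (t - 1) :=
    zero_le_one.trans (NonconvexGD.one_le_growth _ _ _)
  have g2 : 0 ≤ NonconvexGD.meanGrowth P X L F ξ η μstar uX ustar (t - 1) :=
    zero_le_one.trans (NonconvexGD.one_le_growth _ _ _)
  have hn0 : 0 ≤ (n : ℝ) ^ (-(1 / 2) : ℝ) := by positivity
  have d1 := c1.trans (mul_le_mul_of_nonneg_right b1 g1)
  have d2 := c2.trans (mul_le_mul_of_nonneg_right
    ((mul_assoc _ _ _).symm.le.trans (mul_le_mul_of_nonneg_right b2 hn0)) g2)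
  have tri : ‖μ ω t - ustar t‖ ≤ ‖μ ω t - uX t‖ + ‖uX t - ustar t‖ := norm_sub_le_norm_sub_add_norm_sub _ _ _
  rw [Set.mem_ofPred_eq, Real.rpow_natCast, Real.rpow_natCast, ← mul_pow]
  refine (tri.trans (add_le_add d1 d2)).trans (le_of_eq ?_)
  ring
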